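/- Let $n\ge 2$, $d=n+1$, and let $(M^{d},[g])$ be a smooth manifold with a conformal class $[g]=\{e^{2\omega}g\}$ of smooth Riemannian metrics. For $w\in\mathbb R$ let $\mathcal E[w]$ be the line bundle of conformal densities of weight $w$: a section $\sigma$ is represented in the scale $g$ by a function $\sigma_g$, with $\sigma_{e^{2\omega}g}=e^{w\omega}\sigma_g$. Let $\boldsymbol g$ be the conformal metric, a section of $S^2T^*M\otimes\mathcal E[2]$. For a metric $g$ in the class let $\nabla$ be its Levi-Civita connection, $\Delta=-g^{ab}\nabla_a\nabla_b$, and let the Schouten tensor $P$ and its trace $J=g^{ab}P_{ab}$ be given by $\mathrm{Ric}=(d-2)P+Jg$. The standard tractor bundle $\mathcal T$ is the quotient of the 2-jet bundle $J^2\mathcal E[1]$ by the trace-free part $S^2_0T^*M\otimes\mathcal E[1]$ of $S^2T^*M\otimes\mathcal E[1]\subset J^2\mathcal E[1]$. The operator $D:\mathcal E[1]\to\mathcal T$ is $j^2$ followed by the projection. Each $g$ in the class gives an isomorphism $\mathcal T\cong\mathcal E[1]\oplus T^*M[1]\oplus\mathcal E[-1]$ in which $D\sigma=(\sigma,\nabla_a\sigma,\tfrac1d(\Delta\sigma-J\sigma))$.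 In it the canonical tractor $X:\mathcal E[-1]\to\mathcal T$, viewed as a section of $\mathcal T\otimes\mathcal E[1]$, is $(0,0,1)$, the tractor metric is $h((\sigma,\mu,\rho),(\sigma,\mu,\rho))=\boldsymbol g^{-1}(\mu,\mu)+2\sigma\rho$, and the normal tractor connection is $$\nabla^{\mathcal T}_a(\sigma,\mu_b,\rho)=(\nabla_a\sigma-\mu_a,\ \nabla_a\mu_b+\boldsymbol g_{ab}\rho+P_{ab}\sigma,\ \nabla_a\rho-P_{ab}\mu^b);$$ write $|I|^2=h(I,I)$. A directed almost Einstein structure on $(M,[g])$ is a smooth section $\sigma\not\equiv0$ of $\mathcal E[1]$ for which the trace-free part of $\nabla_a\nabla_b\sigma+P_{ab}\sigma$ vanishes. A directed almost scalar constant structure is a smooth section $\sigma\not\equiv0$ of $\mathcal E[1]$ for which $S([g],\sigma)=\tfrac2d\,\sigma(J-\Delta)\sigma-|\nabla\sigma|^2_{\boldsymbol g}$ is constant. (All these notions may be computed in any metric of the class.) Then: 1. $\sigma\mapsto D\sigma$ is a bijection from the directed almost Einstein structures on $(M,[g])$ onto the smooth parallel sections $I\not\equiv0$ of $\mathcal T$,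 with inverse $I\mapsto\sigma:=h(I,X)$. 2. If $I\not\equiv0$ is a smooth parallel section of $\mathcal T$ and $\sigma:=h(I,X)$, then $S([g],\sigma)=-|I|^2$, and if $M$ is connected this is constant, so that $(M,[g],\sigma)$ is almost scalar constant. 3. In the situation of 2, on the open set where $\sigma\ne0$ the metric $g^o:=\sigma^{-2}\boldsymbol g$ is Einstein, with $\mathrm{Ric}^{g^o}=-n\,|I|^2\,g^o$. -/

import Mathlib

open scoped Manifold ContDiff Topology
open Bundle

noncomputable section

namespace Tractor

/-! ### Tensor calculus in coordinates

`G : E → Matrix` is the matrix field of a metric in local coordinates on `E = ℝᵈ`. -/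

/-- The model space `ℝᵈ`. -/
abbrev Model (d : ℕ) : Type := EuclideanSpace ℝ (Fin d)

/-- The standard basis of `ℝᵈ`. -/
abbrev stdVec {d : ℕ} (i : Fin d) : Model d := EuclideanSpace.single i (1 : ℝ)

/-- The partial derivative `∂ᵢ u`. -/
def pd {d : ℕ} (i : Fin d) (u : Model d → ℝ) (y : Model d) : ℝ := fderiv ℝ u y (stdVec i)

/-- Christoffel symbols `Γᵏᵢⱼ` of the Levi-Civita connection. -/
def christoffel {d : ℕ} (G : Model d → Matrix (Fin d) (Fin d) ℝ) (k i j : Fin d) (y : Model d) : ℝ :=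
  1 / 2 * ∑ l, (G y)⁻¹ k l *
    (pd i (fun z => G z j l) y + pd j (fun z => G z i l) y - pd l (fun z => G z i j) y)

/-- The curvature `R_{ij}{}^k{}_l`, with `(∇ᵢ∇ⱼ - ∇ⱼ∇ᵢ) Vᵏ = R_{ij}{}^k{}_l Vˡ`. -/
def riemann {d : ℕ} (G : Model d → Matrix (Fin d) (Fin d) ℝ) (i j k l : Fin d) (y : Model d) : ℝ :=
  pd i (christoffel G k j l) y - pd j (christoffel G k i l) y +
    ∑ m, (christoffel G k i m y * christoffel G m j l y -
      christoffel G k j m y * christoffel G m i l y)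

/-- `Ric_{ij} = R_{ki}{}^k{}_j`. -/
def coordRicci {d : ℕ} (G : Model d → Matrix (Fin d) (Fin d) ℝ) (y : Model d) :
    Matrix (Fin d) (Fin d) ℝ :=
  Matrix.of fun i j => ∑ k, riemann G k i k j y

/-- The second covariant derivative `∇ᵢ∇ⱼ u` of a function. -/
def coordHess {d : ℕ} (G : Model d → Matrix (Fin d) (Fin d) ℝ) (u : Model d → ℝ) (y : Model d) :
    Matrix (Fin d) (Fin d) ℝ :=
  Matrix.of fun i j => pd i (pd j u) y - ∑ k, christoffel G k i j y * pd k u y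

/-- The covariant derivative `∇ᵢ μⱼ` of a one-form. -/
def coordCov {d : ℕ} (G : Model d → Matrix (Fin d) (Fin d) ℝ) (μ : Fin d → Model d → ℝ)
    (y : Model d) : Matrix (Fin d) (Fin d) ℝ :=
  Matrix.of fun i j => pd i (μ j) y - ∑ k, christoffel G k i j y * μ k y

/-! ### Tensors on a manifold

The components at `x` are taken in the preferred chart at `x`; its coordinate frame at `x` is the
standard basis of `TangentSpace (𝓡 d) x = ℝᵈ`. -/

section Manifold

variable {d : ℕ} {M : Type*} [TopologicalSpace M] [ChartedSpace (Model d) M]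

/-- Fields of (continuous) bilinear forms on the tangent spaces. -/
abbrev BilinField (d : ℕ) (M : Type*) [TopologicalSpace M] [ChartedSpace (Model d) M] :=
  ∀ x : M, TangentSpace (𝓡 d) x →L[ℝ] TangentSpace (𝓡 d) x →L[ℝ] ℝ

/-- The cotangent space `T*ₓM`. -/
abbrev Cotangent (d : ℕ) {M : Type*} [TopologicalSpace M] [ChartedSpace (Model d) M] (x : M) :=
  TangentSpace (𝓡 d) x →L[ℝ] ℝ

/-- The coordinate vector `∂ᵢ` at `x`, for the chart at `x`. -/
def frame (x : M) (i : Fin d) : TangentSpace (𝓡 d) x := (stdVec i : Model d)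

/-- The coordinates of a tangent vector at `x`, for the chart at `x`. -/
def coords {x : M} (v : TangentSpace (𝓡 d) x) (i : Fin d) : ℝ := (show Model d from v) i

/-- The coordinate representation of a function in the chart at `x`. -/
def chartFun (x : M) (f : M → ℝ) : Model d → ℝ := f ∘ (extChartAt (𝓡 d) x).symm

/-- The coordinates of `x` in the chart at `x`. -/
def origin (d : ℕ) {M : Type*} [TopologicalSpace M] [ChartedSpace (Model d) M] (x : M) : Model d :=
  extChartAt (𝓡 d) x x

/-- The coordinate vector field `∂ᵢ` of the chart at `x`, at the point with coordinates `y`. -/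
def chartVec (x : M) (i : Fin d) (y : Model d) :
    TangentSpace (𝓡 d) ((extChartAt (𝓡 d) x).symm y) :=
  mfderiv 𝓘(ℝ, Model d) (𝓡 d) (extChartAt (𝓡 d) x).symm y (stdVec i : Model d)

/-- The components of a bilinear form field in the chart at `x`. -/
def chartMetric (b : BilinField d M) (x : M) (y : Model d) : Matrix (Fin d) (Fin d) ℝ :=
  Matrix.of fun i j => b ((extChartAt (𝓡 d) x).symm y) (chartVec x i y) (chartVec x j y)

/-- The components of a one-form in the chart at `x`. -/
def chartForm (μ : ∀ x : M, Cotangent d x) (x : M) (i : Fin d) (y : Model d) : ℝ :=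
  μ ((extChartAt (𝓡 d) x).symm y) (chartVec x i y)

/-- The matrix `b_{ij}` at `x`. -/
def metricAt (b : BilinField d M) (x : M) : Matrix (Fin d) (Fin d) ℝ :=
  chartMetric b x (origin d x)

/-- The matrix `Ric_{ij}` at `x` of the metric `b`. -/
def ricciAt (b : BilinField d M) (x : M) : Matrix (Fin d) (Fin d) ℝ :=
  coordRicci (chartMetric b x) (origin d x)

/-- The `b`-trace `b^{ij} T_{ij}` at `x` of a 2-tensor. -/
def trace (b : BilinField d M) (x : M) (T : Matrix (Fin d) (Fin d) ℝ) : ℝ :=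
  ∑ i, ∑ j, (metricAt b x)⁻¹ i j * T i j

/-- The inner product `b^{ij} μᵢ νⱼ` of covectors at `x`. -/
def coInner (b : BilinField d M) (x : M) (μ ν : Cotangent d x) : ℝ :=
  ∑ i, ∑ j, (metricAt b x)⁻¹ i j * (μ (frame x i) * ν (frame x j))

/-- `J = Sc / (2 (d - 1))`, the trace of the Schouten tensor. -/
def schoutenTrace (b : BilinField d M) (x : M) : ℝ :=
  trace b x (ricciAt b x) / (2 * ((d : ℝ) - 1))

/-- The Schouten tensor `P`, given by `Ric = (d - 2) P + J b`. -/
def schouten (b : BilinField d M) (x : M) : Matrix (Fin d) (Fin d) ℝ :=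
  ((d : ℝ) - 2)⁻¹ • (ricciAt b x - schoutenTrace b x • metricAt b x)

/-- The second derivatives `∂ᵢ∂ⱼ f` at `x`. -/
def secondDeriv (f : M → ℝ) (x : M) : Matrix (Fin d) (Fin d) ℝ :=
  Matrix.of fun i j => pd i (pd j (chartFun x f)) (origin d x)

/-- The Hessian `∇ᵢ∇ⱼ f` at `x`. -/
def hess (b : BilinField d M) (f : M → ℝ) (x : M) : Matrix (Fin d) (Fin d) ℝ :=
  coordHess (chartMetric b x) (chartFun x f) (origin d x)

/-- The Laplacian with nonnegative spectrum, `Δ f = - b^{ij} ∇ᵢ∇ⱼ f`. -/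
def laplacian (b : BilinField d M) (f : M → ℝ) (x : M) : ℝ := - trace b x (hess b f x)

/-- The covariant derivative `∇ᵢ μⱼ` at `x` of a one-form. -/
def covForm (b : BilinField d M) (μ : ∀ x : M, Cotangent d x) (x : M) :
    Matrix (Fin d) (Fin d) ℝ :=
  coordCov (chartMetric b x) (chartForm μ x) (origin d x)

/-- The differential of a function at `x`, as a covector. -/
def diff (d : ℕ) {M : Type*} [TopologicalSpace M] [ChartedSpace (Model d) M] (f : M → ℝ) (x : M) :
    Cotangent d x :=
  mfderiv (𝓡 d) 𝓘(ℝ, ℝ) f x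

/-- The covector `w ↦ T_{ij} vⁱ wʲ` at `x`. -/
def contract (x : M) (T : Matrix (Fin d) (Fin d) ℝ) (v : TangentSpace (𝓡 d) x) : Cotangent d x :=
  (∑ j, (∑ i, coords v i * T i j) • (EuclideanSpace.proj j : Model d →L[ℝ] ℝ) : Model d →L[ℝ] ℝ)

/-- `A(b, s)`, the trace-free part of `∇∇s + s P`. -/
def obstructionA (b : BilinField d M) (s : M → ℝ) (x : M) : Matrix (Fin d) (Fin d) ℝ :=
  (hess b s x + s x • schouten b x) -
    ((d : ℝ)⁻¹ * trace b x (hess b s x + s x • schouten b x)) • metricAt b x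

/-- `S(b, s) = (2/d) s (J - Δ) s - |ds|²`. -/
def scalarS (b : BilinField d M) (s : M → ℝ) (x : M) : ℝ :=
  2 / (d : ℝ) * s x * (schoutenTrace b x * s x - laplacian b s x) -
    coInner b x (diff d s x) (diff d s x)

/-! ### Derivatives up to second order at a point -/

lemma contDiffAt_chartFun {x : M} {f : M → ℝ} (hf : ContMDiffAt (𝓡 d) 𝓘(ℝ, ℝ) ∞ f x) :
    ContDiffAt ℝ ∞ (chartFun x f) (origin d x) := by
  have := (contMDiffAt_iff_source (I := 𝓡 d)).1 hf
  rw [modelWithCornersSelf_coe, Set.range_id, contMDiffWithinAt_univ,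
    contMDiffAt_iff_contDiffAt] at this
  exact this

lemma chartFun_origin (x : M) (f : M → ℝ) : chartFun x f (origin d x) = f x := by
  simp [chartFun, origin]

lemma diff_frame {x : M} {f : M → ℝ} (hf : ContMDiffAt (𝓡 d) 𝓘(ℝ, ℝ) ∞ f x) (i : Fin d) :
    diff d f x (frame x i) = pd i (chartFun x f) (origin d x) := by
  have h := hf.mdifferentiableAt (by simp)
  rw [diff, h.mfderiv]
  simp [frame, pd, chartFun, origin, writtenInExtChartAt]
  rfl

lemma pd_add {i : Fin d} {u v : Model d → ℝ} {y : Model d} (hu : DifferentiableAt ℝ u y)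
    (hv : DifferentiableAt ℝ v y) : pd i (u + v) y = pd i u y + pd i v y := by
  simp [pd, fderiv_add hu hv]

lemma pd_smul {i : Fin d} {u : Model d → ℝ} {y : Model d} (r : ℝ)
    (hu : DifferentiableAt ℝ u y) : pd i (r • u) y = r * pd i u y := by
  simp [pd, fderiv_const_smul hu]

lemma pd_mul {i : Fin d} {u v : Model d → ℝ} {y : Model d} (hu : DifferentiableAt ℝ u y)
    (hv : DifferentiableAt ℝ v y) : pd i (u * v) y = u y * pd i v y + v y * pd i u y := by
  simp [pd, fderiv_mul hu hv]

lemma eventually_differentiableAt {u : Model d → ℝ} {y : Model d} (hu : ContDiffAt ℝ ∞ u y) :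
    ∀ᶠ z in 𝓝 y, DifferentiableAt ℝ u z := by
  have h1 : ContDiffAt ℝ 1 u y := hu.of_le (by exact_mod_cast le_top)
  filter_upwards [h1.eventually (by simp)] with z hz using hz.differentiableAt (by simp)

lemma differentiableAt_pd {u : Model d → ℝ} {y : Model d} (hu : ContDiffAt ℝ ∞ u y) (i : Fin d) :
    DifferentiableAt ℝ (pd i u) y := by
  have h2 : ContDiffAt ℝ 1 (fderiv ℝ u) y := hu.fderiv_right (m := 1) (by norm_cast)
  exact (h2.differentiableAt (by simp)).clm_apply (differentiableAt_const _)

lemma pd_congr {i : Fin d} {u v : Model d → ℝ} {y : Model d} (h : u =ᶠ[𝓝 y] v) :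
    pd i u y = pd i v y := by
  simp [pd, h.fderiv_eq]

lemma pd_pd_add {i j : Fin d} {u v : Model d → ℝ} {y : Model d} (hu : ContDiffAt ℝ ∞ u y)
    (hv : ContDiffAt ℝ ∞ v y) : pd i (pd j (u + v)) y = pd i (pd j u) y + pd i (pd j v) y := by
  rw [← pd_add (differentiableAt_pd hu j) (differentiableAt_pd hv j)]
  apply pd_congr
  filter_upwards [eventually_differentiableAt hu, eventually_differentiableAt hv] with z h1 h2
  exact pd_add h1 h2

lemma pd_pd_smul {i j : Fin d} {u : Model d → ℝ} {y : Model d} (r : ℝ)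
    (hu : ContDiffAt ℝ ∞ u y) : pd i (pd j (r • u)) y = r * pd i (pd j u) y := by
  rw [← pd_smul r (differentiableAt_pd hu j)]
  apply pd_congr
  filter_upwards [eventually_differentiableAt hu] with z h1
  exact pd_smul r h1

lemma pd_pd_mul {i j : Fin d} {a u : Model d → ℝ} {y : Model d} (ha : ContDiffAt ℝ ∞ a y)
    (hu : ContDiffAt ℝ ∞ u y) (h0 : u y = 0) (h1 : ∀ k, pd k u y = 0) :
    pd i (pd j (a * u)) y = a y * pd i (pd j u) y := by
  have h : pd j (a * u) =ᶠ[𝓝 y] a * pd j u + u * pd j a := by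
    filter_upwards [eventually_differentiableAt ha, eventually_differentiableAt hu] with z hz1 hz2
    simpa using pd_mul hz1 hz2
  have ha1 := ha.differentiableAt (by simp)
  have hu1 := hu.differentiableAt (by simp)
  rw [pd_congr h, pd_add (ha1.mul (differentiableAt_pd hu j)) (hu1.mul (differentiableAt_pd ha j)),
    pd_mul ha1 (differentiableAt_pd hu j), pd_mul hu1 (differentiableAt_pd ha j)]
  simp [h0, h1]

lemma frame_ne_zero [NeZero d] (x : M) : frame (d := d) x 0 ≠ 0 := by
  intro h0
  have : (stdVec (0 : Fin d) : Model d) = 0 := h0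
  simp [stdVec] at this

lemma diff_add {x : M} {f f' : M → ℝ} (hf : ContMDiffAt (𝓡 d) 𝓘(ℝ, ℝ) ∞ f x)
    (hf' : ContMDiffAt (𝓡 d) 𝓘(ℝ, ℝ) ∞ f' x) : diff d (f + f') x = diff d f x + diff d f' x :=
  mfderiv_add (hf.mdifferentiableAt (by simp)) (hf'.mdifferentiableAt (by simp))

lemma diff_mul {x : M} {f f' : M → ℝ} (hf : ContMDiffAt (𝓡 d) 𝓘(ℝ, ℝ) ∞ f x)
    (hf' : ContMDiffAt (𝓡 d) 𝓘(ℝ, ℝ) ∞ f' x) :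
    diff d (f * f') x = f x • diff d f' x + f' x • diff d f x :=
  ((hf.mdifferentiableAt (by simp)).hasMFDerivAt.mul
    (hf'.mdifferentiableAt (by simp)).hasMFDerivAt).mfderiv

lemma diff_smul {x : M} {f : M → ℝ} (r : ℝ) (hf : ContMDiffAt (𝓡 d) 𝓘(ℝ, ℝ) ∞ f x) :
    diff d (r • f) x = r • diff d f x :=
  const_smul_mfderiv (hf.mdifferentiableAt (by simp)) r

lemma secondDeriv_add {x : M} {f f' : M → ℝ} (hf : ContMDiffAt (𝓡 d) 𝓘(ℝ, ℝ) ∞ f x)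
    (hf' : ContMDiffAt (𝓡 d) 𝓘(ℝ, ℝ) ∞ f' x) :
    secondDeriv (d := d) (f + f') x = secondDeriv f x + secondDeriv f' x := by
  ext i j
  exact pd_pd_add (contDiffAt_chartFun hf) (contDiffAt_chartFun hf')

lemma secondDeriv_smul {x : M} {f : M → ℝ} (r : ℝ) (hf : ContMDiffAt (𝓡 d) 𝓘(ℝ, ℝ) ∞ f x) :
    secondDeriv (d := d) (r • f) x = r • secondDeriv f x := by
  ext i j
  exact pd_pd_smul r (contDiffAt_chartFun hf)

lemma trace_add (b : BilinField d M) (x : M) (T U : Matrix (Fin d) (Fin d) ℝ) :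
    trace b x (T + U) = trace b x T + trace b x U := by
  simp [trace, mul_add, Finset.sum_add_distrib]

lemma trace_smul (b : BilinField d M) (x : M) (r : ℝ) (T : Matrix (Fin d) (Fin d) ℝ) :
    trace b x (r • T) = r * trace b x T := by
  simp [trace, Finset.mul_sum, mul_left_comm]

lemma hess_eq {b : BilinField d M} {x : M} {f : M → ℝ}
    (hf : ContMDiffAt (𝓡 d) 𝓘(ℝ, ℝ) ∞ f x) :
    hess b f x = secondDeriv f x - Matrix.of fun i j =>
      ∑ k, christoffel (chartMetric b x) k i j (origin d x) * diff d f x (frame x k) := by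
  ext i j
  simp [hess, coordHess, secondDeriv, diff_frame hf]

lemma hess_add {b : BilinField d M} {x : M} {f f' : M → ℝ}
    (hf : ContMDiffAt (𝓡 d) 𝓘(ℝ, ℝ) ∞ f x) (hf' : ContMDiffAt (𝓡 d) 𝓘(ℝ, ℝ) ∞ f' x) :
    hess b (f + f') x = hess b f x + hess b f' x := by
  rw [hess_eq (hf.add hf'), hess_eq hf, hess_eq hf', secondDeriv_add hf hf', diff_add hf hf']
  ext i j
  simp [mul_add, Finset.sum_add_distrib]
  ring

lemma hess_smul {b : BilinField d M} {x : M} {f : M → ℝ} (r : ℝ)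
    (hf : ContMDiffAt (𝓡 d) 𝓘(ℝ, ℝ) ∞ f x) : hess b (r • f) x = r • hess b f x := by
  have hrf : ContMDiffAt (𝓡 d) 𝓘(ℝ, ℝ) ∞ (r • f) x := contMDiffAt_const.mul hf
  rw [hess_eq hrf, hess_eq hf, secondDeriv_smul r hf, diff_smul r hf]
  ext i j
  simp [mul_sub, Finset.mul_sum, mul_left_comm]

/-! ### Conformal structures and densities -/

variable [IsManifold (𝓡 d) ∞ M]

/-- Smooth Riemannian metrics. -/
abbrev Metric (d : ℕ) (M : Type*) [TopologicalSpace M] [ChartedSpace (Model d) M]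
    [IsManifold (𝓡 d) ∞ M] :=
  ContMDiffRiemannianMetric (𝓡 d) ∞ (Model d) (fun x : M => TangentSpace (𝓡 d) x)

/-- `g' = e^{2υ} g` for a smooth function `υ`. -/
def ConformallyRelated (g g' : Metric d M) : Prop :=
  ∃ υ : M → ℝ, ContMDiff (𝓡 d) 𝓘(ℝ, ℝ) ∞ υ ∧
    ∀ x v w, g'.inner x v w = Real.exp (2 * υ x) * g.inner x v w

/-- A conformal structure `[g]`: an equivalence class of conformally related metrics. -/
structure ConformalStructure (d : ℕ) (M : Type*) [TopologicalSpace M] [ChartedSpace (Model d) M]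
    [IsManifold (𝓡 d) ∞ M] where
  metrics : Set (Metric d M)
  nonempty : metrics.Nonempty
  mem_iff : ∀ g ∈ metrics, ∀ g', g' ∈ metrics ↔ ConformallyRelated g g'

/-- The fibre at `x` of the density bundle `ℰ[w]`: functions on the metrics of the conformal class
whose value depends on the metric at `x` only and is homogeneous, i.e. `φ(e^{2t} g) = e^{wt} φ(g)`.
-/
def Density (c : ConformalStructure d M) (w : ℝ) (x : M) : Submodule ℝ (c.metrics → ℝ) where
  carrier := {φ | ∀ g g' : c.metrics, ∀ t : ℝ,
    (∀ v u, g'.1.inner x v u = Real.exp (2 * t) * g.1.inner x v u) →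
      φ g' = Real.exp (w * t) * φ g}
  add_mem' {φ ψ} hφ hψ g g' t h := by simp [hφ g g' t h, hψ g g' t h, mul_add]
  zero_mem' := by simp
  smul_mem' r φ hφ g g' t h := by simp [hφ g g' t h]; ring

/-- The function that represents a section of `ℰ[w]` in the scale `g`. -/
def inScale {c : ConformalStructure d M} (g : c.metrics) (σ : M → c.metrics → ℝ) : M → ℝ :=
  fun x => σ x g

/-- The smooth sections of `ℰ[w]`. -/
def SmoothDensity (c : ConformalStructure d M) (w : ℝ) : Submodule ℝ (M → c.metrics → ℝ) where
  carrier := {σ | (∀ x, σ x ∈ Density c w x) ∧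
    ∀ g : c.metrics, ContMDiff (𝓡 d) 𝓘(ℝ, ℝ) ∞ (inScale g σ)}
  add_mem' hσ hτ := ⟨fun x => add_mem (hσ.1 x) (hτ.1 x), fun g => (hσ.2 g).add (hτ.2 g)⟩
  zero_mem' := ⟨fun _ => zero_mem _, fun _ => contMDiff_const⟩
  smul_mem' r _ hσ :=
    ⟨fun x => Submodule.smul_mem _ r (hσ.1 x), fun g => contMDiff_const.mul (hσ.2 g)⟩

/-- The sections of `ℰ[1]` that are smooth near `x`. -/
def LocalDensity (c : ConformalStructure d M) (x : M) : Submodule ℝ (M → c.metrics → ℝ) where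
  carrier := {σ | (∀ y, σ y ∈ Density c 1 y) ∧
    ∀ g : c.metrics, ∀ᶠ y in 𝓝 x, ContMDiffAt (𝓡 d) 𝓘(ℝ, ℝ) ∞ (inScale g σ) y}
  add_mem' hσ hτ := ⟨fun x => add_mem (hσ.1 x) (hτ.1 x), fun g => by
    filter_upwards [hσ.2 g, hτ.2 g] with y h1 h2 using h1.add h2⟩
  zero_mem' := ⟨fun _ => zero_mem _, fun _ => Filter.Eventually.of_forall fun _ => contMDiffAt_const⟩
  smul_mem' r _ hσ := ⟨fun x => Submodule.smul_mem _ r (hσ.1 x), fun g => by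
    filter_upwards [hσ.2 g] with y h1 using contMDiffAt_const.mul h1⟩

/-! ### The standard tractor bundle -/

section Tractor

variable {c : ConformalStructure d M}

lemma LocalDensity.smooth {x : M} (σ : LocalDensity c x) (g : c.metrics) :
    ContMDiffAt (𝓡 d) 𝓘(ℝ, ℝ) ∞ (inScale g σ.1) x :=
  (σ.2.2 g).self_of_nhds

/-- The local sections of `ℰ[1]` whose 2-jet at `x` vanishes. -/
def jetKernel (c : ConformalStructure d M) (x : M) : Submodule ℝ (LocalDensity c x) where
  carrier := {σ | ∀ g : c.metrics, inScale g σ.1 x = 0 ∧ diff d (inScale g σ.1) x = 0 ∧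
    secondDeriv (d := d) (inScale g σ.1) x = 0}
  add_mem' {σ τ} hσ hτ g := by
    obtain ⟨h1, h2, h3⟩ := hσ g
    obtain ⟨k1, k2, k3⟩ := hτ g
    have e : inScale g (σ + τ).1 = inScale g σ.1 + inScale g τ.1 := rfl
    rw [e, diff_add (LocalDensity.smooth σ g) (LocalDensity.smooth τ g), secondDeriv_add (LocalDensity.smooth σ g) (LocalDensity.smooth τ g)]
    simp [h1, h2, h3, k1, k2, k3]
  zero_mem' g := by
    have e : inScale g (0 : LocalDensity c x).1 = (0 : ℝ) • inScale g (0 : LocalDensity c x).1 := by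
      ext y; simp [inScale]
    rw [e, diff_smul _ (LocalDensity.smooth 0 g), secondDeriv_smul _ (LocalDensity.smooth 0 g)]
    simp
  smul_mem' r σ hσ g := by
    obtain ⟨h1, h2, h3⟩ := hσ g
    have e : inScale g (r • σ).1 = r • inScale g σ.1 := rfl
    rw [e, diff_smul r (LocalDensity.smooth σ g), secondDeriv_smul r (LocalDensity.smooth σ g)]
    simp [h1, h2, h3]

/-- The fibre at `x` of the bundle of 2-jets `J² ℰ[1]`. -/
abbrev Jet2 (c : ConformalStructure d M) (x : M) : Type _ := LocalDensity c x ⧸ jetKernel c x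

/-- The local sections of `ℰ[1]` whose 1-jet at `x` vanishes and whose second derivative at `x`, an
element of `S²T*ₓM ⊗ ℰ[1]ₓ`, is trace-free. -/
def traceFreeGerms (c : ConformalStructure d M) (x : M) : Submodule ℝ (LocalDensity c x) where
  carrier := {σ | ∀ g : c.metrics, inScale g σ.1 x = 0 ∧ diff d (inScale g σ.1) x = 0 ∧
    trace g.1.inner x (secondDeriv (inScale g σ.1) x) = 0}
  add_mem' {σ τ} hσ hτ g := by
    obtain ⟨h1, h2, h3⟩ := hσ g
    obtain ⟨k1, k2, k3⟩ := hτ g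
    have e : inScale g (σ + τ).1 = inScale g σ.1 + inScale g τ.1 := rfl
    rw [e, diff_add (LocalDensity.smooth σ g) (LocalDensity.smooth τ g), secondDeriv_add (LocalDensity.smooth σ g) (LocalDensity.smooth τ g), trace_add]
    simp [h1, h2, h3, k1, k2, k3]
  zero_mem' g := by
    have e : inScale g (0 : LocalDensity c x).1 = (0 : ℝ) • inScale g (0 : LocalDensity c x).1 := by
      ext y; simp [inScale]
    rw [e, diff_smul _ (LocalDensity.smooth 0 g), secondDeriv_smul _ (LocalDensity.smooth 0 g),
      trace_smul]
    simp
  smul_mem' r σ hσ g := by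
    obtain ⟨h1, h2, h3⟩ := hσ g
    have e : inScale g (r • σ).1 = r • inScale g σ.1 := rfl
    rw [e, diff_smul r (LocalDensity.smooth σ g), secondDeriv_smul r (LocalDensity.smooth σ g), trace_smul]
    simp [h1, h2, h3]

/-- The image of `S²₀T*ₓM ⊗ ℰ[1]ₓ` in `J²ₓ ℰ[1]`. -/
def traceFreeJets (c : ConformalStructure d M) (x : M) : Submodule ℝ (Jet2 c x) :=
  (traceFreeGerms c x).map (jetKernel c x).mkQ

/-- The fibre at `x` of the standard tractor bundle, `J² ℰ[1]` modulo `S²₀T*M ⊗ ℰ[1]`. -/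
abbrev TractorFibre (c : ConformalStructure d M) (x : M) : Type _ := Jet2 c x ⧸ traceFreeJets c x

/-- The canonical projection of a local section of `ℰ[1]` to its tractor at `x`. -/
def toTractor (c : ConformalStructure d M) (x : M) : LocalDensity c x →ₗ[ℝ] TractorFibre c x :=
  (traceFreeJets c x).mkQ ∘ₗ (jetKernel c x).mkQ

/-- The tautological operator `D` from smooth sections of `ℰ[1]` to tractors. -/
def tractorD (c : ConformalStructure d M) (σ : SmoothDensity c 1) (x : M) : TractorFibre c x :=
  toTractor c x ⟨σ.1, σ.2.1, fun g => Filter.Eventually.of_forall fun y => (σ.2.2 g) y⟩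

/-- `σ ↦ (σ, ∇σ, (1/d)(Δσ - Jσ))` at `x`, in the scale `g`. -/
def jetSplit (c : ConformalStructure d M) (g : c.metrics) (x : M) :
    LocalDensity c x →ₗ[ℝ] ℝ × Cotangent d x × ℝ where
  toFun σ := (inScale g σ.1 x, diff d (inScale g σ.1) x,
    (d : ℝ)⁻¹ * (laplacian g.1.inner (inScale g σ.1) x -
      schoutenTrace g.1.inner x * inScale g σ.1 x))
  map_add' σ τ := by
    have e : inScale g (σ + τ).1 = inScale g σ.1 + inScale g τ.1 := rfl
    rw [e, diff_add (LocalDensity.smooth σ g) (LocalDensity.smooth τ g), laplacian, hess_add (LocalDensity.smooth σ g) (LocalDensity.smooth τ g),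
      trace_add]
    simp [laplacian]
    ring
  map_smul' r σ := by
    have e : inScale g (r • σ).1 = r • inScale g σ.1 := rfl
    rw [e, diff_smul r (LocalDensity.smooth σ g), laplacian, hess_smul r (LocalDensity.smooth σ g), trace_smul]
    simp [laplacian]
    ring

lemma jetSplit_eq_zero (g : c.metrics) {x : M} {σ : LocalDensity c x}
    (h0 : inScale g σ.1 x = 0) (h1 : diff d (inScale g σ.1) x = 0)
    (h2 : trace g.1.inner x (secondDeriv (inScale g σ.1) x) = 0) : jetSplit c g x σ = 0 := by
  have h : hess g.1.inner (inScale g σ.1) x = secondDeriv (inScale g σ.1) x := by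
    rw [hess_eq (LocalDensity.smooth σ g)]
    ext i j
    simp [h1]
  simp [jetSplit, h0, h1, laplacian, h, h2]

/-- The components `(σ, μ, ρ)` of a tractor at `x` in the scale `g`. -/
def splitMap (c : ConformalStructure d M) (g : c.metrics) (x : M) :
    TractorFibre c x →ₗ[ℝ] ℝ × Cotangent d x × ℝ :=
  (traceFreeJets c x).liftQ
    ((jetKernel c x).liftQ (jetSplit c g x) (fun σ hσ => by
      obtain ⟨h0, h1, h2⟩ := hσ g
      exact jetSplit_eq_zero g h0 h1 (by simp [h2, trace])))
    (by
      rintro _ ⟨σ, hσ, rfl⟩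
      obtain ⟨h0, h1, h2⟩ := hσ g
      simpa using jetSplit_eq_zero g h0 h1 h2)

lemma splitMap_toTractor (g : c.metrics) (x : M) (σ : LocalDensity c x) :
    splitMap c g x (toTractor c x σ) = jetSplit c g x σ := rfl

lemma toTractor_surjective (x : M) : Function.Surjective (toTractor c x) :=
  (Submodule.mkQ_surjective _).comp (Submodule.mkQ_surjective _)

lemma inScale_eq {w : ℝ} {g g' : c.metrics} {υ : M → ℝ}
    (h : ∀ x v u, g'.1.inner x v u = Real.exp (2 * υ x) * g.1.inner x v u)
    {σ : M → c.metrics → ℝ} (hσ : ∀ x, σ x ∈ Density c w x) (x : M) :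
    inScale g' σ x = Real.exp (w * υ x) * inScale g σ x :=
  hσ x g g' (υ x) (h x)

lemma metricAt_conformal {g g' : c.metrics} {υ : M → ℝ}
    (h : ∀ x v u, g'.1.inner x v u = Real.exp (2 * υ x) * g.1.inner x v u) (x : M) :
    metricAt g'.1.inner x = Real.exp (2 * υ x) • metricAt g.1.inner x := by
  ext i j
  have e : (extChartAt (𝓡 d) x).symm (origin d x) = x := extChartAt_to_inv x
  simp only [metricAt, chartMetric, Matrix.of_apply, Matrix.smul_apply, h, smul_eq_mul]
  rw [e]

lemma isUnit_det_metricAt (g : Metric d M) (x : M) : IsUnit (metricAt g.inner x).det := by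
  rw [isUnit_iff_ne_zero]
  intro h0
  obtain ⟨v, hv, hM⟩ := Matrix.exists_mulVec_eq_zero_iff.2 h0
  set L : Model d →L[ℝ] TangentSpace (𝓡 d) ((extChartAt (𝓡 d) x).symm (origin d x)) :=
    mfderiv 𝓘(ℝ, Model d) (𝓡 d) (extChartAt (𝓡 d) x).symm (origin d x) with hL
  have hinj : Function.Injective L := by
    have := isInvertible_mfderivWithin_extChartAt_symm (I := 𝓡 d) (x := x)
      (y := origin d x) (mem_extChartAt_target x)
    rw [modelWithCornersSelf_coe, Set.range_id, mfderivWithin_univ] at this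
    exact this.injective
  set V : Model d := ∑ i, v i • stdVec i with hV
  have hVi : ∀ i, V i = v i := by
    intro i
    simp [hV, stdVec, Pi.single_apply]
  have hV0 : V ≠ 0 := by
    intro hz
    apply hv
    ext i
    rw [← hVi i, hz]
    rfl
  have hpos := g.pos _ (L V) (fun hz => hV0 (hinj (by rw [hz, map_zero])))
  have : g.inner _ (L V) (L V) = v ⬝ᵥ (metricAt g.inner x).mulVec v := by
    simp only [hV, map_sum, map_smul, dotProduct, Matrix.mulVec, Finset.mul_sum, sum_apply,
      smul_apply, smul_eq_mul]
    refine Finset.sum_comm.trans (Finset.sum_congr rfl fun i _ => Finset.sum_congr rfl fun j _ => ?_)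
    exact (by intros; ring : ∀ a b c : ℝ, a * (b * c) = b * (c * a)) _ _ _
  rw [this, hM] at hpos
  simp at hpos

lemma trace_metricAt (g : Metric d M) (x : M) : trace g.inner x (metricAt g.inner x) = d := by
  have h := Matrix.nonsing_inv_mul _ (isUnit_det_metricAt g x)
  have hs : ∀ i j, metricAt g.inner x i j = metricAt g.inner x j i := fun i j => g.symm _ _ _
  have : trace g.inner x (metricAt g.inner x) =
      ((metricAt g.inner x)⁻¹ * metricAt g.inner x).trace := by
    simp only [trace, Matrix.trace, Matrix.mul_apply, Matrix.diag_apply]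
    exact Finset.sum_congr rfl fun i _ => Finset.sum_congr rfl fun j _ => by rw [hs i j]
  rw [this, h]
  simp

lemma splitMap_injective [NeZero d] (g : c.metrics) (x : M) :
    Function.Injective (splitMap c g x) := by
  have hd : (d : ℝ) ≠ 0 := by exact_mod_cast NeZero.ne d
  rw [injective_iff_map_eq_zero]
  intro t ht
  obtain ⟨σ, rfl⟩ := toTractor_surjective x t
  rw [splitMap_toTractor] at ht
  have h0 : inScale g σ.1 x = 0 := congrArg Prod.fst ht
  have h1 : diff d (inScale g σ.1) x = 0 := congrArg (fun p => p.2.1) ht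
  have h2 : trace g.1.inner x (secondDeriv (inScale g σ.1) x) = 0 := by
    have h : hess g.1.inner (inScale g σ.1) x = secondDeriv (inScale g σ.1) x := by
      rw [hess_eq (LocalDensity.smooth σ g)]
      ext i j
      simp [h1]
    have h3 : (d : ℝ)⁻¹ * (laplacian g.1.inner (inScale g σ.1) x -
      schoutenTrace g.1.inner x * inScale g σ.1 x) = 0 := congrArg (fun p => p.2.2) ht
    simpa [laplacian, h, h0, hd] using h3
  have hmem : σ ∈ traceFreeGerms c x := by
    intro g'
    obtain ⟨υ, hυ, h⟩ := (c.mem_iff g.1 g.2 g'.1).1 g'.2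
    have e : inScale g' σ.1 = (fun y => Real.exp (υ y)) * inScale g σ.1 := by
      ext y
      simpa using inScale_eq h σ.2.1 y
    have ha : ContMDiffAt (𝓡 d) 𝓘(ℝ, ℝ) ∞ (fun y => Real.exp (υ y)) x :=
      (Real.contDiff_exp.contMDiff.comp hυ) x
    have hk : ∀ k, pd k (chartFun x (inScale g σ.1)) (origin d x) = 0 := fun k => by
      rw [← diff_frame (LocalDensity.smooth σ g), h1]; rfl
    have hu0 : chartFun x (inScale g σ.1) (origin d x) = 0 := by rw [chartFun_origin, h0]
    have e2 : secondDeriv (d := d) (inScale g' σ.1) x =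
        Real.exp (υ x) • secondDeriv (inScale g σ.1) x := by
      ext i j
      rw [e]
      have := pd_pd_mul (i := i) (j := j) (contDiffAt_chartFun ha)
        (contDiffAt_chartFun (LocalDensity.smooth σ g)) hu0 hk
      rw [chartFun_origin] at this
      exact this
    refine ⟨by rw [e]; simp [h0], ?_, ?_⟩
    · rw [e, diff_mul ha (LocalDensity.smooth σ g), h1, h0]
      simp
    · rw [e2, trace_smul]
      have : (metricAt g'.1.inner x)⁻¹ = (Real.exp (2 * υ x))⁻¹ • (metricAt g.1.inner x)⁻¹ := by
        rw [metricAt_conformal h]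
        exact Matrix.inv_smul' _ (Units.mk0 _ (Real.exp_ne_zero (2 * υ x)))
          (isUnit_det_metricAt g.1 x)
      have h3 : trace g'.1.inner x (secondDeriv (inScale g σ.1) x) =
          (Real.exp (2 * υ x))⁻¹ * trace g.1.inner x (secondDeriv (inScale g σ.1) x) := by
        simp [trace, this, Finset.mul_sum, mul_assoc]
      rw [h3, h2]
      simp
  change (traceFreeJets c x).mkQ _ = 0
  simp only [Submodule.mkQ_apply, Submodule.Quotient.mk_eq_zero]
  exact ⟨σ, hmem, rfl⟩

/-- The logarithmic conformal factor `υ` at `x`, where `g' = e^{2υ} g`. -/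
def logFactor (g g' : c.metrics) (x : M) : ℝ :=
  Classical.choose (show ∃ _ : M → ℝ, _ from (c.mem_iff g.1 g.2 g'.1).1 g'.2) x

lemma contMDiff_logFactor (g g' : c.metrics) : ContMDiff (𝓡 d) 𝓘(ℝ, ℝ) ∞ (logFactor g g') :=
  (Classical.choose_spec (show ∃ _ : M → ℝ, _ from (c.mem_iff g.1 g.2 g'.1).1 g'.2)).1

lemma inner_logFactor (g g' : c.metrics) (x : M) (v u : TangentSpace (𝓡 d) x) :
    g'.1.inner x v u = Real.exp (2 * logFactor g g' x) * g.1.inner x v u :=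
  (Classical.choose_spec (show ∃ _ : M → ℝ, _ from (c.mem_iff g.1 g.2 g'.1).1 g'.2)).2 x v u

/-- The section of `ℰ[w]` that is represented by the function `f` in the scale `g`. -/
def ofScale (c : ConformalStructure d M) (w : ℝ) (g : c.metrics) (f : M → ℝ) :
    M → c.metrics → ℝ :=
  fun x g' => Real.exp (w * logFactor g g' x) * f x

lemma ofScale_mem [NeZero d] (w : ℝ) (g : c.metrics) (f : M → ℝ) (x : M) :
    ofScale c w g f x ∈ Density c w x := by
  intro g₁ g₂ t h
  have e := h (frame x 0) (frame x 0)
  rw [inner_logFactor g g₁, inner_logFactor g g₂, ← mul_assoc, ← Real.exp_add] at e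
  have e' := Real.exp_injective (mul_right_cancel₀ (g.1.pos x _ (frame_ne_zero x)).ne' e)
  have : logFactor g g₂ x = t + logFactor g g₁ x := by linarith
  rw [ofScale, ofScale, this, ← mul_assoc, ← Real.exp_add, mul_add]

lemma inScale_ofScale [NeZero d] (w : ℝ) (g : c.metrics) (f : M → ℝ) :
    inScale g (ofScale c w g f) = f := by
  ext x
  have e := inner_logFactor g g x (frame x 0) (frame x 0)
  have e0 : (1 : ℝ) = Real.exp (2 * logFactor g g x) :=
    mul_right_cancel₀ (g.1.pos x _ (frame_ne_zero x)).ne' ((one_mul _).trans e)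
  have e1 : logFactor g g x = 0 := by
    have := (Real.exp_eq_one_iff _).1 e0.symm
    linarith
  simp [inScale, ofScale, e1]

lemma exists_jet [NeZero d] (g : c.metrics) (x : M) (a : ℝ) (α : Cotangent d x) (k : ℝ) :
    ∃ σ : LocalDensity c x, inScale g σ.1 x = a ∧ diff d (inScale g σ.1) x = α ∧
      secondDeriv (inScale g σ.1) x = k • metricAt g.1.inner x := by
  let L : Model d →L[ℝ] Model d :=
    mfderiv 𝓘(ℝ, Model d) (𝓡 d) (extChartAt (𝓡 d) x).symm (origin d x)
  let B₀ : Model d →L[ℝ] Model d →L[ℝ] ℝ := g.1.inner ((extChartAt (𝓡 d) x).symm (origin d x))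
  let B : Model d →L[ℝ] Model d →L[ℝ] ℝ := B₀.bilinearComp L L
  have hB : ∀ v u, B v u = B u v := fun v u => g.1.symm _ _ _
  let α' : Model d →L[ℝ] ℝ := α
  let y₀ : Model d := origin d x
  let u : Model d → ℝ := fun y => a + α' (y - y₀) + k / 2 * B (y - y₀) (y - y₀)
  have hu : ContDiff ℝ ∞ u := by fun_prop
  have hder : ∀ y, HasFDerivAt u (α' + k • B (y - y₀)) y := by
    intro y
    have h0 : HasFDerivAt (fun y : Model d => y - y₀) (ContinuousLinearMap.id ℝ (Model d)) y :=
      (hasFDerivAt_id y).sub_const y₀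
    have h1 : HasFDerivAt (fun y => α' (y - y₀)) (α'.comp (ContinuousLinearMap.id ℝ _)) y :=
      α'.hasFDerivAt.comp y h0
    have h2 : HasFDerivAt (fun y => B (y - y₀)) (B.comp (ContinuousLinearMap.id ℝ _)) y :=
      B.hasFDerivAt.comp y h0
    have h3 := ((h1.const_add a).add ((h2.clm_apply h0).const_mul (k / 2)))
    refine h3.congr_fderiv ?_
    ext v
    simp [hB v y, hB v y₀]
    ring
  have hpd : ∀ j, pd j u = fun y => α' (stdVec j) + k * B (y - y₀) (stdVec j) := by
    intro j
    ext y
    simp [pd, (hder y).fderiv]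
  let f : M → ℝ := fun p => u (extChartAt (𝓡 d) x p)
  have hf : ∀ᶠ y in 𝓝 x, ContMDiffAt (𝓡 d) 𝓘(ℝ, ℝ) ∞ f y := by
    filter_upwards [extChartAt_source_mem_nhds (I := 𝓡 d) x] with y hy
    rw [extChartAt_source] at hy
    exact hu.contMDiff.contMDiffAt.comp y (contMDiffAt_extChartAt' hy)
  have hc : chartFun x f =ᶠ[𝓝 y₀] u := by
    filter_upwards [extChartAt_target_mem_nhds (I := 𝓡 d) x] with y hy
    simp only [chartFun, f, Function.comp]
    rw [(extChartAt (𝓡 d) x).right_inv hy]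
  have hfx := hf.self_of_nhds
  refine ⟨⟨ofScale c 1 g f, ofScale_mem 1 g f, fun g' => ?_⟩, ?_⟩
  · filter_upwards [hf] with y hy
    have : ContMDiffAt (𝓡 d) 𝓘(ℝ, ℝ) ∞ (fun y => Real.exp (1 * logFactor g g' y)) y :=
      (Real.contDiff_exp.contMDiff.comp (contMDiff_const.mul (contMDiff_logFactor g g'))) y
    exact this.mul hy
  · simp only [inScale_ofScale]
    refine ⟨?_, ?_, ?_⟩
    · simp [f, u, y₀, origin]
    · have : (diff d f x : Model d →L[ℝ] ℝ) = α' := by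
        have h := hfx.mdifferentiableAt (by simp)
        rw [diff, h.mfderiv]
        have e : fderiv ℝ (chartFun x f) (origin d x) = α' := by
          rw [hc.fderiv_eq, (hder y₀).fderiv]
          simp
        simpa [chartFun, origin, writtenInExtChartAt] using! e
      exact this
    · ext i j
      have h1 : pd j (chartFun x f) =ᶠ[𝓝 y₀] pd j u := by
        filter_upwards [hc.eventuallyEq_nhds] with y hy using pd_congr hy
      have h2 : pd i (pd j (chartFun x f)) y₀ = k * B (stdVec i) (stdVec j) := by
        rw [pd_congr h1, hpd j, pd]
        have h0 : HasFDerivAt (fun y : Model d => y - y₀) (ContinuousLinearMap.id ℝ (Model d)) y₀ :=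
          (hasFDerivAt_id y₀).sub_const y₀
        have h3 : HasFDerivAt (fun y => B.flip (stdVec j) (y - y₀))
            ((B.flip (stdVec j)).comp (ContinuousLinearMap.id ℝ _)) y₀ :=
          (B.flip (stdVec j)).hasFDerivAt.comp y₀ h0
        have h4 := (h3.const_mul k).const_add (α' (stdVec j))
        have h5 := h4.fderiv
        simp only [ContinuousLinearMap.flip_apply] at h5
        rw [h5]
        simp
      exact h2

lemma splitMap_surjective [NeZero d] (g : c.metrics) (x : M) :
    Function.Surjective (splitMap c g x) := by
  rintro ⟨a, α, r⟩
  have hd : (d : ℝ) ≠ 0 := by exact_mod_cast NeZero.ne d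
  let C : Matrix (Fin d) (Fin d) ℝ := Matrix.of fun i j =>
    ∑ k, christoffel (chartMetric g.1.inner x) k i j (origin d x) * α (frame x k)
  obtain ⟨σ, h0, h1, h2⟩ := exists_jet g x a α
    ((trace g.1.inner x C - schoutenTrace g.1.inner x * a) / d - r)
  refine ⟨toTractor c x σ, ?_⟩
  rw [splitMap_toTractor]
  have hh : hess g.1.inner (inScale g σ.1) x =
      ((trace g.1.inner x C - schoutenTrace g.1.inner x * a) / d - r) • metricAt g.1.inner x +
        (-1 : ℝ) • C := by
    rw [hess_eq (LocalDensity.smooth σ g), h1, h2]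
    simp [C, sub_eq_add_neg]
  have h3 : (d : ℝ)⁻¹ * (laplacian g.1.inner (inScale g σ.1) x -
      schoutenTrace g.1.inner x * inScale g σ.1 x) = r := by
    rw [laplacian, hh, trace_add, trace_smul, trace_smul, trace_metricAt, h0]
    field_simp
    ring
  exact Prod.ext h0 (Prod.ext h1 h3)

/-- The isomorphism `𝒯ₓ ≅ ℰ[1]ₓ ⊕ T*ₓM[1] ⊕ ℰ[-1]ₓ`, `t ↦ (σ, μ, ρ)`, given by a metric `g` of the
conformal class; density bundles are trivialised by `g`. -/
def splitting [NeZero d] (c : ConformalStructure d M) (g : c.metrics) (x : M) :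
    TractorFibre c x ≃ₗ[ℝ] ℝ × Cotangent d x × ℝ :=
  LinearEquiv.ofBijective (splitMap c g x) ⟨splitMap_injective g x, splitMap_surjective g x⟩

/-! ### Tractor metric, canonical tractor and tractor connection -/

variable [NeZero d]

/-- The tractor metric `h((σ, μ, ρ), (σ', μ', ρ')) = g⁻¹(μ, μ') + σρ' + ρσ'`, in the scale `g`. -/
def tractorMetric (c : ConformalStructure d M) (g : c.metrics) (x : M) (t t' : TractorFibre c x) :
    ℝ :=
  coInner g.1.inner x (splitting c g x t).2.1 (splitting c g x t').2.1 +
    (splitting c g x t).1 * (splitting c g x t').2.2 +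
    (splitting c g x t).2.2 * (splitting c g x t').1

/-- The canonical tractor `X : ℰ[-1] → 𝒯`, `ρ ↦ (0, 0, ρ)`. -/
def canonicalX (c : ConformalStructure d M) (g : c.metrics) (x : M) (ρ : Density c (-1) x) :
    TractorFibre c x :=
  (splitting c g x).symm (0, 0, ρ.1 g)

/-- The section `h(I, X)` of `ℰ[1]`. Its value in the scale `g` is the pairing of `I` with the image
under `X` of the element of `ℰ[-1]ₓ` that `g` represents by `1`. -/
def pairX (c : ConformalStructure d M) (I : ∀ x, TractorFibre c x) : M → c.metrics → ℝ :=
  fun x g => tractorMetric c g x (I x)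
    (canonicalX c g x ⟨ofScale c (-1) g (fun _ => 1) x, ofScale_mem (-1) g (fun _ => 1) x⟩)

/-- The components of a section of the tractor bundle in the scale `g`. -/
def compσ (c : ConformalStructure d M) (g : c.metrics) (I : ∀ x, TractorFibre c x) : M → ℝ :=
  fun x => (splitting c g x (I x)).1

/-- See `compσ`. -/
def compμ (c : ConformalStructure d M) (g : c.metrics) (I : ∀ x, TractorFibre c x) :
    ∀ x : M, Cotangent d x :=
  fun x => (splitting c g x (I x)).2.1

/-- See `compσ`. -/
def compρ (c : ConformalStructure d M) (g : c.metrics) (I : ∀ x, TractorFibre c x) : M → ℝ :=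
  fun x => (splitting c g x (I x)).2.2

/-- Smooth sections of the tractor bundle. -/
def IsSmoothTractor (c : ConformalStructure d M) (I : ∀ x, TractorFibre c x) : Prop :=
  ∀ g : c.metrics, ContMDiff (𝓡 d) 𝓘(ℝ, ℝ) ∞ (compσ c g I) ∧
    ContMDiff (𝓡 d) ((𝓡 d).prod 𝓘(ℝ, Model d →L[ℝ] ℝ)) ∞
      (fun x => TotalSpace.mk' (Model d →L[ℝ] ℝ) (E := fun x : M => Cotangent d x) x
        (compμ c g I x)) ∧
    ContMDiff (𝓡 d) 𝓘(ℝ, ℝ) ∞ (compρ c g I)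

/-- The normal tractor connection, in the scale `g`:
`∇_v (σ, μ, ρ) = (∇_v σ - μ(v), ∇_v μ + ρ g(v, ·) + σ P(v, ·), ∇_v ρ - P(v, μ^♯))`. -/
def tractorConnection (c : ConformalStructure d M) (g : c.metrics) (I : ∀ x, TractorFibre c x)
    (x : M) (v : TangentSpace (𝓡 d) x) : TractorFibre c x :=
  (splitting c g x).symm
    (diff d (compσ c g I) x v - compμ c g I x v,
     contract x (covForm g.1.inner (compμ c g I) x) v + compρ c g I x • g.1.inner x v +
      compσ c g I x • contract x (schouten g.1.inner x) v,
     diff d (compρ c g I) x v -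
      coInner g.1.inner x (contract x (schouten g.1.inner x) v) (compμ c g I x))

/-- `I` is parallel for the tractor connection, computed in the scale `g`. -/
def IsParallel (c : ConformalStructure d M) (g : c.metrics) (I : ∀ x, TractorFibre c x) : Prop :=
  ∀ x v, tractorConnection c g I x v = 0

/-- `σ` satisfies the almost Einstein equation `trace-free(∇∇σ + Pσ) = 0`, computed in the scale
`g`. -/
def IsAlmostEinstein (c : ConformalStructure d M) (g : c.metrics) (σ : M → c.metrics → ℝ) : Prop :=
  ∀ x, obstructionA g.1.inner (inScale g σ) x = 0

/-- `(M, [g], σ)` is a directed almost scalar constant structure with `S([g], σ) = k`. -/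
def IsAlmostScalarConstant (c : ConformalStructure d M) (σ : M → c.metrics → ℝ) (k : ℝ) : Prop :=
  σ ∈ SmoothDensity c 1 ∧ σ ≠ 0 ∧ ∀ (g : c.metrics) x, scalarS g.1.inner (inScale g σ) x = k

/-- The metric `σ⁻² 𝐠` (on the open set where `σ ≠ 0`), where `𝐠` is the conformal metric. -/
def scaleMetric (c : ConformalStructure d M) (g : c.metrics) (σ : M → c.metrics → ℝ) :
    BilinField d M :=
  fun x => ((inScale g σ x) ^ 2)⁻¹ • g.1.inner x

end Tractor

end Manifold

end Tractor

end

open Tractor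

/-! A density `σ` of weight one has the tractor `(σ, ∇σ, ρ)` with `ρ = (1/d)(Δσ - Jσ)`. The slots of
`∇ᵀ(σ, μ, ρ) = 0` read `μ = ∇σ`, then `∇∇σ + ρg + σP = 0`, then `∇ρ = P(∇σ)`. Tracing the second
forces the above value of `ρ`, so the first two slots say that `σ` solves the almost Einstein
equation. The third slot is a consequence: applying `∇` to the second, commuting derivatives by the
Ricci identity and tracing with the contracted Bianchi identity `∇ᵐPᵢₘ = ∂ᵢJ`, all curvature terms
cancel and `(d - 1)(∇ρ - P(∇σ)) = 0` remains. These two equations make `|∇σ|² + 2σρ = -S([g], σ)`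
locally constant, and where `σ ≠ 0` the conformal change to `σ⁻²g` turns the equation into
`Ric = -(d - 1)(|∇σ|² + 2σρ) σ⁻²g`.

Parallelism and the almost Einstein equation are tensor equations on a manifold, while derivatives
are taken at the centre of the preferred chart of each point. Naturality under isometric changes of
coordinates carries the equation from the centre of each chart to the whole chart, where it can be
differentiated. Naturality holds because the Levi-Civita connection is the only torsion-free metric
one, and the same characterization gives the conformal change of the connection. -/

noncomputable section

namespace Tractor

/-! ### Calculus of functions and matrix fields in coordinates -/

section Calculus

variable {d e : ℕ} {U : Set (Model d)} {y : Model d}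

lemma differentiableAt_of_contDiffOn {f : Model d → ℝ} (hf : ContDiffOn ℝ ∞ f U) (hU : IsOpen U)
    (hy : y ∈ U) : DifferentiableAt ℝ f y :=
  (hf.contDiffAt (hU.mem_nhds hy)).differentiableAt (by simp)

lemma contDiffOn_pd {f : Model d → ℝ} (hf : ContDiffOn ℝ ∞ f U) (hU : IsOpen U) (i : Fin d) :
    ContDiffOn ℝ ∞ (pd i f) U :=
  (hf.fderiv_of_isOpen hU (by simp)).clm_apply contDiffOn_const

lemma pd_congr_on {f g : Model d → ℝ} (hU : IsOpen U) (h : ∀ z ∈ U, f z = g z) (hy : y ∈ U)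
    (i : Fin d) : pd i f y = pd i g y :=
  pd_congr (Filter.eventuallyEq_of_mem (hU.mem_nhds hy) h)

lemma pd_fun_add {i : Fin d} {u v : Model d → ℝ} (hu : DifferentiableAt ℝ u y)
    (hv : DifferentiableAt ℝ v y) : pd i (fun z => u z + v z) y = pd i u y + pd i v y :=
  pd_add hu hv

lemma pd_fun_sub {i : Fin d} {u v : Model d → ℝ} (hu : DifferentiableAt ℝ u y)
    (hv : DifferentiableAt ℝ v y) : pd i (fun z => u z - v z) y = pd i u y - pd i v y := by
  simp [pd, fderiv_fun_sub hu hv]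

lemma pd_fun_neg {i : Fin d} {u : Model d → ℝ} : pd i (fun z => - u z) y = - pd i u y := by
  simp [pd, fderiv_fun_neg]

lemma pd_fun_mul {i : Fin d} {u v : Model d → ℝ} (hu : DifferentiableAt ℝ u y)
    (hv : DifferentiableAt ℝ v y) :
    pd i (fun z => u z * v z) y = u y * pd i v y + v y * pd i u y :=
  pd_mul hu hv

lemma pd_const (i : Fin d) (r : ℝ) : pd i (fun _ => r) y = 0 := by simp [pd]

lemma pd_const_mul {i : Fin d} {u : Model d → ℝ} (r : ℝ) (hu : DifferentiableAt ℝ u y) :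
    pd i (fun z => r * u z) y = r * pd i u y :=
  pd_smul r hu

lemma pd_fun_sum {ι : Type*} {s : Finset ι} {i : Fin d} {u : ι → Model d → ℝ}
    (hu : ∀ a ∈ s, DifferentiableAt ℝ (u a) y) :
    pd i (fun z => ∑ a ∈ s, u a z) y = ∑ a ∈ s, pd i (u a) y := by
  simp [pd, fderiv_fun_sum hu]

lemma pd_comp {h : ℝ → ℝ} {h' : ℝ} {u : Model d → ℝ} (i : Fin d)
    (hh : HasDerivAt h h' (u y)) (hu : DifferentiableAt ℝ u y) :
    pd i (fun z => h (u z)) y = h' * pd i u y := by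
  have hcomp := (hh.hasFDerivAt.comp y hu.hasFDerivAt).fderiv
  simp only [Function.comp_def] at hcomp
  simp [pd, hcomp, mul_comm]

lemma pd_exp {u : Model d → ℝ} (i : Fin d) (hu : DifferentiableAt ℝ u y) :
    pd i (fun z => Real.exp (u z)) y = Real.exp (u y) * pd i u y :=
  pd_comp i (Real.hasDerivAt_exp _) hu

lemma pd_pd_eq_fderiv_fderiv {f : Model d → ℝ} (hf : ContDiffAt ℝ ∞ f y) (i j : Fin d) :
    pd i (pd j f) y = fderiv ℝ (fderiv ℝ f) y (stdVec i) (stdVec j) := by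
  have hf' : ContDiffAt ℝ 1 (fderiv ℝ f) y := hf.fderiv_right (m := 1) (by norm_cast)
  have hderiv := ((hf'.differentiableAt (by simp)).hasFDerivAt.clm_apply
    (hasFDerivAt_const (stdVec j) y)).fderiv
  change fderiv ℝ (fun z => fderiv ℝ f z (stdVec j)) y (stdVec i) = _
  rw [hderiv]
  simp

lemma pd_pd_comm {f : Model d → ℝ} (hf : ContDiffAt ℝ ∞ f y) (i j : Fin d) :
    pd i (pd j f) y = pd j (pd i f) y := by
  rw [pd_pd_eq_fderiv_fderiv hf, pd_pd_eq_fderiv_fderiv hf]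
  exact (hf.isSymmSndFDerivAt (by simp; norm_cast)).eq _ _

lemma sum_smul_stdVec (v : Model d) : ∑ a, v a • stdVec a = v := by
  ext i
  simp [stdVec, Pi.single_apply]

lemma fderiv_eq_zero_of_pd {u : Model d → ℝ} (h : ∀ i, pd i u y = 0) : fderiv ℝ u y = 0 := by
  ext v
  rw [← sum_smul_stdVec v]
  rw [map_sum, zero_apply]
  refine Finset.sum_eq_zero fun i _ => ?_
  rw [map_smul, show fderiv ℝ u y (stdVec i) = 0 from h i, smul_zero]

lemma pd_apply {φ : Model d → Model e} (hφ : DifferentiableAt ℝ φ y) (i : Fin d) (a : Fin e) :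
    pd i (fun z => φ z a) y = fderiv ℝ φ y (stdVec i) a := by
  change fderiv ℝ ((EuclideanSpace.proj (𝕜 := ℝ) a : Model e →L[ℝ] ℝ) ∘ φ) y (stdVec i) = _
  rw [((EuclideanSpace.proj (𝕜 := ℝ) a : Model e →L[ℝ] ℝ).hasFDerivAt.comp y
    hφ.hasFDerivAt).fderiv]
  rfl

lemma pd_comp_map {φ : Model d → Model e} {f : Model e → ℝ} (hφ : DifferentiableAt ℝ φ y)
    (hf : DifferentiableAt ℝ f (φ y)) (i : Fin d) :
    pd i (fun z => f (φ z)) y = ∑ a, pd i (fun z => φ z a) y * pd a f (φ y) := by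
  have hcomp := (hf.hasFDerivAt.comp y hφ.hasFDerivAt).fderiv
  simp only [Function.comp_def] at hcomp
  rw [pd, hcomp]
  simp only [pd_apply hφ, ContinuousLinearMap.comp_apply]
  conv_lhs => rw [← sum_smul_stdVec (fderiv ℝ φ y (stdVec i))]
  simp only [map_sum, map_smul, smul_eq_mul, pd]

end Calculus

section MatrixFields

variable {d : ℕ} {U : Set (Model d)} {y : Model d} {l m n : Type*}

/-- The matrix field `A` has smooth entries on `U`. Entries are used because matrices carry no
canonical norm. -/
def SmoothMatrixOn (A : Model d → Matrix m n ℝ) (U : Set (Model d)) : Prop :=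
  ∀ k l, ContDiffOn ℝ ∞ (fun z => A z k l) U

/-- The entrywise partial derivative `∂ᵢ A` of a matrix field. -/
def pdMatrix (i : Fin d) (A : Model d → Matrix m n ℝ) (y : Model d) : Matrix m n ℝ :=
  Matrix.of fun k l => pd i (fun z => A z k l) y

lemma pdMatrix_apply (i : Fin d) (A : Model d → Matrix m n ℝ) (y : Model d) (k : m) (l : n) :
    pdMatrix i A y k l = pd i (fun z => A z k l) y := rfl

lemma pdMatrix_transpose (i : Fin d) (A : Model d → Matrix m n ℝ) :
    pdMatrix i (fun z => (A z).transpose) y = (pdMatrix i A y).transpose := rfl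

lemma pdMatrix_const (i : Fin d) (C : Matrix m n ℝ) : pdMatrix i (fun _ => C) y = 0 := by
  ext k l
  exact pd_const i _

namespace SmoothMatrixOn

lemma mul [Fintype m] {A : Model d → Matrix l m ℝ} {B : Model d → Matrix m n ℝ}
    (hA : SmoothMatrixOn A U) (hB : SmoothMatrixOn B U) :
    SmoothMatrixOn (fun z => A z * B z) U := by
  intro k l
  simp only [Matrix.mul_apply]
  exact ContDiffOn.sum fun j _ => (hA k j).mul (hB j l)

lemma trace [Fintype m] {A : Model d → Matrix m m ℝ} (hA : SmoothMatrixOn A U) :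
    ContDiffOn ℝ ∞ (fun z => (A z).trace) U :=
  ContDiffOn.sum fun i _ => hA i i

lemma det [Fintype m] [DecidableEq m] {A : Model d → Matrix m m ℝ} (hA : SmoothMatrixOn A U) :
    ContDiffOn ℝ ∞ (fun z => (A z).det) U := by
  simp only [Matrix.det_apply']
  refine ContDiffOn.sum fun s _ => contDiffOn_const.mul ?_
  exact contDiffOn_prod fun i _ => hA _ _

lemma inv [Fintype m] [DecidableEq m] {A : Model d → Matrix m m ℝ} (hA : SmoothMatrixOn A U)
    (hdet : ∀ z ∈ U, IsUnit (A z).det) : SmoothMatrixOn (fun z => (A z)⁻¹) U := by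
  intro k l
  simp only [Matrix.inv_def, Ring.inverse_eq_inv', Matrix.smul_apply, smul_eq_mul,
    Matrix.adjugate_apply]
  refine (hA.det.inv fun z hz => (hdet z hz).ne_zero).mul (SmoothMatrixOn.det ?_)
  intro a b
  by_cases h : a = l
  · subst h
    simpa using contDiffOn_const
  · simpa [Matrix.updateRow_ne h] using hA a b

lemma differentiableAt {A : Model d → Matrix m n ℝ} (hA : SmoothMatrixOn A U) (hU : IsOpen U)
    (hy : y ∈ U) (k : m) (l : n) : DifferentiableAt ℝ (fun z => A z k l) y :=
  differentiableAt_of_contDiffOn (hA k l) hU hy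

variable {A B : Model d → Matrix m n ℝ}

lemma add (hA : SmoothMatrixOn A U) (hB : SmoothMatrixOn B U) :
    SmoothMatrixOn (fun z => A z + B z) U :=
  fun k l => (hA k l).add (hB k l)

lemma sub (hA : SmoothMatrixOn A U) (hB : SmoothMatrixOn B U) :
    SmoothMatrixOn (fun z => A z - B z) U :=
  fun k l => (hA k l).sub (hB k l)

lemma const (C : Matrix m n ℝ) : SmoothMatrixOn (fun _ => C) U := fun _ _ => contDiffOn_const

lemma smul {f : Model d → ℝ} (hf : ContDiffOn ℝ ∞ f U) (hA : SmoothMatrixOn A U) :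
    SmoothMatrixOn (fun z => f z • A z) U :=
  fun k l => hf.mul (hA k l)

lemma transpose (hA : SmoothMatrixOn A U) : SmoothMatrixOn (fun z => (A z).transpose) U :=
  fun k l => hA l k

lemma pdMatrix (hA : SmoothMatrixOn A U) (hU : IsOpen U) (i : Fin d) :
    SmoothMatrixOn (pdMatrix i A) U :=
  fun k l => contDiffOn_pd (hA k l) hU i

end SmoothMatrixOn

lemma pdMatrix_mul [Fintype m] {A : Model d → Matrix l m ℝ} {B : Model d → Matrix m n ℝ}
    (hA : SmoothMatrixOn A U) (hB : SmoothMatrixOn B U) (hU : IsOpen U) (hy : y ∈ U)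
    (i : Fin d) :
    pdMatrix i (fun z => A z * B z) y = pdMatrix i A y * B y + A y * pdMatrix i B y := by
  ext k l
  have hA' := hA.differentiableAt hU hy k
  have hB' := fun j => hB.differentiableAt hU hy j l
  simp only [pdMatrix_apply, Matrix.mul_apply, Matrix.add_apply]
  rw [pd_fun_sum (u := fun j z => A z k j * B z j l) fun j _ => (hA' j).mul (hB' j),
    ← Finset.sum_add_distrib]
  refine Finset.sum_congr rfl fun j _ => ?_
  rw [pd_fun_mul (hA' j) (hB' j)]
  ring

variable {A B : Model d → Matrix m n ℝ}

lemma pdMatrix_add (hA : SmoothMatrixOn A U) (hB : SmoothMatrixOn B U) (hU : IsOpen U)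
    (hy : y ∈ U) (i : Fin d) :
    pdMatrix i (fun z => A z + B z) y = pdMatrix i A y + pdMatrix i B y := by
  ext k l
  exact pd_fun_add (hA.differentiableAt hU hy k l) (hB.differentiableAt hU hy k l)

lemma pdMatrix_sub (hA : SmoothMatrixOn A U) (hB : SmoothMatrixOn B U) (hU : IsOpen U)
    (hy : y ∈ U) (i : Fin d) :
    pdMatrix i (fun z => A z - B z) y = pdMatrix i A y - pdMatrix i B y := by
  ext k l
  exact pd_fun_sub (hA.differentiableAt hU hy k l) (hB.differentiableAt hU hy k l)

lemma pdMatrix_congr (hU : IsOpen U) (h : ∀ z ∈ U, A z = B z) (hy : y ∈ U) (i : Fin d) :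
    pdMatrix i A y = pdMatrix i B y := by
  ext k l
  exact pd_congr_on hU (fun z hz => by rw [h z hz]) hy i

lemma pdMatrix_comm (hA : SmoothMatrixOn A U) (hU : IsOpen U) (hy : y ∈ U) (i j : Fin d) :
    pdMatrix i (pdMatrix j A) y = pdMatrix j (pdMatrix i A) y := by
  ext k l
  exact pd_pd_comm ((hA k l).contDiffAt (hU.mem_nhds hy)) i j

end MatrixFields

/-! ### Connections in a trivialization -/

section Connections

variable {d : ℕ} {U : Set (Model d)} {y : Model d} {l m n : Type*}
  [Fintype l] [Fintype m] [Fintype n]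
  {A : Fin d → Model d → Matrix m m ℝ} {B : Fin d → Model d → Matrix n n ℝ}
  {C : Fin d → Model d → Matrix l l ℝ}

/-- The curvature `∂ᵢ Aⱼ - ∂ⱼ Aᵢ + [Aᵢ, Aⱼ]` of the connection `∂ᵢ + Aᵢ`. -/
def connCurvature (A : Fin d → Model d → Matrix m m ℝ) (i j : Fin d) (y : Model d) :
    Matrix m m ℝ :=
  pdMatrix i (A j) y - pdMatrix j (A i) y + (A i y * A j y - A j y * A i y)

/-- The covariant derivative of a homomorphism `T` from the bundle with connection `A` to the bundle
with connection `B`. -/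
def covHom (A : Fin d → Model d → Matrix m m ℝ) (B : Fin d → Model d → Matrix n n ℝ) (i : Fin d)
    (T : Model d → Matrix n m ℝ) (y : Model d) : Matrix n m ℝ :=
  pdMatrix i T y + (B i y * T y - T y * A i y)

/-- The connection on the dual bundle. -/
def dualConn (A : Fin d → Model d → Matrix m m ℝ) (i : Fin d) (y : Model d) : Matrix m m ℝ :=
  -(A i y).transpose

lemma connCurvature_swap (i j : Fin d) : connCurvature A j i y = -connCurvature A i j y := by
  unfold connCurvature
  abel

lemma connCurvature_congr {D : Fin d → Model d → Matrix m m ℝ} (hU : IsOpen U)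
    (h : ∀ k, ∀ z ∈ U, A k z = D k z) (hy : y ∈ U) (i j : Fin d) :
    connCurvature A i j y = connCurvature D i j y := by
  simp only [connCurvature, pdMatrix_congr hU (h _) hy, h _ y hy]

lemma smoothMatrixOn_connCurvature (hA : ∀ i, SmoothMatrixOn (A i) U) (hU : IsOpen U)
    (i j : Fin d) : SmoothMatrixOn (connCurvature A i j) U :=
  (((hA j).pdMatrix hU i).sub ((hA i).pdMatrix hU j)).add
    (((hA i).mul (hA j)).sub ((hA j).mul (hA i)))

lemma connCurvature_dualConn (i j : Fin d) :
    connCurvature (dualConn A) i j y = -(connCurvature A i j y).transpose := by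
  have hpd : ∀ a b, pdMatrix a (dualConn A b) y = -(pdMatrix a (A b) y).transpose :=
    fun a b => by
      ext k l
      exact pd_fun_neg
  simp only [connCurvature, hpd, dualConn, Matrix.transpose_add, Matrix.transpose_sub,
    Matrix.transpose_mul, neg_mul_neg]
  abel

variable {S T : Model d → Matrix n m ℝ}

lemma covHom_congr (hU : IsOpen U) (h : ∀ z ∈ U, S z = T z) (hy : y ∈ U) (i : Fin d) :
    covHom A B i S y = covHom A B i T y := by
  simp only [covHom, pdMatrix_congr hU h hy, h y hy]

lemma covHom_zero (i : Fin d) : covHom A B i (fun _ => 0) y = 0 := by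
  simp [covHom, pdMatrix_const]

lemma covHom_neg (i : Fin d) : covHom A B i (fun z => -T z) y = -covHom A B i T y := by
  have hpd : pdMatrix i (fun z => -T z) y = -pdMatrix i T y := by
    ext k l
    exact pd_fun_neg
  simp only [covHom, hpd, Matrix.mul_neg, Matrix.neg_mul]
  abel

lemma covHom_dualConn_transpose (i : Fin d) (E : Model d → Matrix m m ℝ) :
    (covHom (dualConn A) A i E y).transpose =
      covHom (dualConn A) A i (fun z => (E z).transpose) y := by
  simp only [covHom, dualConn, pdMatrix_transpose, Matrix.transpose_add, Matrix.transpose_sub,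
    Matrix.transpose_mul, Matrix.transpose_neg, Matrix.transpose_transpose, Matrix.mul_neg]
  abel

lemma covHom_add (hS : SmoothMatrixOn S U) (hT : SmoothMatrixOn T U) (hU : IsOpen U) (hy : y ∈ U)
    (i : Fin d) :
    covHom A B i (fun z => S z + T z) y = covHom A B i S y + covHom A B i T y := by
  simp only [covHom, pdMatrix_add hS hT hU hy, Matrix.mul_add, Matrix.add_mul]
  abel

lemma covHom_sub (hS : SmoothMatrixOn S U) (hT : SmoothMatrixOn T U) (hU : IsOpen U) (hy : y ∈ U)
    (i : Fin d) :
    covHom A B i (fun z => S z - T z) y = covHom A B i S y - covHom A B i T y := by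
  simp only [covHom, pdMatrix_sub hS hT hU hy, Matrix.mul_sub, Matrix.sub_mul]
  abel

lemma covHom_smul {f : Model d → ℝ} (hf : ContDiffOn ℝ ∞ f U) (hT : SmoothMatrixOn T U)
    (hU : IsOpen U) (hy : y ∈ U) (i : Fin d) :
    covHom A B i (fun z => f z • T z) y = pd i f y • T y + f y • covHom A B i T y := by
  have hpd : pdMatrix i (fun z => f z • T z) y = pd i f y • T y + f y • pdMatrix i T y := by
    ext k l
    simp only [pdMatrix_apply, Matrix.smul_apply, Matrix.add_apply, smul_eq_mul]
    rw [pd_fun_mul (differentiableAt_of_contDiffOn hf hU hy) (hT.differentiableAt hU hy k l)]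
    ring
  simp only [covHom, hpd, Matrix.mul_smul, Matrix.smul_mul, smul_add, smul_sub]
  abel

lemma covHom_mul {R : Model d → Matrix l n ℝ} (hR : SmoothMatrixOn R U) (hT : SmoothMatrixOn T U)
    (hU : IsOpen U) (hy : y ∈ U) (i : Fin d) :
    covHom A C i (fun z => R z * T z) y = covHom B C i R y * T y + R y * covHom A B i T y := by
  simp only [covHom, pdMatrix_mul hR hT hU hy, Matrix.mul_add, Matrix.add_mul, Matrix.mul_sub,
    Matrix.sub_mul, Matrix.mul_assoc]
  abel

lemma covHom_inv_of_parallel [DecidableEq m] [DecidableEq n] {R : Model d → Matrix m n ℝ}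
    (hT : SmoothMatrixOn T U) (hR : SmoothMatrixOn R U) (hU : IsOpen U) (hy : y ∈ U)
    (hRT : ∀ z ∈ U, R z * T z = 1) (hTR : T y * R y = 1) {i : Fin d}
    (hpar : covHom A B i T y = 0) : covHom B A i R y = 0 := by
  have hone : covHom A A i (fun _ => (1 : Matrix m m ℝ)) y = 0 := by
    simp [covHom, pdMatrix_const]
  have hmul := covHom_mul (A := A) (B := B) (C := A) hR hT hU hy i
  rw [covHom_congr hU hRT hy, hone, hpar, Matrix.mul_zero, add_zero] at hmul
  calc covHom B A i R y = covHom B A i R y * T y * R y := by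
        rw [Matrix.mul_assoc, hTR, Matrix.mul_one]
    _ = 0 := by rw [← hmul, Matrix.zero_mul]

lemma covHom_covHom_sub (hA : ∀ i, SmoothMatrixOn (A i) U) (hB : ∀ i, SmoothMatrixOn (B i) U)
    (hT : SmoothMatrixOn T U) (hU : IsOpen U) (hy : y ∈ U) (i j : Fin d) :
    covHom A B i (covHom A B j T) y - covHom A B j (covHom A B i T) y =
      connCurvature B i j y * T y - T y * connCurvature A i j y := by
  have hpd : ∀ a b, pdMatrix a (covHom A B b T) y = pdMatrix a (pdMatrix b T) y +
      (pdMatrix a (B b) y * T y + B b y * pdMatrix a T y -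
        (pdMatrix a T y * A b y + T y * pdMatrix a (A b) y)) := by
    intro a b
    have hBT := (hB b).mul hT
    have hTA := hT.mul (hA b)
    unfold covHom
    rw [pdMatrix_add (hT.pdMatrix hU b) (hBT.sub hTA) hU hy, pdMatrix_sub hBT hTA hU hy,
      pdMatrix_mul (hB b) hT hU hy, pdMatrix_mul hT (hA b) hU hy]
  unfold covHom at hpd ⊢
  rw [hpd, hpd, pdMatrix_comm hT hU hy j i]
  simp only [connCurvature, Matrix.mul_add, Matrix.add_mul, Matrix.mul_sub, Matrix.sub_mul,
    Matrix.mul_assoc]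
  abel

lemma connCurvature_mul_of_parallel (hA : ∀ i, SmoothMatrixOn (A i) U)
    (hB : ∀ i, SmoothMatrixOn (B i) U) (hT : SmoothMatrixOn T U) (hU : IsOpen U) (hy : y ∈ U)
    (hpar : ∀ z ∈ U, ∀ i, covHom A B i T z = 0) (i j : Fin d) :
    connCurvature B i j y * T y = T y * connCurvature A i j y := by
  have hzero : ∀ a b, covHom A B a (covHom A B b T) y = 0 := fun a b => by
    rw [covHom_congr (T := fun _ => 0) hU (fun z hz => hpar z hz b) hy, covHom_zero]
  rw [← sub_eq_zero, ← covHom_covHom_sub hA hB hT hU hy, hzero, hzero, sub_zero]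

lemma second_bianchi (hA : ∀ i, SmoothMatrixOn (A i) U) (hU : IsOpen U) (hy : y ∈ U)
    (i j k : Fin d) :
    covHom A A i (connCurvature A j k) y + covHom A A j (connCurvature A k i) y +
      covHom A A k (connCurvature A i j) y = 0 := by
  have hpd : ∀ a b c, pdMatrix a (connCurvature A b c) y =
      pdMatrix a (pdMatrix b (A c)) y - pdMatrix a (pdMatrix c (A b)) y +
      (pdMatrix a (A b) y * A c y + A b y * pdMatrix a (A c) y -
        (pdMatrix a (A c) y * A b y + A c y * pdMatrix a (A b) y)) := by
    intro a b c
    have hbc := (hA c).pdMatrix hU b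
    have hcb := (hA b).pdMatrix hU c
    have hmul := (hA b).mul (hA c)
    have hmul' := (hA c).mul (hA b)
    unfold connCurvature
    rw [pdMatrix_add (hbc.sub hcb) (hmul.sub hmul') hU hy, pdMatrix_sub hbc hcb hU hy,
      pdMatrix_sub hmul hmul' hU hy, pdMatrix_mul (hA b) (hA c) hU hy,
      pdMatrix_mul (hA c) (hA b) hU hy]
  simp only [covHom, hpd]
  rw [pdMatrix_comm (hA k) hU hy j i, pdMatrix_comm (hA i) hU hy k j,
    pdMatrix_comm (hA j) hU hy i k]
  unfold connCurvature
  noncomm_ring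

lemma connCurvature_add {D : Fin d → Model d → Matrix m m ℝ} (hA : ∀ i, SmoothMatrixOn (A i) U)
    (hD : ∀ i, SmoothMatrixOn (D i) U) (hU : IsOpen U) (hy : y ∈ U) (i j : Fin d) :
    connCurvature (fun k z => A k z + D k z) i j y = connCurvature A i j y +
      (covHom A A i (D j) y - covHom A A j (D i) y) + (D i y * D j y - D j y * D i y) := by
  simp only [connCurvature, covHom, pdMatrix_add (hA _) (hD _) hU hy]
  noncomm_ring

end Connections

/-! ### The Levi-Civita connection in coordinates -/

section LeviCivita

variable {d : ℕ} {U : Set (Model d)} {y : Model d} {G : Model d → Matrix (Fin d) (Fin d) ℝ}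

/-- `G` is a smooth field of nondegenerate symmetric matrices on the open set `U`, that is, a
pseudo-Riemannian metric in coordinates. -/
structure IsMetricOn (G : Model d → Matrix (Fin d) (Fin d) ℝ) (U : Set (Model d)) : Prop where
  isOpen : IsOpen U
  smooth : SmoothMatrixOn G U
  symm : ∀ y ∈ U, ∀ i j, G y i j = G y j i
  det : ∀ y ∈ U, IsUnit (G y).det

/-- The connection matrices `(Γᵢ)ᵏₗ = Γᵏᵢₗ` of the tangent bundle. -/
def leviCivita (G : Model d → Matrix (Fin d) (Fin d) ℝ) (i : Fin d) (y : Model d) :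
    Matrix (Fin d) (Fin d) ℝ :=
  Matrix.of fun k l => christoffel G k i l y

lemma leviCivita_apply (i k l : Fin d) : leviCivita G i y k l = christoffel G k i l y := rfl

lemma riemann_eq_connCurvature (i j k l : Fin d) :
    riemann G i j k l y = connCurvature (leviCivita G) i j y k l := by
  simp only [connCurvature, riemann, Matrix.add_apply, Matrix.sub_apply, Matrix.mul_apply,
    pdMatrix_apply, leviCivita_apply, ← Finset.sum_sub_distrib]

lemma coordRicci_apply (i j : Fin d) :
    coordRicci G y i j = ∑ k, connCurvature (leviCivita G) k i y k j := by
  simp only [coordRicci, Matrix.of_apply, riemann_eq_connCurvature]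

namespace IsMetricOn

lemma mono (hG : IsMetricOn G U) {V : Set (Model d)} (hV : IsOpen V) (h : V ⊆ U) :
    IsMetricOn G V where
  isOpen := hV
  smooth k l := (hG.smooth k l).mono h
  symm y hy := hG.symm y (h hy)
  det y hy := hG.det y (h hy)

lemma mul_inv (hG : IsMetricOn G U) (hy : y ∈ U) : G y * (G y)⁻¹ = 1 :=
  Matrix.mul_nonsing_inv _ (hG.det y hy)

lemma inv_mul (hG : IsMetricOn G U) (hy : y ∈ U) : (G y)⁻¹ * G y = 1 :=
  Matrix.nonsing_inv_mul _ (hG.det y hy)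

lemma transpose_eq (hG : IsMetricOn G U) (hy : y ∈ U) : (G y).transpose = G y := by
  ext i j
  exact hG.symm y hy j i

lemma inv_transpose (hG : IsMetricOn G U) (hy : y ∈ U) : ((G y)⁻¹).transpose = (G y)⁻¹ := by
  rw [Matrix.transpose_nonsing_inv, hG.transpose_eq hy]

lemma inv_symm (hG : IsMetricOn G U) (hy : y ∈ U) (i j : Fin d) : (G y)⁻¹ i j = (G y)⁻¹ j i :=
  congrFun (congrFun (hG.inv_transpose hy) j) i

lemma pd_symm (hG : IsMetricOn G U) (hy : y ∈ U) (k i j : Fin d) :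
    pd k (fun z => G z i j) y = pd k (fun z => G z j i) y :=
  pd_congr_on hG.isOpen (fun z hz => hG.symm z hz i j) hy k

lemma inv_smooth (hG : IsMetricOn G U) : SmoothMatrixOn (fun z => (G z)⁻¹) U :=
  hG.smooth.inv hG.det

lemma christoffel_smooth (hG : IsMetricOn G U) (k i j : Fin d) :
    ContDiffOn ℝ ∞ (christoffel G k i j) U := by
  unfold christoffel
  refine contDiffOn_const.mul (ContDiffOn.sum fun l _ => (hG.inv_smooth k l).mul ?_)
  exact ((contDiffOn_pd (hG.smooth _ _) hG.isOpen _).add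
    (contDiffOn_pd (hG.smooth _ _) hG.isOpen _)).sub (contDiffOn_pd (hG.smooth _ _) hG.isOpen _)

lemma leviCivita_smooth (hG : IsMetricOn G U) (i : Fin d) : SmoothMatrixOn (leviCivita G i) U :=
  fun k l => hG.christoffel_smooth k i l

lemma dualConn_smooth (hG : IsMetricOn G U) (i : Fin d) :
    SmoothMatrixOn (dualConn (leviCivita G) i) U :=
  fun k l => (hG.christoffel_smooth l i k).neg

lemma curvature_smooth (hG : IsMetricOn G U) (i j : Fin d) :
    SmoothMatrixOn (connCurvature (leviCivita G) i j) U :=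
  smoothMatrixOn_connCurvature hG.leviCivita_smooth hG.isOpen i j

lemma ricci_smooth (hG : IsMetricOn G U) : SmoothMatrixOn (coordRicci G) U := fun i j => by
  simp only [coordRicci_apply]
  exact ContDiffOn.sum fun k _ => hG.curvature_smooth k i k j

lemma christoffel_symm (hG : IsMetricOn G U) (hy : y ∈ U) (k i j : Fin d) :
    christoffel G k i j y = christoffel G k j i y := by
  unfold christoffel
  congr 1
  refine Finset.sum_congr rfl fun l _ => ?_
  rw [hG.pd_symm hy l i j]
  ring

lemma mul_leviCivita (hG : IsMetricOn G U) (hy : y ∈ U) (l i j : Fin d) :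
    (G y * leviCivita G i y) l j = 1 / 2 *
      (pd i (fun z => G z j l) y + pd j (fun z => G z i l) y - pd l (fun z => G z i j) y) := by
  have hΓ : (fun k => leviCivita G i y k j) = (1 / 2 : ℝ) • (G y)⁻¹.mulVec fun l =>
      pd i (fun z => G z j l) y + pd j (fun z => G z i l) y - pd l (fun z => G z i j) y := rfl
  change (G y).mulVec (fun k => leviCivita G i y k j) l = _
  rw [hΓ, Matrix.mulVec_smul, Matrix.mulVec_mulVec, hG.mul_inv hy, Matrix.one_mulVec]
  rfl

lemma covHom_metric (hG : IsMetricOn G U) (hy : y ∈ U) (i : Fin d) :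
    covHom (leviCivita G) (dualConn (leviCivita G)) i G y = 0 := by
  have htr : (leviCivita G i y).transpose * G y = (G y * leviCivita G i y).transpose := by
    rw [Matrix.transpose_mul, hG.transpose_eq hy]
  ext a b
  simp only [covHom, dualConn, Matrix.neg_mul, htr, Matrix.add_apply, Matrix.sub_apply,
    Matrix.neg_apply, Matrix.transpose_apply, hG.mul_leviCivita hy, pdMatrix_apply,
    Matrix.zero_apply]
  rw [hG.pd_symm hy i b a]
  ring

lemma leviCivita_unique (hG : IsMetricOn G U) (hy : y ∈ U)
    {A : Fin d → Model d → Matrix (Fin d) (Fin d) ℝ} (hsymm : ∀ i j k, A i y k j = A j y k i)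
    (hpar : ∀ i, covHom A (dualConn A) i G y = 0) (i : Fin d) : leviCivita G i y = A i y := by
  have hpd : ∀ k a b, pd k (fun z => G z a b) y = (G y * A k y) b a + (G y * A k y) a b := by
    intro k a b
    have htr : (A k y).transpose * G y = (G y * A k y).transpose := by
      rw [Matrix.transpose_mul, hG.transpose_eq hy]
    have hab := congrFun (congrFun (hpar k) a) b
    simp only [covHom, dualConn, Matrix.neg_mul, htr, Matrix.add_apply, Matrix.sub_apply,
      Matrix.neg_apply, Matrix.transpose_apply, pdMatrix_apply, Matrix.zero_apply] at hab
    linarith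
  have hsymm' : ∀ l j k, (G y * A j y) l k = (G y * A k y) l j := fun l j k => by
    simp only [Matrix.mul_apply, hsymm j k]
  have hlower : G y * leviCivita G i y = G y * A i y := by
    ext l j
    rw [hG.mul_leviCivita hy, hpd, hpd, hpd, hsymm' l j i, hsymm' i j l, hsymm' j i l]
    ring
  calc leviCivita G i y = (G y)⁻¹ * (G y * leviCivita G i y) := by
        rw [← mul_assoc, hG.inv_mul hy, one_mul]
    _ = A i y := by rw [hlower, ← mul_assoc, hG.inv_mul hy, one_mul]

lemma covHom_inv (hG : IsMetricOn G U) (hy : y ∈ U) (i : Fin d) :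
    covHom (dualConn (leviCivita G)) (leviCivita G) i (fun z => (G z)⁻¹) y = 0 :=
  covHom_inv_of_parallel hG.smooth hG.inv_smooth hG.isOpen hy (fun _ hz => hG.inv_mul hz)
    (hG.mul_inv hy) (hG.covHom_metric hy i)

end IsMetricOn

end LeviCivita

/-! ### The contracted Bianchi identity -/

section ContractedBianchi

variable {d : ℕ} {U : Set (Model d)} {y : Model d} {G : Model d → Matrix (Fin d) (Fin d) ℝ}

/-- The curvature `R_{ij}{}^{kl}` with the second index of the endomorphism raised. -/
def raisedCurvature (G : Model d → Matrix (Fin d) (Fin d) ℝ) (i j : Fin d) (y : Model d) :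
    Matrix (Fin d) (Fin d) ℝ :=
  connCurvature (leviCivita G) i j y * (G y)⁻¹

/-- The covariant derivative `∇ₘ R_{ij}{}^{kl}`. -/
def covRaisedCurvature (G : Model d → Matrix (Fin d) (Fin d) ℝ) (m i j : Fin d) (y : Model d) :
    Matrix (Fin d) (Fin d) ℝ :=
  covHom (dualConn (leviCivita G)) (leviCivita G) m (raisedCurvature G i j) y -
    ∑ p, (christoffel G p m i y • raisedCurvature G p j y +
      christoffel G p m j y • raisedCurvature G i p y)

/-- The Ricci tensor `Ricᵢᵏ` with the second index raised. -/
def mixedRicci (G : Model d → Matrix (Fin d) (Fin d) ℝ) (y : Model d) :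
    Matrix (Fin d) (Fin d) ℝ :=
  coordRicci G y * (G y)⁻¹

/-- The divergence `∇ₘ Eᵢᵐ` of an endomorphism field `E` of the cotangent bundle, with components
`E i m = Eᵢᵐ`. -/
def divergence (G E : Model d → Matrix (Fin d) (Fin d) ℝ) (y : Model d) (i : Fin d) : ℝ :=
  ∑ m, covHom (dualConn (leviCivita G)) (dualConn (leviCivita G)) m E y i m

lemma trace_covHom_self {A : Fin d → Model d → Matrix (Fin d) (Fin d) ℝ}
    {E : Model d → Matrix (Fin d) (Fin d) ℝ} (hE : SmoothMatrixOn E U) (hU : IsOpen U)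
    (hy : y ∈ U) (i : Fin d) :
    (covHom A A i E y).trace = pd i (fun z => (E z).trace) y := by
  rw [covHom, Matrix.trace_add, Matrix.trace_sub, Matrix.trace_mul_comm, sub_self, add_zero]
  exact (pd_fun_sum fun a _ => hE.differentiableAt hU hy a a).symm

lemma raisedCurvature_swap (i j : Fin d) :
    raisedCurvature G j i y = -raisedCurvature G i j y := by
  rw [raisedCurvature, connCurvature_swap, Matrix.neg_mul, raisedCurvature]

lemma covRaisedCurvature_swap (m i j : Fin d) :
    covRaisedCurvature G m j i y = -covRaisedCurvature G m i j y := by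
  have hneg : raisedCurvature G j i = fun z => -raisedCurvature G i j z :=
    funext fun _ => raisedCurvature_swap i j
  simp only [covRaisedCurvature, hneg, covHom_neg, raisedCurvature_swap i,
    raisedCurvature_swap _ j, smul_neg, Finset.sum_add_distrib, Finset.sum_neg_distrib]
  abel

namespace IsMetricOn

lemma raisedCurvature_smooth (hG : IsMetricOn G U) (i j : Fin d) :
    SmoothMatrixOn (raisedCurvature G i j) U :=
  (hG.curvature_smooth i j).mul hG.inv_smooth

lemma mixedRicci_smooth (hG : IsMetricOn G U) : SmoothMatrixOn (mixedRicci G) U :=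
  hG.ricci_smooth.mul hG.inv_smooth

-- The curvature commutes with the parallel homomorphism `G⁻¹ : T* → T`.
lemma raisedCurvature_transpose (hG : IsMetricOn G U) (hy : y ∈ U) (i j : Fin d) :
    (raisedCurvature G i j y).transpose = -raisedCurvature G i j y := by
  have hcomm := connCurvature_mul_of_parallel hG.dualConn_smooth hG.leviCivita_smooth hG.inv_smooth
    hG.isOpen hy (fun _ hz => hG.covHom_inv hz) i j
  rw [connCurvature_dualConn, Matrix.mul_neg] at hcomm
  rw [raisedCurvature, Matrix.transpose_mul, hG.inv_transpose hy, hcomm, neg_neg]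

lemma covRaisedCurvature_transpose (hG : IsMetricOn G U) (hy : y ∈ U) (m i j : Fin d) :
    (covRaisedCurvature G m i j y).transpose = -covRaisedCurvature G m i j y := by
  rw [covRaisedCurvature, Matrix.transpose_sub, covHom_dualConn_transpose,
    covHom_congr hG.isOpen (fun _ hz => hG.raisedCurvature_transpose hz i j) hy, covHom_neg]
  simp only [Matrix.transpose_sum, Matrix.transpose_add, Matrix.transpose_smul,
    hG.raisedCurvature_transpose hy, smul_neg, ← neg_add, Finset.sum_neg_distrib]
  abel

lemma covRaisedCurvature_cyclic (hG : IsMetricOn G U) (hy : y ∈ U) (i j k : Fin d) :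
    covRaisedCurvature G i j k y + covRaisedCurvature G j k i y + covRaisedCurvature G k i j y =
      0 := by
  have hcov : ∀ a b c,
      covHom (dualConn (leviCivita G)) (leviCivita G) a (raisedCurvature G b c) y =
        covHom (leviCivita G) (leviCivita G) a (connCurvature (leviCivita G) b c) y *
          (G y)⁻¹ := fun a b c => by
    unfold raisedCurvature
    rw [covHom_mul (B := leviCivita G) (hG.curvature_smooth b c) hG.inv_smooth hG.isOpen hy,
      hG.covHom_inv hy, Matrix.mul_zero, add_zero]
  have hbianchi := congrArg (· * (G y)⁻¹)
    (second_bianchi hG.leviCivita_smooth hG.isOpen hy i j k)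
  simp only [Matrix.add_mul, Matrix.zero_mul, ← hcov] at hbianchi
  have hcancel : ∀ p, (christoffel G p i j y • raisedCurvature G p k y +
      christoffel G p i k y • raisedCurvature G j p y) +
      (christoffel G p j k y • raisedCurvature G p i y +
      christoffel G p j i y • raisedCurvature G k p y) +
      (christoffel G p k i y • raisedCurvature G p j y +
      christoffel G p k j y • raisedCurvature G i p y) = 0 := fun p => by
    rw [hG.christoffel_symm hy p j i, hG.christoffel_symm hy p k i, hG.christoffel_symm hy p k j,
      raisedCurvature_swap p k, raisedCurvature_swap p j, raisedCurvature_swap p i]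
    module
  have hsum := Finset.sum_eq_zero fun p (_ : p ∈ Finset.univ) => hcancel p
  rw [Finset.sum_add_distrib, Finset.sum_add_distrib] at hsum
  unfold covRaisedCurvature
  rw [sub_add_sub_comm, sub_add_sub_comm, hbianchi, hsum, sub_zero]

lemma mixedRicci_apply (hG : IsMetricOn G U) (hy : y ∈ U) (i k : Fin d) :
    mixedRicci G y i k = ∑ j, raisedCurvature G i j y k j := by
  have hmove : ∀ j, raisedCurvature G i j y k j = raisedCurvature G j i y j k := fun j => by
    rw [raisedCurvature_swap, ← hG.raisedCurvature_transpose hy, Matrix.transpose_apply]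
  simp only [hmove]
  simp only [mixedRicci, raisedCurvature, coordRicci_apply, Matrix.mul_apply, Finset.sum_mul]
  exact Finset.sum_comm

lemma covHom_mixedRicci (hG : IsMetricOn G U) (hy : y ∈ U) (m i k : Fin d) :
    covHom (dualConn (leviCivita G)) (dualConn (leviCivita G)) m (mixedRicci G) y i k =
      ∑ j, covRaisedCurvature G m i j y k j := by
  have hpd : pd m (fun z => mixedRicci G z i k) y =
      ∑ j, pd m (fun z => raisedCurvature G i j z k j) y := by
    rw [pd_congr_on hG.isOpen (fun z hz => hG.mixedRicci_apply hz i k) hy]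
    exact pd_fun_sum fun j _ => (hG.raisedCurvature_smooth i j).differentiableAt hG.isOpen hy k j
  have hcancel : ∑ j, ∑ p, raisedCurvature G i j y k p * christoffel G j m p y =
      ∑ j, ∑ p, christoffel G p m j y * raisedCurvature G i p y k j := by
    rw [Finset.sum_comm]
    simp only [mul_comm]
  have hleft : ∑ p, christoffel G p m i y * ∑ j, raisedCurvature G p j y k j =
      ∑ j, ∑ p, christoffel G p m i y * raisedCurvature G p j y k j := by
    simp only [Finset.mul_sum]
    exact Finset.sum_comm
  have hright : ∑ p, (∑ j, raisedCurvature G i j y p j) * christoffel G k m p y =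
      ∑ j, ∑ p, christoffel G k m p y * raisedCurvature G i j y p j := by
    simp only [Finset.sum_mul]
    rw [Finset.sum_comm]
    simp only [mul_comm]
  simp only [covRaisedCurvature, covHom, dualConn, Matrix.add_apply, Matrix.sub_apply,
    Matrix.mul_apply, Matrix.neg_apply, Matrix.transpose_apply, Matrix.sum_apply,
    Matrix.smul_apply, pdMatrix_apply, leviCivita_apply, smul_eq_mul, neg_mul, mul_neg,
    Finset.sum_add_distrib, Finset.sum_sub_distrib, Finset.sum_neg_distrib,
    hG.mixedRicci_apply hy, hpd, hcancel, hleft, hright]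
  ring

lemma contracted_bianchi (hG : IsMetricOn G U) (hy : y ∈ U) (i : Fin d) :
    2 * divergence G (mixedRicci G) y i = pd i (fun z => (mixedRicci G z).trace) y := by
  have hcyc : ∑ m, ∑ j, (covRaisedCurvature G m i j y + covRaisedCurvature G i j m y +
      covRaisedCurvature G j m i y) m j = 0 := by
    simp only [hG.covRaisedCurvature_cyclic hy, Matrix.zero_apply, Finset.sum_const_zero]
  have hdiv : divergence G (mixedRicci G) y i = ∑ m, ∑ j, covRaisedCurvature G m i j y m j := by
    simp only [divergence, hG.covHom_mixedRicci hy]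
  have hdiv' : divergence G (mixedRicci G) y i = ∑ m, ∑ j, covRaisedCurvature G j m i y m j := by
    rw [hdiv, Finset.sum_comm]
    refine Finset.sum_congr rfl fun j _ => Finset.sum_congr rfl fun m _ => ?_
    rw [covRaisedCurvature_swap, ← hG.covRaisedCurvature_transpose hy, Matrix.transpose_apply]
  have htrace : pd i (fun z => (mixedRicci G z).trace) y =
      -∑ m, ∑ j, covRaisedCurvature G i j m y m j := by
    rw [← trace_covHom_self (A := dualConn (leviCivita G)) hG.mixedRicci_smooth hG.isOpen hy,
      Matrix.trace]
    simp only [Matrix.diag_apply, hG.covHom_mixedRicci hy, ← Finset.sum_neg_distrib]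
    refine Finset.sum_congr rfl fun j _ => Finset.sum_congr rfl fun m _ => ?_
    rw [covRaisedCurvature_swap, Matrix.neg_apply]
  simp only [Matrix.add_apply, Finset.sum_add_distrib, ← hdiv, ← hdiv'] at hcyc
  linarith

end IsMetricOn

end ContractedBianchi

/-! ### The Ricci identity -/

section Sections

open Matrix

variable {d : ℕ} {U : Set (Model d)} {y : Model d} {m n : Type*} [Fintype m] [Fintype n]
  {A : Fin d → Model d → Matrix m m ℝ} {B : Fin d → Model d → Matrix n n ℝ}

/-- The covariant derivative of a section `v` of the bundle with connection `A`. -/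
def covVec (A : Fin d → Model d → Matrix m m ℝ) (i : Fin d) (v : Model d → m → ℝ) (y : Model d) :
    m → ℝ :=
  fun k => pd i (fun z => v z k) y + (A i y *ᵥ v y) k

-- A section is a homomorphism from the trivial line bundle.
lemma covHom_replicateCol (i : Fin d) (v : Model d → m → ℝ) :
    covHom (fun _ _ => 0) A i (fun z => replicateCol Unit (v z)) y =
      replicateCol Unit (covVec A i v y) := by
  rw [covHom, Matrix.mul_zero, sub_zero]
  rfl

lemma covHom_replicateRow (i : Fin d) (v : Model d → m → ℝ) :
    covHom A (fun _ _ => 0) i (fun z => replicateRow Unit (v z)) y =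
      replicateRow Unit (covVec (dualConn A) i v y) := by
  ext _ k
  simp [covHom, covVec, dualConn, pdMatrix_apply, neg_mulVec, mulVec_transpose, vecMul,
    Matrix.mul_apply, dotProduct]

lemma smoothMatrixOn_replicateCol {l : Type*} {v : Model d → l → ℝ}
    (hv : ∀ k, ContDiffOn ℝ ∞ (fun z => v z k) U) :
    SmoothMatrixOn (fun z => replicateCol Unit (v z)) U := fun k _ => hv k

lemma covVec_congr {v w : Model d → m → ℝ} (hU : IsOpen U) (h : ∀ z ∈ U, v z = w z) (hy : y ∈ U)
    (i : Fin d) : covVec A i v y = covVec A i w y := by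
  ext k
  simp only [covVec, h y hy, pd_congr_on hU (fun z hz => congrFun (h z hz) k) hy]

lemma contDiffOn_covVec (hA : ∀ i, SmoothMatrixOn (A i) U) {v : Model d → m → ℝ}
    (hv : ∀ k, ContDiffOn ℝ ∞ (fun z => v z k) U) (hU : IsOpen U) (i : Fin d) (k : m) :
    ContDiffOn ℝ ∞ (fun z => covVec A i v z k) U :=
  (contDiffOn_pd (hv k) hU i).add (((hA i).mul (smoothMatrixOn_replicateCol hv)) k ())

lemma covVec_mulVec {T : Model d → Matrix n m ℝ} {v : Model d → m → ℝ} (hT : SmoothMatrixOn T U)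
    (hv : ∀ k, ContDiffOn ℝ ∞ (fun z => v z k) U) (hU : IsOpen U) (hy : y ∈ U) (i : Fin d) :
    covVec B i (fun z => T z *ᵥ v z) y =
      covHom A B i T y *ᵥ v y + T y *ᵥ covVec A i v y := by
  apply replicateCol_injective (ι := Unit)
  rw [← covHom_replicateCol, replicateCol_add, replicateCol_mulVec, replicateCol_mulVec,
    ← covHom_replicateCol]
  simp only [replicateCol_mulVec]
  exact covHom_mul hT (smoothMatrixOn_replicateCol hv) hU hy i

lemma covHom_vecMulVec {v : Model d → n → ℝ} {w : Model d → m → ℝ}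
    (hv : ∀ k, ContDiffOn ℝ ∞ (fun z => v z k) U) (hw : ∀ k, ContDiffOn ℝ ∞ (fun z => w z k) U)
    (hU : IsOpen U) (hy : y ∈ U) (i : Fin d) :
    covHom A B i (fun z => vecMulVec (v z) (w z)) y =
      vecMulVec (covVec B i v y) (w y) + vecMulVec (v y) (covVec (dualConn A) i w y) := by
  have hrow : SmoothMatrixOn (fun z => replicateRow Unit (w z)) U := fun _ k => hw k
  simp only [vecMulVec_eq Unit]
  rw [covHom_mul (B := fun _ _ => 0) (smoothMatrixOn_replicateCol hv) hrow hU hy,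
    covHom_replicateCol, covHom_replicateRow]

lemma pd_dotProduct {v w : Model d → m → ℝ}
    (hv : ∀ k, ContDiffOn ℝ ∞ (fun z => v z k) U) (hw : ∀ k, ContDiffOn ℝ ∞ (fun z => w z k) U)
    (hU : IsOpen U) (hy : y ∈ U) (i : Fin d) :
    pd i (fun z => v z ⬝ᵥ w z) y =
      covVec (dualConn A) i v y ⬝ᵥ w y + v y ⬝ᵥ covVec A i w y := by
  have hrow : SmoothMatrixOn (fun z => replicateRow Unit (v z)) U := fun _ k => hv k
  have hmul := covHom_mul (A := fun _ _ => 0) (B := A) (C := fun _ _ => 0) hrow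
    (smoothMatrixOn_replicateCol hw) hU hy i
  rw [covHom_replicateCol, covHom_replicateRow] at hmul
  simpa [covHom, pdMatrix_apply] using congrFun (congrFun hmul ()) ()

lemma covVec_covVec_sub (hA : ∀ i, SmoothMatrixOn (A i) U) {v : Model d → m → ℝ}
    (hv : ∀ k, ContDiffOn ℝ ∞ (fun z => v z k) U) (hU : IsOpen U) (hy : y ∈ U) (i j : Fin d) :
    covVec A i (covVec A j v) y - covVec A j (covVec A i v) y = connCurvature A i j y *ᵥ v y := by
  have hcomm := covHom_covHom_sub (A := fun _ _ => (0 : Matrix Unit Unit ℝ))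
    (fun _ _ _ => contDiffOn_const) hA (smoothMatrixOn_replicateCol hv) hU hy i j
  have hcol : ∀ a, covHom (fun _ _ => 0) A a (fun z => replicateCol Unit (v z)) =
      fun z => replicateCol Unit (covVec A a v z) := fun a =>
    funext fun _ => covHom_replicateCol a v
  have hflat : connCurvature (fun _ _ => (0 : Matrix Unit Unit ℝ)) i j y = 0 := by
    simp [connCurvature, pdMatrix_const]
  rw [hcol, hcol, covHom_replicateCol, covHom_replicateCol, hflat, Matrix.mul_zero, sub_zero,
    ← replicateCol_mulVec] at hcomm
  exact replicateCol_injective (ι := Unit) hcomm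

end Sections

section Gradient

open Matrix

variable {d : ℕ} {U : Set (Model d)} {y : Model d} {G : Model d → Matrix (Fin d) (Fin d) ℝ}
  {u : Model d → ℝ}

/-- The components `∂ᵢ u` of the differential of a function. -/
def differential (u : Model d → ℝ) (y : Model d) : Fin d → ℝ := fun i => pd i u y

/-- The components `Gⁱʲ ∂ⱼ u` of the gradient of a function. -/
def gradient (G : Model d → Matrix (Fin d) (Fin d) ℝ) (u : Model d → ℝ) (y : Model d) :
    Fin d → ℝ :=
  (G y)⁻¹ *ᵥ differential u y

lemma covVec_differential (i : Fin d) :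
    covVec (dualConn (leviCivita G)) i (differential u) y = coordHess G u y i := by
  ext a
  simp [covVec, dualConn, neg_mulVec, mulVec_transpose, vecMul, dotProduct, coordHess,
    leviCivita_apply, differential, mul_comm, sub_eq_add_neg]

lemma contDiffOn_differential (hu : ContDiffOn ℝ ∞ u U) (hU : IsOpen U) (i : Fin d) :
    ContDiffOn ℝ ∞ (fun z => differential u z i) U :=
  contDiffOn_pd hu hU i

namespace IsMetricOn

lemma contDiffOn_gradient (hG : IsMetricOn G U) (hu : ContDiffOn ℝ ∞ u U) (i : Fin d) :
    ContDiffOn ℝ ∞ (fun z => gradient G u z i) U :=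
  (hG.inv_smooth.mul (smoothMatrixOn_replicateCol (contDiffOn_differential hu hG.isOpen))) i ()

lemma coordHess_smooth (hG : IsMetricOn G U) (hu : ContDiffOn ℝ ∞ u U) :
    SmoothMatrixOn (coordHess G u) U := fun i j => by
  simp only [← covVec_differential]
  exact contDiffOn_covVec hG.dualConn_smooth (contDiffOn_differential hu hG.isOpen) hG.isOpen i j

lemma mulVec_gradient (hG : IsMetricOn G U) (hy : y ∈ U) :
    G y *ᵥ gradient G u y = differential u y := by
  rw [gradient, mulVec_mulVec, hG.mul_inv hy, one_mulVec]

lemma covVec_gradient (hG : IsMetricOn G U) (hu : ContDiffOn ℝ ∞ u U) (hy : y ∈ U) (i : Fin d) :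
    covVec (leviCivita G) i (gradient G u) y = (coordHess G u y * (G y)⁻¹) i := by
  unfold gradient
  rw [covVec_mulVec (A := dualConn (leviCivita G)) hG.inv_smooth
    (contDiffOn_differential hu hG.isOpen) hG.isOpen hy, hG.covHom_inv hy, zero_mulVec, zero_add,
    covVec_differential]
  ext a
  rw [mulVec, dotProduct_comm, Matrix.mul_apply]
  exact Finset.sum_congr rfl fun b _ => by rw [hG.inv_symm hy]

end IsMetricOn

lemma covHom_dualConn_apply (E : Model d → Matrix (Fin d) (Fin d) ℝ) (i j k : Fin d) :
    covHom (dualConn (leviCivita G)) (dualConn (leviCivita G)) i E y j k =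
      covVec (leviCivita G) i (fun z => E z j) y k - ∑ p, christoffel G p i j y * E y p k := by
  simp only [covHom, covVec, dualConn, Matrix.add_apply, Matrix.sub_apply, Matrix.mul_apply,
    Matrix.neg_apply, Matrix.transpose_apply, pdMatrix_apply, leviCivita_apply, mulVec, dotProduct,
    neg_mul, mul_neg, mul_comm (E y j _)]
  ring

lemma IsMetricOn.ricci_identity (hG : IsMetricOn G U) {v : Model d → Fin d → ℝ}
    (hv : ∀ k, ContDiffOn ℝ ∞ (fun z => v z k) U) {E : Model d → Matrix (Fin d) (Fin d) ℝ}
    (hE : ∀ z ∈ U, ∀ i, E z i = covVec (leviCivita G) i v z) (hy : y ∈ U) (i : Fin d) :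
    divergence G E y i - pd i (fun z => (E z).trace) y = (coordRicci G y *ᵥ v y) i := by
  have hE_smooth : SmoothMatrixOn E U := fun a b =>
    (contDiffOn_covVec hG.leviCivita_smooth hv hG.isOpen a b).congr
      fun z hz => congrFun (hE z hz a) b
  have hcov : ∀ a b, covVec (leviCivita G) a (fun z => E z b) y =
      covVec (leviCivita G) a (covVec (leviCivita G) b v) y := fun a b => by
    ext k
    simp only [covVec, hE y hy,
      pd_congr_on hG.isOpen (fun z hz => congrFun (hE z hz b) k) hy]
  have hcomm : ∀ m, covHom (dualConn (leviCivita G)) (dualConn (leviCivita G)) m E y i m -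
      covHom (dualConn (leviCivita G)) (dualConn (leviCivita G)) i E y m m =
        (connCurvature (leviCivita G) m i y *ᵥ v y) m := fun m => by
    rw [covHom_dualConn_apply, covHom_dualConn_apply, hcov, hcov,
      ← covVec_covVec_sub hG.leviCivita_smooth hv hG.isOpen hy]
    simp only [hG.christoffel_symm hy _ m i, Pi.sub_apply]
    ring
  rw [← trace_covHom_self (A := dualConn (leviCivita G)) hE_smooth hG.isOpen hy, divergence,
    Matrix.trace, ← Finset.sum_sub_distrib]
  simp only [Matrix.diag_apply, hcomm, mulVec, dotProduct, coordRicci_apply, Finset.sum_mul]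
  exact Finset.sum_comm

end Gradient

/-! ### The prolonged almost Einstein equation -/

section Prolongation

open Matrix

variable {d : ℕ} {U : Set (Model d)} {y : Model d} {G : Model d → Matrix (Fin d) (Fin d) ℝ}
  {u r : Model d → ℝ}

/-- The trace `J` of the Schouten tensor. -/
def coordSchoutenTrace (G : Model d → Matrix (Fin d) (Fin d) ℝ) (y : Model d) : ℝ :=
  (mixedRicci G y).trace / (2 * ((d : ℝ) - 1))

/-- The Schouten tensor `Pᵢⱼ`. -/
def coordSchouten (G : Model d → Matrix (Fin d) (Fin d) ℝ) (y : Model d) :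
    Matrix (Fin d) (Fin d) ℝ :=
  ((d : ℝ) - 2)⁻¹ • (coordRicci G y - coordSchoutenTrace G y • G y)

lemma coordRicci_eq (hd : 3 ≤ d) :
    coordRicci G y = ((d : ℝ) - 2) • coordSchouten G y + coordSchoutenTrace G y • G y := by
  have hd3 : (3 : ℝ) ≤ d := by exact_mod_cast hd
  rw [coordSchouten, smul_inv_smul₀ (by linarith), sub_add_cancel]

namespace IsMetricOn

lemma coordSchoutenTrace_smooth (hG : IsMetricOn G U) : ContDiffOn ℝ ∞ (coordSchoutenTrace G) U :=
  hG.mixedRicci_smooth.trace.div_const _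

lemma coordSchouten_smooth (hG : IsMetricOn G U) : SmoothMatrixOn (coordSchouten G) U :=
  fun i j => contDiffOn_const.mul
    ((hG.ricci_smooth i j).sub (hG.coordSchoutenTrace_smooth.mul (hG.smooth i j)))

lemma mixedRicci_eq (hG : IsMetricOn G U) (hd : 3 ≤ d) (hy : y ∈ U) :
    mixedRicci G y = ((d : ℝ) - 2) • (coordSchouten G y * (G y)⁻¹) +
      coordSchoutenTrace G y • (1 : Matrix (Fin d) (Fin d) ℝ) := by
  rw [mixedRicci, coordRicci_eq hd, Matrix.add_mul, Matrix.smul_mul, Matrix.smul_mul,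
    hG.mul_inv hy]

lemma trace_coordSchouten (hG : IsMetricOn G U) (hd : 3 ≤ d) (hy : y ∈ U) :
    (coordSchouten G y * (G y)⁻¹).trace = coordSchoutenTrace G y := by
  have hd3 : (3 : ℝ) ≤ d := by exact_mod_cast hd
  have htrace := congrArg Matrix.trace (hG.mixedRicci_eq hd hy)
  have hJ : (mixedRicci G y).trace = 2 * ((d : ℝ) - 1) * coordSchoutenTrace G y := by
    rw [coordSchoutenTrace, mul_div_cancel₀]
    nlinarith
  rw [hJ, Matrix.trace_add, Matrix.trace_smul, Matrix.trace_smul, Matrix.trace_one,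
    Fintype.card_fin, smul_eq_mul, smul_eq_mul] at htrace
  refine mul_left_cancel₀ (show (d : ℝ) - 2 ≠ 0 by linarith) ?_
  linear_combination -htrace

end IsMetricOn

lemma covHom_smul_one {f : Model d → ℝ} (hf : ContDiffOn ℝ ∞ f U) (hU : IsOpen U) (hy : y ∈ U)
    (A : Fin d → Model d → Matrix (Fin d) (Fin d) ℝ) (i : Fin d) :
    covHom A A i (fun z => f z • 1) y = pd i f y • (1 : Matrix (Fin d) (Fin d) ℝ) := by
  rw [covHom_smul hf (.const 1) hU hy]
  simp [covHom, pdMatrix_const]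

namespace IsMetricOn

lemma mixedSchouten_smooth (hG : IsMetricOn G U) :
    SmoothMatrixOn (fun z => coordSchouten G z * (G z)⁻¹) U :=
  hG.coordSchouten_smooth.mul hG.inv_smooth

lemma divergence_schouten (hG : IsMetricOn G U) (hd : 3 ≤ d) (hy : y ∈ U) (i : Fin d) :
    divergence G (fun z => coordSchouten G z * (G z)⁻¹) y i = pd i (coordSchoutenTrace G) y := by
  have hd3 : (3 : ℝ) ≤ d := by exact_mod_cast hd
  have hcov : ∀ m, covHom (dualConn (leviCivita G)) (dualConn (leviCivita G)) m (mixedRicci G) y =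
      ((d : ℝ) - 2) • covHom (dualConn (leviCivita G)) (dualConn (leviCivita G)) m
        (fun z => coordSchouten G z * (G z)⁻¹) y +
          pd m (coordSchoutenTrace G) y • (1 : Matrix (Fin d) (Fin d) ℝ) := fun m => by
    rw [covHom_congr hG.isOpen (fun z hz => hG.mixedRicci_eq hd hz) hy,
      covHom_add (.smul contDiffOn_const hG.mixedSchouten_smooth)
        (.smul hG.coordSchoutenTrace_smooth (.const 1)) hG.isOpen hy,
      covHom_smul contDiffOn_const hG.mixedSchouten_smooth hG.isOpen hy, pd_const, zero_smul,
      zero_add, covHom_smul_one hG.coordSchoutenTrace_smooth hG.isOpen hy]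
  have hdiv : divergence G (mixedRicci G) y i =
      ((d : ℝ) - 2) * divergence G (fun z => coordSchouten G z * (G z)⁻¹) y i +
        pd i (coordSchoutenTrace G) y := by
    simp [divergence, hcov, Finset.sum_add_distrib, Finset.mul_sum, Matrix.one_apply]
  have htrace : pd i (fun z => (mixedRicci G z).trace) y =
      2 * ((d : ℝ) - 1) * pd i (coordSchoutenTrace G) y := by
    rw [← pd_const_mul _ (differentiableAt_of_contDiffOn hG.coordSchoutenTrace_smooth hG.isOpen hy)]
    congr 1
    ext z
    rw [coordSchoutenTrace, mul_div_cancel₀]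
    nlinarith
  refine mul_left_cancel₀ (show (d : ℝ) - 2 ≠ 0 by linarith) ?_
  linear_combination (1 / 2) * hG.contracted_bianchi hy i - hdiv + (1 / 2) * htrace

lemma hessian_mul_inv_of_almostEinstein (hG : IsMetricOn G U) (hy : y ∈ U)
    (h : coordHess G u y + u y • coordSchouten G y + r y • G y = 0) :
    coordHess G u y * (G y)⁻¹ + u y • (coordSchouten G y * (G y)⁻¹) +
      r y • (1 : Matrix (Fin d) (Fin d) ℝ) = 0 := by
  have hmul := congrArg (· * (G y)⁻¹) h
  simpa only [Matrix.add_mul, Matrix.smul_mul, hG.mul_inv hy, Matrix.zero_mul] using hmul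

lemma covHom_almostEinstein (hG : IsMetricOn G U) (hu : ContDiffOn ℝ ∞ u U)
    (hr : ContDiffOn ℝ ∞ r U)
    (h : ∀ z ∈ U, coordHess G u z + u z • coordSchouten G z + r z • G z = 0) (hy : y ∈ U)
    (A : Fin d → Model d → Matrix (Fin d) (Fin d) ℝ) (i : Fin d) :
    covHom A A i (fun z => coordHess G u z * (G z)⁻¹) y +
      (pd i u y • (coordSchouten G y * (G y)⁻¹) +
        u y • covHom A A i (fun z => coordSchouten G z * (G z)⁻¹) y) +
      pd i r y • (1 : Matrix (Fin d) (Fin d) ℝ) = 0 := by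
  have hHess : SmoothMatrixOn (fun z => coordHess G u z * (G z)⁻¹) U :=
    (hG.coordHess_smooth hu).mul hG.inv_smooth
  have hSchouten : SmoothMatrixOn (fun z => u z • (coordSchouten G z * (G z)⁻¹)) U :=
    .smul hu hG.mixedSchouten_smooth
  have hzero := covHom_congr (A := A) (B := A) hG.isOpen
    (fun z hz => hG.hessian_mul_inv_of_almostEinstein hz (h z hz)) hy i
  rwa [covHom_zero, covHom_add (hHess.add hSchouten) (.smul hr (.const 1))
    hG.isOpen hy, covHom_add hHess hSchouten hG.isOpen hy,
    covHom_smul hu hG.mixedSchouten_smooth hG.isOpen hy, covHom_smul_one hr hG.isOpen hy] at hzero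

lemma divergence_hessian_of_almostEinstein (hG : IsMetricOn G U) (hd : 3 ≤ d)
    (hu : ContDiffOn ℝ ∞ u U) (hr : ContDiffOn ℝ ∞ r U)
    (h : ∀ z ∈ U, coordHess G u z + u z • coordSchouten G z + r z • G z = 0) (hy : y ∈ U)
    (i : Fin d) :
    divergence G (fun z => coordHess G u z * (G z)⁻¹) y i =
      -(coordSchouten G y *ᵥ gradient G u y) i - u y * pd i (coordSchoutenTrace G) y -
        pd i r y := by
  have hsum := Finset.sum_eq_zero fun m (_ : m ∈ Finset.univ) =>
    congrFun (congrFun (hG.covHom_almostEinstein hu hr h hy (dualConn (leviCivita G)) m) i) m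
  simp only [Matrix.add_apply, Matrix.smul_apply, smul_eq_mul, Matrix.one_apply,
    Finset.sum_add_distrib, ← Finset.mul_sum, mul_ite, mul_one, mul_zero, Finset.sum_ite_eq,
    Finset.mem_univ, if_true] at hsum
  rw [gradient, mulVec_mulVec]
  simp only [← hG.divergence_schouten hd hy, mulVec, dotProduct, differential, divergence,
    mul_comm _ (pd _ u y)]
  linarith

lemma pd_trace_hessian_of_almostEinstein (hG : IsMetricOn G U) (hd : 3 ≤ d)
    (hu : ContDiffOn ℝ ∞ u U) (hr : ContDiffOn ℝ ∞ r U)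
    (h : ∀ z ∈ U, coordHess G u z + u z • coordSchouten G z + r z • G z = 0) (hy : y ∈ U)
    (i : Fin d) :
    pd i (fun z => (coordHess G u z * (G z)⁻¹).trace) y =
      -(coordSchoutenTrace G y * pd i u y) - u y * pd i (coordSchoutenTrace G) y -
        d * pd i r y := by
  have htrace := congrArg Matrix.trace
    (hG.covHom_almostEinstein hu hr h hy (dualConn (leviCivita G)) i)
  rw [Matrix.trace_add, Matrix.trace_add, Matrix.trace_add, Matrix.trace_smul,
    Matrix.trace_smul, Matrix.trace_smul, Matrix.trace_one, Matrix.trace_zero, Fintype.card_fin,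
    trace_covHom_self ((hG.coordHess_smooth hu).mul hG.inv_smooth) hG.isOpen hy,
    trace_covHom_self hG.mixedSchouten_smooth hG.isOpen hy, hG.trace_coordSchouten hd hy,
    pd_congr_on hG.isOpen (fun z hz => hG.trace_coordSchouten hd hz) hy, smul_eq_mul, smul_eq_mul,
    smul_eq_mul] at htrace
  linarith

-- Compare the Ricci identity for the gradient of `u` with the divergence and the differentiated
-- trace of the equation; `∇ᵐPᵢₘ = ∂ᵢJ` cancels the derivatives of the curvature.
lemma differential_of_almostEinstein (hG : IsMetricOn G U) (hd : 3 ≤ d)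
    (hu : ContDiffOn ℝ ∞ u U) (hr : ContDiffOn ℝ ∞ r U)
    (h : ∀ z ∈ U, coordHess G u z + u z • coordSchouten G z + r z • G z = 0) (hy : y ∈ U) :
    differential r y = coordSchouten G y *ᵥ gradient G u y := by
  have hd3 : (3 : ℝ) ≤ d := by exact_mod_cast hd
  ext i
  have hricci := hG.ricci_identity (hG.contDiffOn_gradient hu)
    (fun z hz j => (hG.covVec_gradient hu hz j).symm) hy i
  rw [hG.divergence_hessian_of_almostEinstein hd hu hr h hy,
    hG.pd_trace_hessian_of_almostEinstein hd hu hr h hy, coordRicci_eq hd, add_mulVec, smul_mulVec,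
    smul_mulVec, hG.mulVec_gradient hy] at hricci
  simp only [Pi.add_apply, Pi.smul_apply, smul_eq_mul, differential] at hricci ⊢
  refine mul_left_cancel₀ (show (d : ℝ) - 1 ≠ 0 by linarith) ?_
  linear_combination hricci

end IsMetricOn

/-- The squared norm `|du|² + 2ur` of the tractor with components `(u, du, r)`. -/
def coordNormSq (G : Model d → Matrix (Fin d) (Fin d) ℝ) (u r : Model d → ℝ) (y : Model d) : ℝ :=
  differential u y ⬝ᵥ gradient G u y + 2 * (u y * r y)

namespace IsMetricOn

lemma contDiffOn_differential_dotProduct_gradient (hG : IsMetricOn G U)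
    (hu : ContDiffOn ℝ ∞ u U) :
    ContDiffOn ℝ ∞ (fun z => differential u z ⬝ᵥ gradient G u z) U :=
  ContDiffOn.sum fun i _ =>
    (contDiffOn_differential hu hG.isOpen i).mul (hG.contDiffOn_gradient hu i)

lemma contDiffOn_coordNormSq (hG : IsMetricOn G U) (hu : ContDiffOn ℝ ∞ u U)
    (hr : ContDiffOn ℝ ∞ r U) : ContDiffOn ℝ ∞ (coordNormSq G u r) U :=
  (hG.contDiffOn_differential_dotProduct_gradient hu).add (contDiffOn_const.mul (hu.mul hr))

lemma pd_coordNormSq (hG : IsMetricOn G U) (hd : 3 ≤ d) (hu : ContDiffOn ℝ ∞ u U)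
    (hr : ContDiffOn ℝ ∞ r U)
    (h : ∀ z ∈ U, coordHess G u z + u z • coordSchouten G z + r z • G z = 0) (hy : y ∈ U)
    (i : Fin d) : pd i (coordNormSq G u r) y = 0 := by
  have hdiff {f : Model d → ℝ} (hf : ContDiffOn ℝ ∞ f U) : DifferentiableAt ℝ f y :=
    differentiableAt_of_contDiffOn hf hG.isOpen hy
  have hpair : pd i (fun z => differential u z ⬝ᵥ gradient G u z) y =
      2 * (coordHess G u y *ᵥ gradient G u y) i := by
    rw [pd_dotProduct (A := leviCivita G) (contDiffOn_differential hu hG.isOpen)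
      (hG.contDiffOn_gradient hu) hG.isOpen hy, covVec_differential, hG.covVec_gradient hu hy,
      dotProduct_comm (differential u y), two_mul]
    change _ + ((coordHess G u y * (G y)⁻¹) *ᵥ differential u y) i = _
    rw [← mulVec_mulVec]
    rfl
  have hhess := congrFun (congrArg (· *ᵥ gradient G u y) (h y hy)) i
  simp only [add_mulVec, smul_mulVec, hG.mulVec_gradient hy,
    ← hG.differential_of_almostEinstein hd hu hr h hy, Pi.add_apply, Pi.smul_apply, smul_eq_mul,
    zero_mulVec, Pi.zero_apply] at hhess
  have hprod : ContDiffOn ℝ ∞ (fun z => 2 * (u z * r z)) U := contDiffOn_const.mul (hu.mul hr)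
  unfold coordNormSq
  rw [pd_fun_add (hdiff (hG.contDiffOn_differential_dotProduct_gradient hu)) (hdiff hprod),
    pd_const_mul (u := fun z => u z * r z) 2 (hdiff (hu.mul hr)), pd_fun_mul (hdiff hu) (hdiff hr),
    hpair]
  simp only [differential] at hhess
  linear_combination 2 * hhess

end IsMetricOn

end Prolongation

/-! ### Conformal change of the metric -/

section Conformal

open Matrix

variable {d : ℕ} {U : Set (Model d)} {y : Model d} {G G' : Model d → Matrix (Fin d) (Fin d) ℝ}
  {f : Model d → ℝ}

/-- The matrix `(∂_v f) δᵏₗ + vᵏ ∂ₗ f - (∇ᵏ f) vₗ`, which is the difference in the direction `v`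
of the Levi-Civita connections of `e^{2 f} G` and `G`. -/
def conformalDiff (G : Model d → Matrix (Fin d) (Fin d) ℝ) (f : Model d → ℝ) (v : Fin d → ℝ)
    (z : Model d) : Matrix (Fin d) (Fin d) ℝ :=
  (differential f z ⬝ᵥ v) • (1 : Matrix (Fin d) (Fin d) ℝ) + vecMulVec v (differential f z) -
    vecMulVec (gradient G f z) (G z *ᵥ v)

lemma vecMul_conformalDiff (w v : Fin d → ℝ) :
    w ᵥ* conformalDiff G f v y = (differential f y ⬝ᵥ v) • w + (w ⬝ᵥ v) • differential f y -
      (w ⬝ᵥ gradient G f y) • (G y *ᵥ v) := by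
  simp only [conformalDiff, vecMul_add, vecMul_sub, vecMul_smul, vecMul_one, vecMul_vecMulVec]

lemma sum_smul_conformalDiff_single (v : Fin d → ℝ) :
    ∑ a, v a • conformalDiff G f (Pi.single a 1) y = conformalDiff G f v y := by
  ext k l
  simp only [conformalDiff, Matrix.sum_apply, Matrix.smul_apply, Matrix.sub_apply,
    Matrix.add_apply, vecMulVec_apply, smul_eq_mul, mul_sub, mul_add, Finset.sum_sub_distrib,
    Finset.sum_add_distrib, dotProduct_single, mul_one, mulVec_single_one, col_apply]
  congr 2
  · simp only [dotProduct, Finset.sum_mul]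
    exact Finset.sum_congr rfl fun a _ => by ring
  · simp [Pi.single_apply]
  · simp only [mulVec, dotProduct, Finset.mul_sum]
    exact Finset.sum_congr rfl fun a _ => by ring

namespace IsMetricOn

lemma metric_mulVec_single (hG : IsMetricOn G U) (hy : y ∈ U) (i : Fin d) :
    G y *ᵥ Pi.single i 1 = G y i := by
  ext j
  rw [mulVec_single_one]
  exact hG.symm y hy j i

lemma conformal (hG : IsMetricOn G U) (hf : ContDiffOn ℝ ∞ f U)
    (h : ∀ z ∈ U, G' z = Real.exp (2 * f z) • G z) : IsMetricOn G' U where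
  isOpen := hG.isOpen
  smooth i j := ContDiffOn.congr
    ((Real.contDiff_exp.comp_contDiffOn (contDiffOn_const.mul hf)).mul (hG.smooth i j))
    fun z hz => by rw [h z hz]; rfl
  symm z hz i j := by
    rw [h z hz, Matrix.smul_apply, Matrix.smul_apply, hG.symm z hz]
  det z hz := by
    rw [h z hz, det_smul]
    exact ((Real.exp_ne_zero _).isUnit.pow _).mul (hG.det z hz)

lemma inv_conformal (hG : IsMetricOn G U) (hy : y ∈ U) (h : G' y = Real.exp (2 * f y) • G y) :
    (G' y)⁻¹ = (Real.exp (2 * f y))⁻¹ • (G y)⁻¹ := by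
  rw [h]
  exact inv_smul' _ (Units.mk0 _ (Real.exp_ne_zero (2 * f y))) (hG.det y hy)

lemma mul_conformalDiff (hG : IsMetricOn G U) (hy : y ∈ U) (v : Fin d → ℝ) :
    G y * conformalDiff G f v y = (differential f y ⬝ᵥ v) • G y +
      (vecMulVec (G y *ᵥ v) (differential f y) - vecMulVec (differential f y) (G y *ᵥ v)) := by
  rw [conformalDiff, Matrix.mul_sub, Matrix.mul_add, Matrix.mul_smul, Matrix.mul_one,
    mul_vecMulVec, mul_vecMulVec, hG.mulVec_gradient hy, add_sub_assoc]

lemma leviCivita_conformal (hG : IsMetricOn G U) (hf : ContDiffOn ℝ ∞ f U)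
    (h : ∀ z ∈ U, G' z = Real.exp (2 * f z) • G z) (hy : y ∈ U) (i : Fin d) :
    leviCivita G' i y = leviCivita G i y + conformalDiff G f (Pi.single i 1) y := by
  set A : Fin d → Model d → Matrix (Fin d) (Fin d) ℝ :=
    fun i z => leviCivita G i z + conformalDiff G f (Pi.single i 1) z with hA
  refine (hG.conformal hf h).leviCivita_unique hy (A := A) (fun i j k => ?_) (fun k => ?_) i
  · simp only [hA, Matrix.add_apply, leviCivita_apply, hG.christoffel_symm hy k i j, conformalDiff,
      Matrix.sub_apply, Matrix.smul_apply, vecMulVec_apply, dotProduct_single,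
      hG.metric_mulVec_single hy, hG.symm y hy i j, Matrix.one_apply, Pi.single_apply, smul_eq_mul]
    ring
  · have hexp : ContDiffOn ℝ ∞ (fun z => Real.exp (2 * f z)) U :=
      Real.contDiff_exp.comp_contDiffOn (contDiffOn_const.mul hf)
    have hf_y := differentiableAt_of_contDiffOn hf hG.isOpen hy
    have hdiff : (conformalDiff G f (Pi.single k 1) y)ᵀ * G y +
        G y * conformalDiff G f (Pi.single k 1) y = (2 * pd k f y) • G y := by
      have htr : (conformalDiff G f (Pi.single k 1) y)ᵀ * G y =
          (G y * conformalDiff G f (Pi.single k 1) y)ᵀ := by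
        rw [transpose_mul, hG.transpose_eq hy]
      rw [htr, hG.mul_conformalDiff hy, transpose_add, transpose_sub, transpose_smul,
        hG.transpose_eq hy, transpose_vecMulVec, transpose_vecMulVec, dotProduct_single, mul_one,
        two_mul, add_smul, differential]
      abel
    have hcov : covHom A (dualConn A) k G y = -((2 * pd k f y) • G y) := by
      rw [← hdiff, ← sub_eq_zero, ← hG.covHom_metric hy k]
      simp only [covHom, dualConn, hA, transpose_add, Matrix.mul_add, Matrix.add_mul,
        Matrix.neg_mul, neg_add]
      abel
    rw [covHom_congr hG.isOpen h hy, covHom_smul hexp hG.smooth hG.isOpen hy, hcov,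
      pd_exp k (hf_y.const_mul 2), pd_const_mul 2 hf_y, smul_neg, smul_smul, add_neg_cancel]

lemma contDiffOn_metric_mulVec (hG : IsMetricOn G U) {v : Model d → Fin d → ℝ}
    (hv : ∀ k, ContDiffOn ℝ ∞ (fun z => v z k) U) (k : Fin d) :
    ContDiffOn ℝ ∞ (fun z => (G z *ᵥ v z) k) U :=
  (hG.smooth.mul (smoothMatrixOn_replicateCol hv)) k ()

lemma conformalDiff_smooth (hG : IsMetricOn G U) (hf : ContDiffOn ℝ ∞ f U)
    {v : Model d → Fin d → ℝ} (hv : ∀ k, ContDiffOn ℝ ∞ (fun z => v z k) U) :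
    SmoothMatrixOn (fun z => conformalDiff G f (v z) z) U :=
  have hdf := contDiffOn_differential hf hG.isOpen
  ((SmoothMatrixOn.smul (ContDiffOn.sum fun k _ => (hdf k).mul (hv k)) (.const 1)).add
    fun k l => (hv k).mul (hdf l)).sub
      fun k l => (hG.contDiffOn_gradient hf k).mul (hG.contDiffOn_metric_mulVec hv l)

lemma covHom_conformalDiff (hG : IsMetricOn G U) (hf : ContDiffOn ℝ ∞ f U)
    {v : Model d → Fin d → ℝ} (hv : ∀ k, ContDiffOn ℝ ∞ (fun z => v z k) U) (hy : y ∈ U)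
    (i : Fin d) :
    covHom (leviCivita G) (leviCivita G) i (fun z => conformalDiff G f (v z) z) y =
      conformalDiff G f (covVec (leviCivita G) i v y) y +
        ((coordHess G f y i ⬝ᵥ v y) • (1 : Matrix (Fin d) (Fin d) ℝ) +
          vecMulVec (v y) (coordHess G f y i) -
          vecMulVec ((coordHess G f y * (G y)⁻¹) i) (G y *ᵥ v y)) := by
  have hdf := contDiffOn_differential hf hG.isOpen
  have hpair : ContDiffOn ℝ ∞ (fun z => differential f z ⬝ᵥ v z) U :=
    ContDiffOn.sum fun k _ => (hdf k).mul (hv k)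
  have hvdf : SmoothMatrixOn (fun z => vecMulVec (v z) (differential f z)) U :=
    fun k l => (hv k).mul (hdf l)
  have hgrad : SmoothMatrixOn (fun z => vecMulVec (gradient G f z) (G z *ᵥ v z)) U :=
    fun k l => (hG.contDiffOn_gradient hf k).mul (hG.contDiffOn_metric_mulVec hv l)
  unfold conformalDiff
  rw [covHom_sub ((SmoothMatrixOn.smul hpair (.const 1)).add hvdf) hgrad hG.isOpen hy,
    covHom_add (.smul hpair (.const 1)) hvdf hG.isOpen hy,
    covHom_smul_one hpair hG.isOpen hy, covHom_vecMulVec hv hdf hG.isOpen hy,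
    covHom_vecMulVec (hG.contDiffOn_gradient hf) (hG.contDiffOn_metric_mulVec hv) hG.isOpen hy,
    covVec_mulVec (A := leviCivita G) hG.smooth hv hG.isOpen hy, hG.covHom_metric hy,
    hG.covVec_gradient hf hy, covVec_differential,
    pd_dotProduct (A := leviCivita G) hdf hv hG.isOpen hy, covVec_differential, zero_mulVec,
    zero_add, add_smul]
  abel

lemma conformalDiff_gradient (hG : IsMetricOn G U) (hy : y ∈ U) :
    conformalDiff G f (gradient G f y) y =
      (differential f y ⬝ᵥ gradient G f y) • (1 : Matrix (Fin d) (Fin d) ℝ) := by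
  rw [conformalDiff, hG.mulVec_gradient hy, add_sub_cancel_right]

lemma sum_conformalDiff_single_apply (hG : IsMetricOn G U) (hy : y ∈ U) (l : Fin d) :
    ∑ a, conformalDiff G f (Pi.single a 1) y a l = d * differential f y l := by
  have hgrad : ∑ a, gradient G f y a * G y l a = differential f y l := by
    rw [← hG.mulVec_gradient (u := f) hy, mulVec, dotProduct_comm]
    rfl
  simp [conformalDiff, vecMulVec_apply, Finset.sum_add_distrib, hgrad, Matrix.one_apply]

lemma sum_conformalDiff_mul_apply (hG : IsMetricOn G U) (hy : y ∈ U) (j l : Fin d) :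
    ∑ a, (conformalDiff G f (Pi.single a 1) y * conformalDiff G f (Pi.single j 1) y) a l =
      d * (2 * (differential f y j * differential f y l) -
        (differential f y ⬝ᵥ gradient G f y) * G y j l) := by
  have hrow := congrFun (vecMul_conformalDiff (G := G) (f := f) (y := y) (differential f y)
    (Pi.single j 1)) l
  simp only [vecMul, dotProduct_single, mul_one, hG.metric_mulVec_single hy, Pi.sub_apply,
    Pi.add_apply, Pi.smul_apply, smul_eq_mul] at hrow
  simp only [Matrix.mul_apply]
  rw [Finset.sum_comm]
  simp only [← Finset.sum_mul, hG.sum_conformalDiff_single_apply hy, mul_assoc, ← Finset.mul_sum]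
  rw [← dotProduct, hrow]
  ring

-- The sum over the gradient direction is `T(∇f) = |df|²`.
lemma sum_mul_conformalDiff_apply (hG : IsMetricOn G U) (hy : y ∈ U) (j l : Fin d) :
    ∑ a, (conformalDiff G f (Pi.single j 1) y * conformalDiff G f (Pi.single a 1) y) a l =
      (d + 2) * (differential f y j * differential f y l) -
        2 * (differential f y ⬝ᵥ gradient G f y) * G y j l := by
  have hrow := congrFun (vecMul_conformalDiff (G := G) (f := f) (y := y) (differential f y)
    (Pi.single j 1)) l
  simp only [dotProduct_single, mul_one, hG.metric_mulVec_single hy, Pi.sub_apply,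
    Pi.add_apply, Pi.smul_apply, smul_eq_mul] at hrow
  have hgrad : ∑ a, gradient G f y a * (G y j ᵥ* conformalDiff G f (Pi.single a 1) y) l =
      (differential f y ⬝ᵥ gradient G f y) * G y j l := by
    have hsum := congrArg (fun T => (G y j ᵥ* T) l)
      (sum_smul_conformalDiff_single (G := G) (f := f) (y := y) (gradient G f y))
    simpa [hG.conformalDiff_gradient hy, vecMul_sum, vecMul_smul] using hsum
  have hsplit : ∀ a,
      (conformalDiff G f (Pi.single j 1) y * conformalDiff G f (Pi.single a 1) y) a l =
        differential f y j * conformalDiff G f (Pi.single a 1) y a l +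
          (Pi.single j 1 : Fin d → ℝ) a *
            (differential f y ᵥ* conformalDiff G f (Pi.single a 1) y) l -
          gradient G f y a * (G y j ᵥ* conformalDiff G f (Pi.single a 1) y) l := fun a => by
    conv_lhs => rw [conformalDiff, Matrix.sub_mul, Matrix.add_mul, Matrix.smul_mul, Matrix.one_mul,
      vecMulVec_mul, vecMulVec_mul, dotProduct_single, mul_one, hG.metric_mulVec_single hy]
    rfl
  simp only [hsplit, Finset.sum_sub_distrib, Finset.sum_add_distrib, ← Finset.mul_sum,
    hG.sum_conformalDiff_single_apply hy, hgrad, Pi.single_apply, ite_mul, one_mul, zero_mul,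
    Finset.sum_ite_eq', Finset.mem_univ, if_true]
  simp only [hrow]
  ring

lemma coordHess_symm (hG : IsMetricOn G U) (hf : ContDiffOn ℝ ∞ f U) (hy : y ∈ U) (i j : Fin d) :
    coordHess G f y i j = coordHess G f y j i := by
  simp only [coordHess, Matrix.of_apply, pd_pd_comm (hf.contDiffAt (hG.isOpen.mem_nhds hy)) i j,
    hG.christoffel_symm hy _ i j]

lemma connCurvature_conformal (hG : IsMetricOn G U) (hf : ContDiffOn ℝ ∞ f U)
    (h : ∀ z ∈ U, G' z = Real.exp (2 * f z) • G z) (hy : y ∈ U) (i j : Fin d) :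
    connCurvature (leviCivita G') i j y = connCurvature (leviCivita G) i j y +
      (vecMulVec (Pi.single j 1) (coordHess G f y i) -
          vecMulVec ((coordHess G f y * (G y)⁻¹) i) (G y j) -
        (vecMulVec (Pi.single i 1) (coordHess G f y j) -
          vecMulVec ((coordHess G f y * (G y)⁻¹) j) (G y i))) +
      (conformalDiff G f (Pi.single i 1) y * conformalDiff G f (Pi.single j 1) y -
        conformalDiff G f (Pi.single j 1) y * conformalDiff G f (Pi.single i 1) y) := by
  have hsmooth : ∀ k, SmoothMatrixOn (conformalDiff G f (Pi.single k 1)) U := fun k =>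
    hG.conformalDiff_smooth hf fun _ => contDiffOn_const
  have hcov : ∀ a b, covHom (leviCivita G) (leviCivita G) a (conformalDiff G f (Pi.single b 1)) y =
      conformalDiff G f (fun k => christoffel G k a b y) y +
        (coordHess G f y a b • (1 : Matrix (Fin d) (Fin d) ℝ) +
          vecMulVec (Pi.single b 1) (coordHess G f y a) -
          vecMulVec ((coordHess G f y * (G y)⁻¹) a) (G y b)) := fun a b => by
    have hsingle : covVec (leviCivita G) a (fun _ => (Pi.single b 1 : Fin d → ℝ)) y =
        fun k => christoffel G k a b y := by
      ext k
      simp [covVec, pd_const, leviCivita_apply]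
    have hcov_single := hG.covHom_conformalDiff hf (v := fun _ => Pi.single b 1)
      (fun _ => contDiffOn_const) hy a
    rwa [hsingle, hG.metric_mulVec_single hy, dotProduct_single, mul_one] at hcov_single
  rw [connCurvature_congr hG.isOpen (fun k z hz => hG.leviCivita_conformal hf h hz k) hy,
    connCurvature_add hG.leviCivita_smooth hsmooth hG.isOpen hy, hcov, hcov,
    funext fun k => hG.christoffel_symm hy k i j, hG.coordHess_symm hf hy i j]
  abel

lemma ricci_conformal (hG : IsMetricOn G U) (hf : ContDiffOn ℝ ∞ f U)
    (h : ∀ z ∈ U, G' z = Real.exp (2 * f z) • G z) (hy : y ∈ U) :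
    coordRicci G' y = coordRicci G y -
      ((d : ℝ) - 2) • (coordHess G f y - vecMulVec (differential f y) (differential f y)) -
      ((coordHess G f y * (G y)⁻¹).trace +
        ((d : ℝ) - 2) * (differential f y ⬝ᵥ gradient G f y)) • G y := by
  ext j l
  have hcancel : ∑ a, (coordHess G f y * (G y)⁻¹) j a * G y a l = coordHess G f y j l := by
    rw [← Matrix.mul_apply, Matrix.mul_assoc, hG.inv_mul hy, Matrix.mul_one]
  have htrace : ∑ a, (coordHess G f y * (G y)⁻¹) a a = (coordHess G f y * (G y)⁻¹).trace := rfl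
  simp only [coordRicci_apply, hG.connCurvature_conformal hf h hy, Matrix.add_apply,
    Matrix.sub_apply, vecMulVec_apply, Finset.sum_add_distrib, Finset.sum_sub_distrib,
    hG.sum_conformalDiff_mul_apply hy, hG.sum_mul_conformalDiff_apply hy, hcancel,
    ← Finset.sum_mul, htrace]
  simp [Pi.single_apply, vecMulVec_apply]
  ring

lemma coordSchoutenTrace_conformal (hG : IsMetricOn G U) (hd : 3 ≤ d) (hf : ContDiffOn ℝ ∞ f U)
    (h : ∀ z ∈ U, G' z = Real.exp (2 * f z) • G z) (hy : y ∈ U) :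
    coordSchoutenTrace G' y = (Real.exp (2 * f y))⁻¹ * (coordSchoutenTrace G y -
      (coordHess G f y * (G y)⁻¹).trace -
      ((d : ℝ) - 2) / 2 * (differential f y ⬝ᵥ gradient G f y)) := by
  have hd3 : (3 : ℝ) ≤ d := by exact_mod_cast hd
  have hd1 : (d : ℝ) - 1 ≠ 0 := by linarith
  have hnorm : (vecMulVec (differential f y) (differential f y) * (G y)⁻¹).trace =
      differential f y ⬝ᵥ gradient G f y := by
    rw [vecMulVec_mul, trace_vecMulVec, dotProduct_comm, ← dotProduct_mulVec, gradient]
  rw [coordSchoutenTrace, mixedRicci, hG.ricci_conformal hf h hy, hG.inv_conformal hy (h y hy)]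
  simp only [Matrix.sub_mul, Matrix.smul_mul, Matrix.mul_smul, hG.mul_inv hy,
    Matrix.trace_smul, Matrix.trace_sub, hnorm, Matrix.trace_one, Fintype.card_fin, smul_eq_mul]
  rw [coordSchoutenTrace, mixedRicci]
  field_simp
  ring

lemma coordSchouten_conformal (hG : IsMetricOn G U) (hd : 3 ≤ d) (hf : ContDiffOn ℝ ∞ f U)
    (h : ∀ z ∈ U, G' z = Real.exp (2 * f z) • G z) (hy : y ∈ U) :
    coordSchouten G' y = coordSchouten G y -
      (coordHess G f y - vecMulVec (differential f y) (differential f y)) -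
      (1 / 2 * (differential f y ⬝ᵥ gradient G f y)) • G y := by
  have hd3 : (3 : ℝ) ≤ d := by exact_mod_cast hd
  have hd2 : (d : ℝ) - 2 ≠ 0 := by linarith
  ext j l
  simp only [coordSchouten, hG.ricci_conformal hf h hy, hG.coordSchoutenTrace_conformal hd hf h hy,
    h y hy, Matrix.smul_apply, Matrix.sub_apply, smul_eq_mul]
  have := Real.exp_ne_zero (2 * f y)
  field_simp
  ring

lemma coordHess_conformal (hG : IsMetricOn G U) (hf : ContDiffOn ℝ ∞ f U)
    (h : ∀ z ∈ U, G' z = Real.exp (2 * f z) • G z) (hy : y ∈ U) (s : Model d → ℝ) :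
    coordHess G' s y = coordHess G s y - (vecMulVec (differential f y) (differential s y) +
      vecMulVec (differential s y) (differential f y)) +
      (differential s y ⬝ᵥ gradient G f y) • G y := by
  ext i j
  have hcov : coordHess G' s y i = coordHess G s y i -
      differential s y ᵥ* conformalDiff G f (Pi.single i 1) y := by
    ext k
    simp only [← covVec_differential, covVec, dualConn, hG.leviCivita_conformal hf h hy,
      transpose_add, neg_mulVec, add_mulVec, mulVec_transpose, Pi.neg_apply, Pi.add_apply,
      Pi.sub_apply]
    ring
  rw [hcov, vecMul_conformalDiff]
  simp only [dotProduct_single, mul_one, hG.metric_mulVec_single hy, Pi.sub_apply, Pi.add_apply,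
    Pi.smul_apply, smul_eq_mul, Matrix.sub_apply, Matrix.add_apply, Matrix.smul_apply,
    vecMulVec_apply]
  ring

end IsMetricOn

lemma differential_mul {u v : Model d → ℝ} (hu : DifferentiableAt ℝ u y)
    (hv : DifferentiableAt ℝ v y) :
    differential (fun z => u z * v z) y = u y • differential v y + v y • differential u y := by
  ext i
  exact pd_fun_mul hu hv

lemma differential_exp {u : Model d → ℝ} (hu : DifferentiableAt ℝ u y) :
    differential (fun z => Real.exp (u z)) y = Real.exp (u y) • differential u y := by
  ext i
  exact pd_exp i hu

lemma coordHess_congr {u v : Model d → ℝ} (hU : IsOpen U) (h : ∀ z ∈ U, u z = v z) (hy : y ∈ U) :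
    coordHess G u y = coordHess G v y := by
  have hp : ∀ j, ∀ z ∈ U, pd j u z = pd j v z := fun j z hz => pd_congr_on hU h hz j
  ext i j
  simp only [coordHess, Matrix.of_apply, pd_congr_on hU (hp j) hy, hp _ y hy]

lemma coordHess_mul {u v : Model d → ℝ} (hU : IsOpen U) (hu : ContDiffOn ℝ ∞ u U)
    (hv : ContDiffOn ℝ ∞ v U) (hy : y ∈ U) :
    coordHess G (fun z => u z * v z) y = u y • coordHess G v y + v y • coordHess G u y +
      (vecMulVec (differential u y) (differential v y) +
        vecMulVec (differential v y) (differential u y)) := by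
  have hdiff {g : Model d → ℝ} (hg : ContDiffOn ℝ ∞ g U) {z : Model d} (hz : z ∈ U) :
      DifferentiableAt ℝ g z := differentiableAt_of_contDiffOn hg hU hz
  have hpd : ∀ j, ∀ z ∈ U, pd j (fun z => u z * v z) z = u z * pd j v z + v z * pd j u z :=
    fun j z hz => pd_fun_mul (hdiff hu hz) (hdiff hv hz)
  have hpd₂ : ∀ i j, pd i (pd j (fun z => u z * v z)) y =
      u y * pd i (pd j v) y + pd j v y * pd i u y + (v y * pd i (pd j u) y + pd j u y * pd i v y) :=
    fun i j => by
      rw [pd_congr_on hU (hpd j) hy,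
        pd_fun_add (hdiff (hu.mul (contDiffOn_pd hv hU j)) hy)
          (hdiff (hv.mul (contDiffOn_pd hu hU j)) hy),
        pd_fun_mul (hdiff hu hy) (hdiff (contDiffOn_pd hv hU j) hy),
        pd_fun_mul (hdiff hv hy) (hdiff (contDiffOn_pd hu hU j) hy)]
  ext i j
  simp only [coordHess, Matrix.of_apply, Matrix.add_apply, Matrix.smul_apply, smul_eq_mul,
    vecMulVec_apply, differential, hpd₂, hpd _ y hy, mul_add, Finset.sum_add_distrib,
    mul_left_comm _ (u y), mul_left_comm _ (v y), ← Finset.mul_sum]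
  ring

lemma coordHess_exp (hU : IsOpen U) (hf : ContDiffOn ℝ ∞ f U) (hy : y ∈ U) :
    coordHess G (fun z => Real.exp (f z)) y = Real.exp (f y) • (coordHess G f y +
      vecMulVec (differential f y) (differential f y)) := by
  have hdiff {g : Model d → ℝ} (hg : ContDiffOn ℝ ∞ g U) {z : Model d} (hz : z ∈ U) :
      DifferentiableAt ℝ g z := differentiableAt_of_contDiffOn hg hU hz
  have hpd : ∀ j, ∀ z ∈ U, pd j (fun z => Real.exp (f z)) z = Real.exp (f z) * pd j f z :=
    fun j z hz => pd_exp j (hdiff hf hz)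
  ext i j
  simp only [coordHess, Matrix.of_apply, Matrix.add_apply, Matrix.smul_apply, smul_eq_mul,
    vecMulVec_apply, differential, hpd _ y hy]
  rw [pd_congr_on hU (hpd j) hy, pd_fun_mul (hdiff hf hy).exp (hdiff (contDiffOn_pd hf hU j) hy),
    hpd i y hy]
  simp only [mul_left_comm _ (Real.exp _), ← Finset.mul_sum]
  ring

lemma IsMetricOn.hess_add_schouten_conformal (hG : IsMetricOn G U) (hd : 3 ≤ d)
    (hf : ContDiffOn ℝ ∞ f U) (h : ∀ z ∈ U, G' z = Real.exp (2 * f z) • G z) {s s' : Model d → ℝ}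
    (hs : ContDiffOn ℝ ∞ s U) (hs' : ∀ z ∈ U, s' z = Real.exp (f z) * s z) (hy : y ∈ U) :
    coordHess G' s' y + s' y • coordSchouten G' y =
      Real.exp (f y) • (coordHess G s y + s y • coordSchouten G y +
        (differential s y ⬝ᵥ gradient G f y +
          s y / 2 * (differential f y ⬝ᵥ gradient G f y)) • G y) := by
  have hexp : ContDiffOn ℝ ∞ (fun z => Real.exp (f z)) U := Real.contDiff_exp.comp_contDiffOn hf
  have hdiff {g : Model d → ℝ} (hg : ContDiffOn ℝ ∞ g U) : DifferentiableAt ℝ g y :=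
    differentiableAt_of_contDiffOn hg hG.isOpen hy
  rw [coordHess_congr hG.isOpen hs' hy, hG.coordHess_conformal hf h hy,
    coordHess_mul hG.isOpen hexp hs hy, coordHess_exp hG.isOpen hf hy,
    hG.coordSchouten_conformal hd hf h hy, hs' y hy, differential_mul (hdiff hexp) (hdiff hs),
    differential_exp (hdiff hf)]
  ext i j
  simp only [Matrix.add_apply, Matrix.sub_apply, Matrix.smul_apply, smul_eq_mul, vecMulVec_apply,
    Pi.add_apply, Pi.smul_apply, add_dotProduct, smul_dotProduct]
  ring

lemma coordHess_eq_zero {u : Model d → ℝ} (hU : IsOpen U) (h : ∀ z ∈ U, differential u z = 0)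
    (hy : y ∈ U) : coordHess G u y = 0 := by
  have hpd : ∀ j, ∀ z ∈ U, pd j u z = 0 := fun j z hz => congrFun (h z hz) j
  ext i j
  simp only [coordHess, Matrix.of_apply, pd_congr_on hU (hpd j) hy, pd_const, hpd _ y hy,
    mul_zero, Finset.sum_const_zero, sub_zero, Matrix.zero_apply]

lemma exp_two_mul_neg_log {x : ℝ} (hx : x ≠ 0) : Real.exp (2 * -Real.log x) = (x ^ 2)⁻¹ := by
  rw [mul_neg, Real.exp_neg, ← Nat.cast_ofNat (R := ℝ), ← Real.log_pow,
    Real.exp_log (sq_pos_of_ne_zero hx)]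

lemma differential_neg_log {u : Model d → ℝ} (hu : DifferentiableAt ℝ u y) (hne : u y ≠ 0) :
    differential (fun z => -Real.log (u z)) y = -(u y)⁻¹ • differential u y := by
  ext i
  simp only [differential, pd_fun_neg, pd_comp i (Real.hasDerivAt_log hne) hu, Pi.smul_apply,
    smul_eq_mul, neg_mul]

lemma differential_exp_neg_log_mul {u : Model d → ℝ} (hu : DifferentiableAt ℝ u y)
    (hne : u y ≠ 0) : differential (fun z => Real.exp (-Real.log (u z)) * u z) y = 0 := by
  have hlog : DifferentiableAt ℝ (fun z => -Real.log (u z)) y := (hu.log hne).neg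
  rw [differential_mul hlog.exp hu, differential_exp hlog, differential_neg_log hu hne, smul_smul,
    smul_smul, ← add_smul]
  field_simp
  simp

-- In the metric `u⁻² G` the density represented by `u` is constant, so its Hessian vanishes.
lemma IsMetricOn.schouten_of_almostEinstein (hG : IsMetricOn G U) (hd : 3 ≤ d) {u : Model d → ℝ}
    (hu : ContDiffOn ℝ ∞ u U) (hne : ∀ z ∈ U, u z ≠ 0)
    (h : ∀ z ∈ U, G' z = (u z ^ 2)⁻¹ • G z) (hy : y ∈ U) {ρ : ℝ}
    (hρ : coordHess G u y + u y • coordSchouten G y + ρ • G y = 0) :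
    coordSchouten G' y =
      (-(differential u y ⬝ᵥ gradient G u y + 2 * (u y * ρ)) / 2) • G' y := by
  set f : Model d → ℝ := fun z => -Real.log (u z)
  have hu_diff : ∀ z ∈ U, DifferentiableAt ℝ u z := fun z hz =>
    differentiableAt_of_contDiffOn hu hG.isOpen hz
  have hG' : ∀ z ∈ U, G' z = Real.exp (2 * f z) • G z := fun z hz => by
    rw [h z hz, exp_two_mul_neg_log (hne z hz)]
  have hhess : coordHess G' (fun z => Real.exp (f z) * u z) y = 0 :=
    coordHess_eq_zero hG.isOpen
      (fun z hz => differential_exp_neg_log_mul (hu_diff z hz) (hne z hz)) hy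
  have hdf : differential f y = -(u y)⁻¹ • differential u y :=
    differential_neg_log (hu_diff y hy) (hne y hy)
  have hgrad : gradient G f y = -(u y)⁻¹ • gradient G u y := by
    rw [gradient, hdf, mulVec_smul, gradient]
  have hchange := hG.hess_add_schouten_conformal hd (hu.log hne).neg hG' hu (fun _ _ => rfl) hy
  rw [hhess, zero_add, eq_neg_of_add_eq_zero_left hρ, hdf, hgrad] at hchange
  ext i j
  have hij := congrFun (congrFun hchange i) j
  have hu_y := hne y hy
  have hexp := Real.exp_ne_zero (f y)
  simp only [Matrix.smul_apply, Matrix.add_apply, Matrix.neg_apply, smul_eq_mul, smul_dotProduct,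
    dotProduct_smul] at hij
  rw [mul_assoc, mul_right_inj' hexp] at hij
  rw [h y hy, Matrix.smul_apply, Matrix.smul_apply, smul_eq_mul, smul_eq_mul]
  field_simp at hij ⊢
  linarith

lemma IsMetricOn.ricci_of_almostEinstein (hG : IsMetricOn G U) (hd : 3 ≤ d) {u : Model d → ℝ}
    (hu : ContDiffOn ℝ ∞ u U) (hne : ∀ z ∈ U, u z ≠ 0)
    (h : ∀ z ∈ U, G' z = (u z ^ 2)⁻¹ • G z) (hy : y ∈ U) {ρ : ℝ}
    (hρ : coordHess G u y + u y • coordSchouten G y + ρ • G y = 0) :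
    coordRicci G' y = (-((d : ℝ) - 1) *
      (differential u y ⬝ᵥ gradient G u y + 2 * (u y * ρ))) • G' y := by
  have hG' : IsMetricOn G' U := hG.conformal (hu.log hne).neg
    fun z hz => by rw [h z hz, exp_two_mul_neg_log (hne z hz)]
  have hP := hG.schouten_of_almostEinstein hd hu hne h hy hρ
  have htrace := hG'.trace_coordSchouten hd hy
  rw [hP, Matrix.smul_mul, hG'.mul_inv hy, Matrix.trace_smul, Matrix.trace_one, Fintype.card_fin,
    smul_eq_mul] at htrace
  rw [coordRicci_eq hd, hP, ← htrace, smul_smul, ← add_smul]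
  congr 1
  ring

end Conformal

/-! ### Naturality under changes of coordinates -/

section Pullback

open Matrix

variable {d e : ℕ} {U : Set (Model d)} {U' : Set (Model e)} {y : Model d} {m n : Type*}
  {φ : Model d → Model e} {A : Fin e → Model e → Matrix m m ℝ}
  {B : Fin e → Model e → Matrix n n ℝ}

/-- The Jacobian matrix `∂ᵢ φᵃ` of a map, with rows indexed by the target coordinates. -/
def jacobian (φ : Model d → Model e) (z : Model d) : Matrix (Fin e) (Fin d) ℝ :=
  Matrix.of fun a i => pd i (fun w => φ w a) z

/-- The pullback along `φ` of a connection. -/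
def pullbackConn (φ : Model d → Model e) (A : Fin e → Model e → Matrix m m ℝ) (i : Fin d)
    (z : Model d) : Matrix m m ℝ :=
  ∑ a, jacobian φ z a i • A a (φ z)

lemma contDiffOn_coord (hφ : ContDiffOn ℝ ∞ φ U) (a : Fin e) :
    ContDiffOn ℝ ∞ (fun z => φ z a) U :=
  (EuclideanSpace.proj (𝕜 := ℝ) a : Model e →L[ℝ] ℝ).contDiff.comp_contDiffOn hφ

lemma smoothMatrixOn_jacobian (hφ : ContDiffOn ℝ ∞ φ U) (hU : IsOpen U) :
    SmoothMatrixOn (jacobian φ) U :=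
  fun a i => contDiffOn_pd (contDiffOn_coord hφ a) hU i

lemma pdMatrix_jacobian_symm (hφ : ContDiffOn ℝ ∞ φ U) (hU : IsOpen U) (hy : y ∈ U)
    (i : Fin d) (a : Fin e) (j : Fin d) :
    pdMatrix i (jacobian φ) y a j = pdMatrix j (jacobian φ) y a i :=
  pd_pd_comm ((contDiffOn_coord hφ a).contDiffAt (hU.mem_nhds hy)) i j

lemma SmoothMatrixOn.comp {T : Model e → Matrix n m ℝ} (hT : SmoothMatrixOn T U')
    (hφ : ContDiffOn ℝ ∞ φ U) (hmaps : Set.MapsTo φ U U') :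
    SmoothMatrixOn (fun z => T (φ z)) U :=
  fun k l => (hT k l).comp hφ hmaps

lemma smoothMatrixOn_pullbackConn (hA : ∀ a, SmoothMatrixOn (A a) U')
    (hφ : ContDiffOn ℝ ∞ φ U) (hU : IsOpen U) (hmaps : Set.MapsTo φ U U') (i : Fin d) :
    SmoothMatrixOn (pullbackConn φ A i) U := fun k l => by
  simp only [pullbackConn, Matrix.sum_apply, Matrix.smul_apply, smul_eq_mul]
  exact ContDiffOn.sum fun a _ =>
    (smoothMatrixOn_jacobian hφ hU a i).mul ((hA a).comp hφ hmaps k l)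

lemma pullbackConn_dualConn : pullbackConn φ (dualConn A) = dualConn (pullbackConn φ A) := by
  ext i z : 2
  simp [pullbackConn, dualConn, Matrix.transpose_sum]

lemma differential_comp {f : Model e → ℝ} (hφ : DifferentiableAt ℝ φ y)
    (hf : DifferentiableAt ℝ f (φ y)) :
    differential (fun z => f (φ z)) y = (jacobian φ y)ᵀ *ᵥ differential f (φ y) :=
  funext fun i => pd_comp_map hφ hf i

lemma pdMatrix_comp {T : Model e → Matrix n m ℝ} (hφ : DifferentiableAt ℝ φ y)
    (hT : ∀ k l, DifferentiableAt ℝ (fun z => T z k l) (φ y)) (i : Fin d) :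
    pdMatrix i (fun z => T (φ z)) y = ∑ a, jacobian φ y a i • pdMatrix a T (φ y) := by
  ext k l
  simp only [Matrix.sum_apply, Matrix.smul_apply, smul_eq_mul]
  exact pd_comp_map hφ (hT k l) i

lemma pdMatrix_pullbackConn (hφ : ContDiffOn ℝ ∞ φ U) (hU : IsOpen U) (hU' : IsOpen U')
    (hmaps : Set.MapsTo φ U U') (hA : ∀ a, SmoothMatrixOn (A a) U') (hy : y ∈ U) (i j : Fin d) :
    pdMatrix i (pullbackConn φ A j) y = ∑ b, pdMatrix i (jacobian φ) y b j • A b (φ y) +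
      ∑ a, ∑ b, (jacobian φ y a i * jacobian φ y b j) • pdMatrix a (A b) (φ y) := by
  have hφy : DifferentiableAt ℝ φ y := (hφ.contDiffAt (hU.mem_nhds hy)).differentiableAt (by simp)
  have hA' : ∀ b k l, DifferentiableAt ℝ (fun z => A b z k l) (φ y) := fun b =>
    (hA b).differentiableAt hU' (hmaps hy)
  have hJ : ∀ b, DifferentiableAt ℝ (fun z => jacobian φ z b j) y := fun b =>
    (smoothMatrixOn_jacobian hφ hU).differentiableAt hU hy b j
  have hcomp : ∀ b k l, DifferentiableAt ℝ (fun z => A b (φ z) k l) y := fun b =>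
    ((hA b).comp hφ hmaps).differentiableAt hU hy
  ext k l
  simp only [pullbackConn, pdMatrix_apply, Matrix.sum_apply, Matrix.smul_apply, smul_eq_mul,
    Matrix.add_apply]
  rw [pd_fun_sum fun b _ => (hJ b).fun_mul (hcomp b k l), Finset.sum_comm,
    ← Finset.sum_add_distrib]
  refine Finset.sum_congr rfl fun b _ => ?_
  rw [pd_fun_mul (hJ b) (hcomp b k l), pd_comp_map hφy (hA' b k l), Finset.mul_sum, add_comm,
    mul_comm]
  congr 1
  exact Finset.sum_congr rfl fun a _ => by rw [jacobian, Matrix.of_apply, Matrix.of_apply]; ring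

variable [Fintype m]

lemma covHom_comp [Fintype n] {T : Model e → Matrix n m ℝ} (hφ : DifferentiableAt ℝ φ y)
    (hT : ∀ k l, DifferentiableAt ℝ (fun z => T z k l) (φ y)) (i : Fin d) :
    covHom (pullbackConn φ A) (pullbackConn φ B) i (fun z => T (φ z)) y =
      ∑ a, jacobian φ y a i • covHom A B a T (φ y) := by
  simp only [covHom, pdMatrix_comp hφ hT, pullbackConn, Matrix.sum_mul, Matrix.mul_sum,
    Matrix.smul_mul, Matrix.mul_smul, smul_add, smul_sub, Finset.sum_add_distrib,
    Finset.sum_sub_distrib]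

lemma covVec_comp {v : Model e → m → ℝ} (hφ : DifferentiableAt ℝ φ y)
    (hv : ∀ k, DifferentiableAt ℝ (fun z => v z k) (φ y)) (i : Fin d) :
    covVec (pullbackConn φ A) i (fun z => v (φ z)) y =
      ∑ a, jacobian φ y a i • covVec A a v (φ y) := by
  ext k
  simp only [covVec, pd_comp_map hφ (hv k), pullbackConn, sum_mulVec, smul_mulVec,
    Finset.sum_apply, Pi.smul_apply, smul_eq_mul, mul_add, Finset.sum_add_distrib]
  rfl

lemma connCurvature_pullbackConn (hφ : ContDiffOn ℝ ∞ φ U) (hU : IsOpen U) (hU' : IsOpen U')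
    (hmaps : Set.MapsTo φ U U') (hA : ∀ a, SmoothMatrixOn (A a) U') (hy : y ∈ U) (i j : Fin d) :
    connCurvature (pullbackConn φ A) i j y =
      ∑ a, ∑ b, (jacobian φ y a i * jacobian φ y b j) • connCurvature A a b (φ y) := by
  have hswap : ∀ F : Fin e → Fin e → Matrix m m ℝ,
      ∑ a, ∑ b, (jacobian φ y a j * jacobian φ y b i) • F a b =
        ∑ a, ∑ b, (jacobian φ y a i * jacobian φ y b j) • F b a := fun F => by
    rw [Finset.sum_comm]
    simp only [mul_comm]
  have hmul : ∀ k l, pullbackConn φ A k y * pullbackConn φ A l y =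
      ∑ a, ∑ b, (jacobian φ y a k * jacobian φ y b l) • (A a (φ y) * A b (φ y)) := fun k l => by
    simp only [pullbackConn, Matrix.sum_mul, Matrix.mul_sum, Matrix.smul_mul, Matrix.mul_smul,
      Finset.smul_sum, smul_smul]
    rw [Finset.sum_comm]
    simp only [mul_comm]
  simp only [connCurvature, pdMatrix_pullbackConn hφ hU hU' hmaps hA hy, hmul, hswap,
    pdMatrix_jacobian_symm hφ hU hy j _ i, smul_add, smul_sub, Finset.sum_add_distrib,
    Finset.sum_sub_distrib]
  abel

lemma covHom_transpose [Fintype n] {A : Fin d → Model d → Matrix m m ℝ}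
    {B : Fin d → Model d → Matrix n n ℝ}
    {T : Model d → Matrix n m ℝ} (i : Fin d) :
    covHom (dualConn B) (dualConn A) i (fun z => (T z)ᵀ) y = (covHom A B i T y)ᵀ := by
  simp only [covHom, dualConn, pdMatrix_transpose, transpose_add, transpose_sub, transpose_mul,
    Matrix.neg_mul, Matrix.mul_neg]
  abel

end Pullback

section ChartChange

open Matrix

variable {d : ℕ} {U U' : Set (Model d)} {y : Model d} {G G' : Model d → Matrix (Fin d) (Fin d) ℝ}
  {φ : Model d → Model d}

/-- The map `φ` is a local isometry from the metric `G` on `U` to the metric `G'` on `U'`. -/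
structure IsPullback (G G' : Model d → Matrix (Fin d) (Fin d) ℝ) (φ : Model d → Model d)
    (U U' : Set (Model d)) : Prop where
  source : IsMetricOn G U
  target : IsMetricOn G' U'
  smooth : ContDiffOn ℝ ∞ φ U
  maps : Set.MapsTo φ U U'
  eq : ∀ z ∈ U, G z = (jacobian φ z)ᵀ * G' (φ z) * jacobian φ z

namespace IsPullback

lemma differentiableAt (h : IsPullback G G' φ U U') (hy : y ∈ U) : DifferentiableAt ℝ φ y :=
  (h.smooth.contDiffAt (h.source.isOpen.mem_nhds hy)).differentiableAt (by simp)

lemma jacobian_smooth (h : IsPullback G G' φ U U') : SmoothMatrixOn (jacobian φ) U :=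
  smoothMatrixOn_jacobian h.smooth h.source.isOpen

lemma isUnit_det_jacobian (h : IsPullback G G' φ U U') (hy : y ∈ U) :
    IsUnit (jacobian φ y).det := by
  have hdet := h.source.det y hy
  rw [h.eq y hy, det_mul] at hdet
  exact isUnit_of_mul_isUnit_right hdet

lemma covHom_comp_metric (h : IsPullback G G' φ U U') (hy : y ∈ U) (i : Fin d) :
    covHom (pullbackConn φ (leviCivita G')) (dualConn (pullbackConn φ (leviCivita G'))) i
      (fun z => G' (φ z)) y = 0 := by
  rw [← pullbackConn_dualConn, covHom_comp (h.differentiableAt hy)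
    (h.target.smooth.differentiableAt h.target.isOpen (h.maps hy))]
  simp [h.target.covHom_metric (h.maps hy)]

lemma pullbackConn_mul_jacobian_symm (h : IsPullback G G' φ U U') (hy : y ∈ U) (i j a : Fin d) :
    (pullbackConn φ (leviCivita G') i y * jacobian φ y) a j =
      (pullbackConn φ (leviCivita G') j y * jacobian φ y) a i := by
  simp only [pullbackConn, Matrix.mul_apply, Matrix.sum_apply, Matrix.smul_apply, smul_eq_mul,
    leviCivita_apply, Finset.sum_mul]
  rw [Finset.sum_comm]
  refine Finset.sum_congr rfl fun b _ => Finset.sum_congr rfl fun c _ => ?_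
  rw [h.target.christoffel_symm (h.maps hy)]
  ring

-- Transporting the pulled back Levi-Civita connection by `jacobian φ` gives a torsion-free
-- connection for which `G` is parallel.
lemma covHom_jacobian (h : IsPullback G G' φ U U') (hy : y ∈ U) (i : Fin d) :
    covHom (leviCivita G) (pullbackConn φ (leviCivita G')) i (jacobian φ) y = 0 := by
  have hU := h.source.isOpen
  have hJ := h.isUnit_det_jacobian hy
  set B := pullbackConn φ (leviCivita G')
  let A : Fin d → Model d → Matrix (Fin d) (Fin d) ℝ := fun i z =>
    (jacobian φ z)⁻¹ * (pdMatrix i (jacobian φ) z + B i z * jacobian φ z)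
  have hparallel : ∀ i, covHom A B i (jacobian φ) y = 0 := fun i => by
    rw [covHom, mul_nonsing_inv_cancel_left _ _ hJ]
    abel
  have hmetric : ∀ i, covHom A (dualConn A) i G y = 0 := fun i => by
    have hG' := h.target.smooth.comp h.smooth h.maps
    have hJT := h.jacobian_smooth.transpose
    rw [covHom_congr hU h.eq hy, covHom_mul (B := B) (hJT.mul hG') h.jacobian_smooth hU hy,
      covHom_mul (B := dualConn B) hJT hG' hU hy, covHom_transpose, hparallel,
      h.covHom_comp_metric hy, transpose_zero, Matrix.zero_mul, Matrix.mul_zero, Matrix.mul_zero,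
      add_zero, add_zero, Matrix.zero_mul]
  have hsymm : ∀ i j k, A i y k j = A j y k i := fun i j k => by
    simp only [A, Matrix.mul_apply (M := (jacobian φ y)⁻¹), Matrix.add_apply,
      pdMatrix_jacobian_symm h.smooth hU hy i _ j, B, h.pullbackConn_mul_jacobian_symm hy i j]
  rw [← hparallel i, covHom, covHom, h.source.leviCivita_unique hy hsymm hmetric]

lemma connCurvature_leviCivita (h : IsPullback G G' φ U U') (hy : y ∈ U) (i j : Fin d) :
    connCurvature (leviCivita G) i j y = (jacobian φ y)⁻¹ *
      ∑ a, jacobian φ y a i •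
        ((∑ b, jacobian φ y b j • connCurvature (leviCivita G') a b (φ y)) * jacobian φ y) := by
  have hmul := connCurvature_mul_of_parallel h.source.leviCivita_smooth
    (smoothMatrixOn_pullbackConn h.target.leviCivita_smooth h.smooth h.source.isOpen h.maps)
    h.jacobian_smooth h.source.isOpen hy (fun z hz => h.covHom_jacobian hz) i j
  rw [← nonsing_inv_mul_cancel_left _ (connCurvature (leviCivita G) i j y)
    (h.isUnit_det_jacobian hy), ← hmul, connCurvature_pullbackConn h.smooth h.source.isOpen
    h.target.isOpen h.maps h.target.leviCivita_smooth hy]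
  simp only [Matrix.sum_mul, Matrix.smul_mul, Finset.smul_sum, smul_smul]

end IsPullback

lemma sum_mul_sum_smul_apply {J K : Matrix (Fin d) (Fin d) ℝ} (hJK : J * K = 1)
    (M : Fin d → Matrix (Fin d) (Fin d) ℝ) (l : Fin d) :
    ∑ k, (K * ∑ a, J a k • M a) k l = ∑ a, M a a l := by
  calc ∑ k, (K * ∑ a, J a k • M a) k l = ∑ a, ∑ c, (J * K) a c * M a c l := by
        simp only [Matrix.mul_apply, Matrix.sum_apply, Matrix.smul_apply, smul_eq_mul,
          Finset.mul_sum, Finset.sum_mul]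
        rw [Finset.sum_comm]
        conv_lhs => enter [2, c]; rw [Finset.sum_comm]
        rw [Finset.sum_comm]
        exact Finset.sum_congr rfl fun a _ => Finset.sum_congr rfl fun c _ =>
          Finset.sum_congr rfl fun k _ => by ring
    _ = ∑ a, M a a l := by simp [hJK, Matrix.one_apply]

namespace IsPullback

lemma coordRicci_eq (h : IsPullback G G' φ U U') (hy : y ∈ U) :
    coordRicci G y = (jacobian φ y)ᵀ * coordRicci G' (φ y) * jacobian φ y := by
  ext j l
  calc coordRicci G y j l
      = ∑ a, ((∑ b, jacobian φ y b j • connCurvature (leviCivita G') a b (φ y)) *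
          jacobian φ y) a l := by
        rw [coordRicci_apply]
        simp only [h.connCurvature_leviCivita hy]
        exact sum_mul_sum_smul_apply (mul_nonsing_inv _ (h.isUnit_det_jacobian hy)) _ l
    _ = ∑ b, jacobian φ y b j * (coordRicci G' (φ y) * jacobian φ y) b l := by
        simp only [Matrix.sum_mul, Matrix.sum_apply, Matrix.smul_mul, Matrix.smul_apply,
          smul_eq_mul]
        rw [Finset.sum_comm]
        simp only [Matrix.mul_apply, coordRicci_apply, ← Finset.mul_sum, Finset.sum_mul]
        exact Finset.sum_congr rfl fun b _ => by rw [Finset.sum_comm]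
    _ = ((jacobian φ y)ᵀ * coordRicci G' (φ y) * jacobian φ y) j l := by
        rw [Matrix.mul_assoc]
        rfl

lemma coordHess_eq (h : IsPullback G G' φ U U') {u : Model d → ℝ} (hu : ContDiffOn ℝ ∞ u U')
    (hy : y ∈ U) :
    coordHess G (fun z => u (φ z)) y =
      (jacobian φ y)ᵀ * coordHess G' u (φ y) * jacobian φ y := by
  have hdu := contDiffOn_differential hu h.target.isOpen
  have hdiff : ∀ z ∈ U, differential (fun z => u (φ z)) z =
      (jacobian φ z)ᵀ *ᵥ differential u (φ z) := fun z hz =>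
    differential_comp (h.differentiableAt hz)
      (differentiableAt_of_contDiffOn hu h.target.isOpen (h.maps hz))
  have hparallel : ∀ i, covHom (pullbackConn φ (dualConn (leviCivita G')))
      (dualConn (leviCivita G)) i (fun z => (jacobian φ z)ᵀ) y = 0 := fun i => by
    rw [pullbackConn_dualConn, covHom_transpose, h.covHom_jacobian hy, transpose_zero]
  have hducomp : ∀ k, ContDiffOn ℝ ∞ (fun z => differential u (φ z) k) U := fun k =>
    (hdu k).comp h.smooth h.maps
  have hrow : ∀ i, coordHess G (fun z => u (φ z)) y i =
      (jacobian φ y)ᵀ *ᵥ ∑ a, jacobian φ y a i • coordHess G' u (φ y) a := fun i => by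
    rw [← covVec_differential, covVec_congr h.source.isOpen hdiff hy,
      covVec_mulVec (A := pullbackConn φ (dualConn (leviCivita G'))) h.jacobian_smooth.transpose
        hducomp h.source.isOpen hy, hparallel, zero_mulVec, zero_add,
      covVec_comp (h.differentiableAt hy)
        fun k => differentiableAt_of_contDiffOn (hdu k) h.target.isOpen (h.maps hy)]
    simp only [covVec_differential]
  ext i j
  rw [hrow]
  simp only [mulVec, dotProduct, Finset.sum_apply, Pi.smul_apply, smul_eq_mul, Matrix.mul_apply,
    transpose_apply, mul_comm _ (jacobian φ y _ j)]

lemma trace_mul_inv (h : IsPullback G G' φ U U') (hy : y ∈ U) (T : Matrix (Fin d) (Fin d) ℝ) :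
    ((jacobian φ y)ᵀ * T * jacobian φ y * (G y)⁻¹).trace = (T * (G' (φ y))⁻¹).trace := by
  have hJ := h.isUnit_det_jacobian hy
  have hJT : IsUnit (jacobian φ y)ᵀ.det := by rwa [det_transpose]
  rw [h.eq y hy, Matrix.mul_inv_rev, Matrix.mul_inv_rev, Matrix.mul_assoc _ (jacobian φ y),
    mul_nonsing_inv_cancel_left _ _ hJ, Matrix.mul_assoc, trace_mul_comm, Matrix.mul_assoc T,
    Matrix.mul_assoc, nonsing_inv_mul _ hJT, Matrix.mul_one]

lemma eq_zero_of_pullback (h : IsPullback G G' φ U U') (hy : y ∈ U)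
    {T : Matrix (Fin d) (Fin d) ℝ} (hT : (jacobian φ y)ᵀ * T * jacobian φ y = 0) : T = 0 := by
  have hJ := h.isUnit_det_jacobian hy
  have hJT : IsUnit (jacobian φ y)ᵀ.det := by rwa [det_transpose]
  rw [← nonsing_inv_mul_cancel_left _ T hJT, ← mul_nonsing_inv_cancel_right _ (_ * T) hJ, hT]
  simp

lemma coordSchoutenTrace_eq (h : IsPullback G G' φ U U') (hy : y ∈ U) :
    coordSchoutenTrace G y = coordSchoutenTrace G' (φ y) := by
  rw [coordSchoutenTrace, mixedRicci, h.coordRicci_eq hy, h.trace_mul_inv hy]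
  rfl

lemma coordSchouten_eq (h : IsPullback G G' φ U U') (hy : y ∈ U) :
    coordSchouten G y = (jacobian φ y)ᵀ * coordSchouten G' (φ y) * jacobian φ y := by
  rw [coordSchouten, coordSchouten, h.coordRicci_eq hy, h.coordSchoutenTrace_eq hy, h.eq y hy]
  simp only [Matrix.mul_smul, Matrix.smul_mul, Matrix.mul_sub, Matrix.sub_mul]

end IsPullback

end ChartChange

/-! ### Tensors in charts -/

section Charts

variable {d : ℕ} {M : Type*} [TopologicalSpace M] [ChartedSpace (Model d) M]

lemma origin_mem_target (x : M) : origin d x ∈ (extChartAt (𝓡 d) x).target :=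
  mem_extChartAt_target x

/-- The derivative of the inverse of the chart at `x`. The preferred charts trivialize the tangent
spaces, so that the target does not depend on `y`. -/
def symmDeriv (x : M) (y : Model d) : Model d →L[ℝ] Model d :=
  mfderiv 𝓘(ℝ, Model d) (𝓡 d) (extChartAt (𝓡 d) x).symm y

/-- The bilinear form at `p` in the trivialization of the tangent space by the preferred chart. -/
def bilinAt (b : BilinField d M) (p : M) : Model d →L[ℝ] Model d →L[ℝ] ℝ := b p

lemma chartMetric_apply (b : BilinField d M) (x : M) (y : Model d) (i j : Fin d) :
    chartMetric b x y i j = bilinAt b ((extChartAt (𝓡 d) x).symm y)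
      (symmDeriv x y (stdVec i)) (symmDeriv x y (stdVec j)) := rfl

lemma bilinAt_symmDeriv (b : BilinField d M) (x : M) (y v w : Model d) :
    bilinAt b ((extChartAt (𝓡 d) x).symm y) (symmDeriv x y v) (symmDeriv x y w) =
      v ⬝ᵥ (chartMetric b x y).mulVec w := by
  conv_lhs => rw [← sum_smul_stdVec v, ← sum_smul_stdVec w]
  simp only [map_sum, map_smul, sum_apply, smul_apply, smul_eq_mul, dotProduct, Matrix.mulVec,
    Finset.mul_sum, chartMetric_apply]
  rw [Finset.sum_comm]
  exact Finset.sum_congr rfl fun i _ => Finset.sum_congr rfl fun j _ => by ring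

/-- The domain of the change from the chart at `x` to the chart at `x'`. -/
def overlap (x x' : M) : Set (Model d) := ((extChartAt (𝓡 d) x).symm ≫ extChartAt (𝓡 d) x').source

/-- The change from the chart at `x` to the chart at `x'`. -/
def chartChange (x x' : M) (y : Model d) : Model d :=
  extChartAt (𝓡 d) x' ((extChartAt (𝓡 d) x).symm y)

variable {x x' : M} {y : Model d}

lemma mem_overlap : y ∈ overlap x x' ↔ y ∈ (extChartAt (𝓡 d) x).target ∧
    (extChartAt (𝓡 d) x).symm y ∈ (extChartAt (𝓡 d) x').source := by
  simp [overlap, PartialEquiv.trans_source]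

lemma isOpen_overlap (x x' : M) : IsOpen (overlap (d := d) x x') := by
  rw [overlap, PartialEquiv.trans_source]
  exact (continuousOn_extChartAt_symm x).isOpen_inter_preimage (isOpen_extChartAt_target x)
    (isOpen_extChartAt_source x')

lemma symm_chartChange (hy : y ∈ overlap x x') :
    (extChartAt (𝓡 d) x').symm (chartChange x x' y) = (extChartAt (𝓡 d) x).symm y :=
  (extChartAt (𝓡 d) x').left_inv (mem_overlap.1 hy).2

lemma chartChange_mem_target (hy : y ∈ overlap x x') :
    chartChange x x' y ∈ (extChartAt (𝓡 d) x').target :=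
  (extChartAt (𝓡 d) x').map_source (mem_overlap.1 hy).2

lemma chartFun_chartChange (f : M → ℝ) (hy : y ∈ overlap x x') :
    chartFun x f y = chartFun x' f (chartChange x x' y) := by
  simp only [chartFun, Function.comp, symm_chartChange hy]

lemma origin_mem_overlap (h : x ∈ (extChartAt (𝓡 d) x').source) : origin d x ∈ overlap x x' := by
  refine mem_overlap.2 ⟨origin_mem_target x, ?_⟩
  rwa [origin, extChartAt_to_inv x]

lemma chartChange_origin (x x' : M) :
    chartChange x x' (origin d x) = extChartAt (𝓡 d) x' x := by
  rw [chartChange, origin, extChartAt_to_inv x]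

lemma chartChange_origin_symm (hy : y ∈ (extChartAt (𝓡 d) x).target) :
    chartChange ((extChartAt (𝓡 d) x).symm y) x (origin d ((extChartAt (𝓡 d) x).symm y)) = y := by
  rw [chartChange_origin, (extChartAt (𝓡 d) x).right_inv hy]

variable [IsManifold (𝓡 d) ∞ M]

lemma contMDiffAt_extChartAt_symm (hy : y ∈ (extChartAt (𝓡 d) x).target) :
    ContMDiffAt 𝓘(ℝ, Model d) (𝓡 d) ∞ (extChartAt (𝓡 d) x).symm y :=
  (contMDiffOn_extChartAt_symm x y hy).contMDiffAt ((isOpen_extChartAt_target x).mem_nhds hy)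

lemma mdifferentiableAt_extChartAt_symm (hy : y ∈ (extChartAt (𝓡 d) x).target) :
    MDifferentiableAt 𝓘(ℝ, Model d) (𝓡 d) (extChartAt (𝓡 d) x).symm y :=
  (contMDiffAt_extChartAt_symm hy).mdifferentiableAt (by simp)

lemma symmDeriv_injective (hy : y ∈ (extChartAt (𝓡 d) x).target) :
    Function.Injective (symmDeriv x y) := by
  have hinv := isInvertible_mfderivWithin_extChartAt_symm (I := 𝓡 d) hy
  rw [modelWithCornersSelf_coe, Set.range_id, mfderivWithin_univ] at hinv
  exact hinv.injective

-- Both trivializations of the tangent space at `x` come from the same chart.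
lemma symmDeriv_origin (x : M) : symmDeriv x (origin d x) = ContinuousLinearMap.id ℝ (Model d) := by
  have hx : (extChartAt (𝓡 d) x).symm (origin d x) = x := extChartAt_to_inv x
  have hmfderiv : symmDeriv x (origin d x) = fderivWithin ℝ
      (writtenInExtChartAt 𝓘(ℝ, Model d) (𝓡 d) (origin d x) (extChartAt (𝓡 d) x).symm)
      (Set.range 𝓘(ℝ, Model d)) (extChartAt 𝓘(ℝ, Model d) (origin d x) (origin d x)) :=
    (mdifferentiableAt_extChartAt_symm (origin_mem_target x)).mfderiv
  have hright : (extChartAt (𝓡 d) x ∘ (extChartAt (𝓡 d) x).symm) =ᶠ[𝓝 (origin d x)] id :=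
    Filter.eventuallyEq_of_mem ((isOpen_extChartAt_target x).mem_nhds (origin_mem_target x))
      fun _ hz => (extChartAt (𝓡 d) x).right_inv hz
  rw [hmfderiv]
  simp only [writtenInExtChartAt, hx, extChartAt_model_space_eq_id, PartialEquiv.refl_symm,
    PartialEquiv.refl_coe, Function.comp_id, id_eq, modelWithCornersSelf_coe, Set.range_id,
    fderivWithin_univ]
  exact hright.fderiv_eq.trans fderiv_id

lemma metricAt_apply (b : BilinField d M) (x : M) (i j : Fin d) :
    metricAt b x i j = b x (frame x i) (frame x j) := by
  rw [metricAt, chartMetric_apply, symmDeriv_origin, origin, extChartAt_to_inv x]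
  rfl

lemma contMDiffAt_chartVec (x : M) (i : Fin d) (hy : y ∈ (extChartAt (𝓡 d) x).target) :
    ContMDiffAt 𝓘(ℝ, Model d) (𝓡 d).tangent ∞
      (fun z => (⟨(extChartAt (𝓡 d) x).symm z, chartVec x i z⟩ : TangentBundle (𝓡 d) M)) y := by
  have htarget := isOpen_extChartAt_target (I := 𝓡 d) x
  have htangent := (contMDiffOn_extChartAt_symm (I := 𝓡 d) (n := ∞) x).contMDiffOn_tangentMapWithin
    (m := ∞) (by simp) htarget.uniqueMDiffOn
  have hconst : ContMDiff 𝓘(ℝ, Model d) 𝓘(ℝ, Model d).tangent ∞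
      (fun z => (⟨z, (stdVec i : Model d)⟩ : TangentBundle 𝓘(ℝ, Model d) (Model d))) :=
    contMDiff_vectorSpace_iff_contDiff.2 contDiff_const
  have hcomp := htangent.comp (hconst.contMDiffOn (s := (extChartAt (𝓡 d) x).target))
    fun _ hz => hz
  refine (hcomp.contMDiffAt (htarget.mem_nhds hy)).congr_of_eventuallyEq ?_
  filter_upwards [htarget.mem_nhds hy] with z hz
  simp only [Function.comp, tangentMapWithin, chartVec]
  rw [mfderivWithin_of_isOpen htarget hz]

lemma smoothMatrixOn_chartMetric (g : Metric d M) (x : M) :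
    SmoothMatrixOn (chartMetric g.inner x) (extChartAt (𝓡 d) x).target := fun i j y hy => by
  have hinner : ContMDiffAt 𝓘(ℝ, Model d) ((𝓡 d).prod 𝓘(ℝ)) ∞
      (fun z => TotalSpace.mk' ℝ (E := Bundle.Trivial M ℝ) ((extChartAt (𝓡 d) x).symm z)
        (g.inner _ (chartVec x i z) (chartVec x j z))) y := by
    apply ContMDiffAt.clm_bundle_apply₂ (F₁ := Model d) (F₂ := Model d)
    · exact g.contMDiff.contMDiffAt.comp y (contMDiffAt_extChartAt_symm hy)
    · exact contMDiffAt_chartVec x i hy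
    · exact contMDiffAt_chartVec x j hy
  simp only [contMDiffAt_totalSpace] at hinner
  exact (contMDiffAt_iff_contDiffAt.1 hinner.2).contDiffWithinAt

lemma isUnit_det_chartMetric (g : Metric d M) (hy : y ∈ (extChartAt (𝓡 d) x).target) :
    IsUnit (chartMetric g.inner x y).det := by
  rw [isUnit_iff_ne_zero]
  intro hdet
  obtain ⟨v, hv, hker⟩ := Matrix.exists_mulVec_eq_zero_iff.2 hdet
  set V : Model d := WithLp.toLp 2 v
  have hV : symmDeriv x y V ≠ 0 := fun h => hv <| by
    have hzero : V = 0 := symmDeriv_injective hy (by rw [h, map_zero])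
    exact congrArg WithLp.ofLp hzero
  have hpos : 0 < bilinAt g.inner ((extChartAt (𝓡 d) x).symm y) (symmDeriv x y V)
      (symmDeriv x y V) := g.pos _ _ hV
  rw [bilinAt_symmDeriv, show (chartMetric g.inner x y).mulVec V = 0 from hker,
    dotProduct_zero] at hpos
  exact lt_irrefl _ hpos

lemma isMetricOn_chartMetric (g : Metric d M) (x : M) :
    IsMetricOn (chartMetric g.inner x) (extChartAt (𝓡 d) x).target where
  isOpen := isOpen_extChartAt_target x
  symm _ _ _ _ := g.symm _ _ _
  smooth := smoothMatrixOn_chartMetric g x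
  det _ hy := isUnit_det_chartMetric g hy

lemma contDiffOn_chartFun (x : M) {f : M → ℝ} (hf : ContMDiff (𝓡 d) 𝓘(ℝ, ℝ) ∞ f) :
    ContDiffOn ℝ ∞ (chartFun x f) (extChartAt (𝓡 d) x).target :=
  contMDiffOn_iff_contDiffOn.1
    (hf.comp_contMDiffOn (contMDiffOn_extChartAt_symm (I := 𝓡 d) (n := ∞) x))

lemma chartForm_diff {f : M → ℝ} (hf : ContMDiff (𝓡 d) 𝓘(ℝ, ℝ) ∞ f) (i : Fin d)
    (hy : y ∈ (extChartAt (𝓡 d) x).target) :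
    chartForm (diff d f) x i y = pd i (chartFun x f) y := by
  have hchain := mfderiv_comp y (hf.mdifferentiable (by simp) ((extChartAt (𝓡 d) x).symm y))
    (mdifferentiableAt_extChartAt_symm hy)
  rw [pd, chartFun, ← mfderiv_eq_fderiv]
  exact (congrArg (fun L : Model d →L[ℝ] ℝ => L (stdVec i)) hchain).symm

lemma contDiffOn_chartChange (x x' : M) :
    ContDiffOn ℝ ∞ (chartChange (d := d) x x') (overlap x x') :=
  contDiffOn_ext_coord_change (I := 𝓡 d) x' x

lemma differentiableAt_chartChange (hy : y ∈ overlap x x') :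
    DifferentiableAt ℝ (chartChange x x') y :=
  ((contDiffOn_chartChange x x').contDiffAt
    ((isOpen_overlap x x').mem_nhds hy)).differentiableAt (by simp)

lemma symmDeriv_chartChange (hy : y ∈ overlap x x') :
    symmDeriv x y =
      (symmDeriv x' (chartChange x x' y)).comp (fderiv ℝ (chartChange x x') y) := by
  have hsymm : (extChartAt (𝓡 d) x).symm =ᶠ[𝓝 y] (extChartAt (𝓡 d) x').symm ∘ chartChange x x' :=
    Filter.eventuallyEq_of_mem ((isOpen_overlap x x').mem_nhds hy)
      fun _ hz => (symm_chartChange hz).symm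
  exact (((mdifferentiableAt_extChartAt_symm (chartChange_mem_target hy)).hasMFDerivAt.comp y
    (differentiableAt_chartChange hy).hasFDerivAt.hasMFDerivAt).congr_of_eventuallyEq hsymm).mfderiv

lemma fderiv_stdVec_eq_jacobian_col {φ : Model d → Model d} (hφ : DifferentiableAt ℝ φ y)
    (i : Fin d) : (fderiv ℝ φ y (stdVec i)).ofLp = (jacobian φ y).col i :=
  funext fun a => (pd_apply hφ i a).symm

lemma chartMetric_chartChange (b : BilinField d M) (hy : y ∈ overlap x x') :
    chartMetric b x y = (jacobian (chartChange x x') y).transpose *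
      chartMetric b x' (chartChange x x' y) * jacobian (chartChange x x') y := by
  ext i j
  rw [chartMetric_apply, symmDeriv_chartChange hy, ← symm_chartChange hy,
    ContinuousLinearMap.comp_apply, ContinuousLinearMap.comp_apply, bilinAt_symmDeriv,
    fderiv_stdVec_eq_jacobian_col (differentiableAt_chartChange hy),
    fderiv_stdVec_eq_jacobian_col (differentiableAt_chartChange hy), Matrix.mul_assoc]
  rfl

lemma isPullback_chartChange (g : Metric d M) (x x' : M) :
    IsPullback (chartMetric g.inner x) (chartMetric g.inner x') (chartChange x x')
      (overlap x x') (extChartAt (𝓡 d) x').target where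
  source := (isMetricOn_chartMetric g x).mono (isOpen_overlap x x') fun _ hy => (mem_overlap.1 hy).1
  target := isMetricOn_chartMetric g x'
  smooth := contDiffOn_chartChange x x'
  maps _ hz := chartChange_mem_target hz
  eq _ hz := chartMetric_chartChange g.inner hz

end Charts

/-! ### The splitting operator in coordinates -/

section CoordSplitting

open Matrix

variable {d : ℕ} {U U' : Set (Model d)} {y : Model d} {G G' : Model d → Matrix (Fin d) (Fin d) ℝ}
  {φ : Model d → Model d} {f s s' u : Model d → ℝ}

/-- The function `ρ = (1/d)(Δu - Ju)`, the last component of the tractor of `u`. -/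
def coordRho (G : Model d → Matrix (Fin d) (Fin d) ℝ) (u : Model d → ℝ) (y : Model d) : ℝ :=
  (d : ℝ)⁻¹ * (-(coordHess G u y * (G y)⁻¹).trace - coordSchoutenTrace G y * u y)

/-- The trace-free part `∇∇u + uP + ρg` of `∇∇u + uP`. -/
def coordObstruction (G : Model d → Matrix (Fin d) (Fin d) ℝ) (u : Model d → ℝ) (y : Model d) :
    Matrix (Fin d) (Fin d) ℝ :=
  coordHess G u y + u y • coordSchouten G y + coordRho G u y • G y

lemma differential_congr {u v : Model d → ℝ} (hU : IsOpen U) (h : ∀ z ∈ U, u z = v z)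
    (hy : y ∈ U) : differential u y = differential v y :=
  funext fun i => pd_congr_on hU h hy i

namespace IsMetricOn

lemma coordRho_smooth (hG : IsMetricOn G U) (hu : ContDiffOn ℝ ∞ u U) :
    ContDiffOn ℝ ∞ (coordRho G u) U :=
  contDiffOn_const.mul (((hG.coordHess_smooth hu).mul hG.inv_smooth).trace.neg.sub
    (hG.coordSchoutenTrace_smooth.mul hu))

lemma coordRho_eq (hG : IsMetricOn G U) (hd : 3 ≤ d) (hy : y ∈ U) :
    coordRho G u y =
      -((d : ℝ)⁻¹ * ((coordHess G u y + u y • coordSchouten G y) * (G y)⁻¹).trace) := by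
  rw [add_mul, Matrix.smul_mul, Matrix.trace_add, Matrix.trace_smul, hG.trace_coordSchouten hd hy,
    coordRho, smul_eq_mul]
  ring

lemma coordRho_conformal (hG : IsMetricOn G U) (hd : 3 ≤ d) (hf : ContDiffOn ℝ ∞ f U)
    (h : ∀ z ∈ U, G' z = Real.exp (2 * f z) • G z) (hs : ContDiffOn ℝ ∞ s U)
    (hs' : ∀ z ∈ U, s' z = Real.exp (f z) * s z) (hy : y ∈ U) :
    coordRho G' s' y = (Real.exp (f y))⁻¹ * (coordRho G s y -
      (differential s y ⬝ᵥ gradient G f y +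
        s y / 2 * (differential f y ⬝ᵥ gradient G f y))) := by
  have hd3 : (3 : ℝ) ≤ d := by exact_mod_cast hd
  have hd0 : (d : ℝ) ≠ 0 := by linarith
  have hexp := Real.exp_ne_zero (f y)
  rw [(hG.conformal hf h).coordRho_eq hd hy, hG.hess_add_schouten_conformal hd hf h hs hs' hy,
    hG.coordRho_eq hd hy, hG.inv_conformal hy (h y hy), Matrix.smul_mul, Matrix.mul_smul, add_mul,
    Matrix.smul_mul _ (G y), hG.mul_inv hy]
  simp only [Matrix.trace_smul, Matrix.trace_add, Matrix.trace_one, Fintype.card_fin, smul_eq_mul,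
    two_mul, Real.exp_add]
  field_simp
  ring

lemma coordObstruction_conformal (hG : IsMetricOn G U) (hd : 3 ≤ d) (hf : ContDiffOn ℝ ∞ f U)
    (h : ∀ z ∈ U, G' z = Real.exp (2 * f z) • G z) (hs : ContDiffOn ℝ ∞ s U)
    (hs' : ∀ z ∈ U, s' z = Real.exp (f z) * s z) (hy : y ∈ U) :
    coordObstruction G' s' y = Real.exp (f y) • coordObstruction G s y := by
  have hexp := Real.exp_ne_zero (f y)
  rw [coordObstruction, hG.hess_add_schouten_conformal hd hf h hs hs' hy,
    hG.coordRho_conformal hd hf h hs hs' hy, h y hy, coordObstruction, two_mul, Real.exp_add]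
  ext i j
  simp only [Matrix.smul_apply, Matrix.add_apply, smul_eq_mul]
  field_simp
  ring

lemma coordNormSq_conformal (hG : IsMetricOn G U) (hd : 3 ≤ d) (hf : ContDiffOn ℝ ∞ f U)
    (h : ∀ z ∈ U, G' z = Real.exp (2 * f z) • G z) (hs : ContDiffOn ℝ ∞ s U)
    (hs' : ∀ z ∈ U, s' z = Real.exp (f z) * s z) (hy : y ∈ U) :
    coordNormSq G' s' (coordRho G' s') y = coordNormSq G s (coordRho G s) y := by
  have hf_diff := differentiableAt_of_contDiffOn hf hG.isOpen hy
  have hs_diff := differentiableAt_of_contDiffOn hs hG.isOpen hy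
  have hexp := Real.exp_ne_zero (f y)
  have hds : differential s' y =
      Real.exp (f y) • (differential s y + s y • differential f y) := by
    rw [differential_congr hG.isOpen hs' hy, differential_mul hf_diff.exp hs_diff,
      differential_exp hf_diff]
    module
  have hcross : differential f y ⬝ᵥ (G y)⁻¹ *ᵥ differential s y =
      differential s y ⬝ᵥ (G y)⁻¹ *ᵥ differential f y := by
    rw [dotProduct_mulVec, dotProduct_comm, ← mulVec_transpose, hG.inv_transpose hy]
  rw [coordNormSq, coordNormSq, hG.coordRho_conformal hd hf h hs hs' hy, hs' y hy, gradient,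
    gradient, gradient, hds, hG.inv_conformal hy (h y hy), two_mul (f y), Real.exp_add]
  simp only [smul_mulVec, mulVec_smul, mulVec_add, smul_dotProduct, dotProduct_smul,
    add_dotProduct, dotProduct_add, smul_eq_mul, hcross]
  field_simp
  ring

end IsMetricOn

namespace IsPullback

variable {v : Model d → ℝ}

lemma coordRho_eq (h : IsPullback G G' φ U U') (hu : ContDiffOn ℝ ∞ u U')
    (hv : ∀ z ∈ U, v z = u (φ z)) (hy : y ∈ U) : coordRho G v y = coordRho G' u (φ y) := by
  rw [coordRho, coordRho, coordHess_congr h.source.isOpen hv hy, h.coordHess_eq hu hy,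
    h.trace_mul_inv hy, h.coordSchoutenTrace_eq hy, hv y hy]

lemma coordObstruction_eq (h : IsPullback G G' φ U U') (hu : ContDiffOn ℝ ∞ u U')
    (hv : ∀ z ∈ U, v z = u (φ z)) (hy : y ∈ U) :
    coordObstruction G v y = (jacobian φ y)ᵀ * coordObstruction G' u (φ y) * jacobian φ y := by
  rw [coordObstruction, coordHess_congr h.source.isOpen hv hy, h.coordHess_eq hu hy,
    h.coordSchouten_eq hy, h.coordRho_eq hu hv hy, hv y hy, h.eq y hy, coordObstruction]
  simp only [mul_add, add_mul, Matrix.mul_smul, Matrix.smul_mul]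

lemma differential_eq (h : IsPullback G G' φ U U') (hu : ContDiffOn ℝ ∞ u U')
    (hv : ∀ z ∈ U, v z = u (φ z)) (hy : y ∈ U) :
    differential v y = (jacobian φ y)ᵀ *ᵥ differential u (φ y) := by
  rw [differential_congr h.source.isOpen hv hy, differential_comp (h.differentiableAt hy)
    (differentiableAt_of_contDiffOn hu h.target.isOpen (h.maps hy))]

lemma jacobian_mulVec_gradient (h : IsPullback G G' φ U U') (hu : ContDiffOn ℝ ∞ u U')
    (hv : ∀ z ∈ U, v z = u (φ z)) (hy : y ∈ U) :
    jacobian φ y *ᵥ gradient G v y = gradient G' u (φ y) := by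
  have hJ := h.isUnit_det_jacobian hy
  have hJT : IsUnit (jacobian φ y)ᵀ.det := by rwa [det_transpose]
  rw [gradient, h.differential_eq hu hv hy, h.eq y hy, Matrix.mul_inv_rev, Matrix.mul_inv_rev,
    mulVec_mulVec, mulVec_mulVec, Matrix.mul_assoc, Matrix.mul_assoc,
    mul_nonsing_inv_cancel_left _ _ hJ, nonsing_inv_mul_cancel_right _ _ hJT]
  rfl

lemma coordNormSq_eq (h : IsPullback G G' φ U U') (hu : ContDiffOn ℝ ∞ u U')
    (hv : ∀ z ∈ U, v z = u (φ z)) (hy : y ∈ U) :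
    coordNormSq G v (coordRho G v) y = coordNormSq G' u (coordRho G' u) (φ y) := by
  rw [coordNormSq, coordNormSq, h.coordRho_eq hu hv hy, h.differential_eq hu hv hy, hv y hy,
    mulVec_transpose, ← dotProduct_mulVec, h.jacobian_mulVec_gradient hu hv hy]

end IsPullback

end CoordSplitting

/-! ### The almost Einstein equation on a manifold -/

section Contract

variable {d : ℕ} {M : Type*} [TopologicalSpace M] [ChartedSpace (Model d) M]

lemma contract_apply (x : M) (T : Matrix (Fin d) (Fin d) ℝ) (v w : TangentSpace (𝓡 d) x) :
    contract x T v w = ∑ j, (∑ i, coords v i * T i j) * coords w j := by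
  have happly : ∀ (a : Fin d → ℝ) (w : Model d),
      (∑ j, a j • (EuclideanSpace.proj j : Model d →L[ℝ] ℝ)) w = ∑ j, a j * w j := fun a w => by
    simp
  exact happly _ w

lemma coords_frame (x : M) (i j : Fin d) :
    coords (frame (d := d) x i) j = (1 : Matrix (Fin d) (Fin d) ℝ) i j := by
  change (stdVec i : Model d) j = _
  simp [stdVec, Matrix.one_apply, eq_comm]

lemma sum_coords_frame (x : M) (v : TangentSpace (𝓡 d) x) : ∑ i, coords v i • frame x i = v :=
  sum_smul_stdVec (v : Model d)

lemma contract_apply_frame (x : M) (T : Matrix (Fin d) (Fin d) ℝ) (v : TangentSpace (𝓡 d) x)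
    (j : Fin d) : contract x T v (frame x j) = ∑ i, coords v i * T i j := by
  simp [contract_apply, coords_frame, Matrix.one_apply]

lemma contract_add (x : M) (T S : Matrix (Fin d) (Fin d) ℝ) (v : TangentSpace (𝓡 d) x) :
    contract x (T + S) v = contract x T v + contract x S v := by
  ext w
  simp [contract_apply, mul_add, add_mul, Finset.sum_add_distrib]

lemma contract_smul (x : M) (r : ℝ) (T : Matrix (Fin d) (Fin d) ℝ) (v : TangentSpace (𝓡 d) x) :
    contract x (r • T) v = r • contract x T v := by
  ext w
  simp [contract_apply, Finset.mul_sum, mul_left_comm, mul_assoc, Finset.sum_mul]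

lemma contract_eq_zero_iff (x : M) {T : Matrix (Fin d) (Fin d) ℝ} :
    (∀ v, contract x T v = 0) ↔ T = 0 := by
  refine ⟨fun h => ?_, fun h v => ?_⟩
  · ext i j
    have hij := DFunLike.congr_fun (h (frame x i)) (frame x j)
    simpa [contract_apply_frame, coords_frame, Matrix.one_apply] using hij
  · ext w
    simp [h, contract_apply]

end Contract

section Rho

variable {d : ℕ} {M : Type*} [TopologicalSpace M] [ChartedSpace (Model d) M]

/-- The function `ρ = (1/d)(Δf - Jf)`, the last component of the tractor of `f`. -/
def rhoFun (b : BilinField d M) (f : M → ℝ) (x : M) : ℝ :=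
  (d : ℝ)⁻¹ * (laplacian b f x - schoutenTrace b x * f x)

/-- The squared norm `|df|² + 2fρ` of the tractor of `f`. -/
def normSq (b : BilinField d M) (f : M → ℝ) (x : M) : ℝ :=
  coInner b x (diff d f x) (diff d f x) + 2 * (f x * rhoFun b f x)

lemma scalarS_eq_neg_normSq (b : BilinField d M) (f : M → ℝ) (x : M) :
    scalarS b f x = -normSq b f x := by
  rw [scalarS, normSq, rhoFun]
  ring

lemma coInner_eq_dotProduct (b : BilinField d M) (x : M) (μ ν : Cotangent d x) :
    coInner b x μ ν =
      (fun i => μ (frame x i)) ⬝ᵥ (metricAt b x)⁻¹.mulVec fun j => ν (frame x j) := by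
  simp only [coInner, dotProduct, Matrix.mulVec, Finset.mul_sum, mul_left_comm]

lemma diff_frame_eq_differential {f : M → ℝ} {x : M} (hf : ContMDiffAt (𝓡 d) 𝓘(ℝ, ℝ) ∞ f x) :
    (fun i => diff d f x (frame x i)) = differential (chartFun x f) (origin d x) :=
  funext fun i => diff_frame hf i

lemma contMDiff_of_chartFun {f : M → ℝ} (h : ∀ x, ContDiffAt ℝ ∞ (chartFun x f) (origin d x)) :
    ContMDiff (𝓡 d) 𝓘(ℝ, ℝ) ∞ f := fun x => by
  rw [contMDiffAt_iff_source, modelWithCornersSelf_coe, Set.range_id, contMDiffWithinAt_univ,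
    contMDiffAt_iff_contDiffAt]
  exact h x

lemma covForm_diff [IsManifold (𝓡 d) ∞ M] (b : BilinField d M) {f : M → ℝ}
    (hf : ContMDiff (𝓡 d) 𝓘(ℝ, ℝ) ∞ f) (x : M) : covForm b (diff d f) x = hess b f x := by
  ext i j
  simp only [covForm, coordCov, hess, coordHess, Matrix.of_apply]
  rw [pd_congr_on (isOpen_extChartAt_target x) (fun z hz => chartForm_diff hf j hz)
    (origin_mem_target x)]
  simp only [chartForm_diff hf _ (origin_mem_target x)]

end Rho

section MetricExpressions

variable {d : ℕ} {M : Type*} [TopologicalSpace M] [ChartedSpace (Model d) M]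
  [IsManifold (𝓡 d) ∞ M] {f : M → ℝ}

lemma inner_eq_contract (g : Metric d M) (x : M) (v : TangentSpace (𝓡 d) x) :
    g.inner x v = contract x (metricAt g.inner x) v := by
  ext w
  rw [contract_apply]
  conv_lhs => rw [← sum_coords_frame x v, ← sum_coords_frame x w]
  simp only [map_sum, map_smul, sum_apply, smul_apply, smul_eq_mul, metricAt_apply,
    mul_comm (coords w _)]

lemma trace_eq_matrix_trace (g : Metric d M) (x : M) (T : Matrix (Fin d) (Fin d) ℝ) :
    trace g.inner x T = (T * (metricAt g.inner x)⁻¹).trace := by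
  simp only [trace, Matrix.trace, Matrix.diag, Matrix.mul_apply, metricAt, mul_comm (T _ _),
    (isMetricOn_chartMetric g x).inv_symm (origin_mem_target x) _ _]

lemma schoutenTrace_eq (g : Metric d M) (x : M) :
    schoutenTrace g.inner x = coordSchoutenTrace (chartMetric g.inner x) (origin d x) := by
  rw [schoutenTrace, trace_eq_matrix_trace]
  rfl

lemma schouten_eq (g : Metric d M) (x : M) :
    schouten g.inner x = coordSchouten (chartMetric g.inner x) (origin d x) := by
  rw [schouten, schoutenTrace_eq]
  rfl

lemma rhoFun_eq (g : Metric d M) (f : M → ℝ) (x : M) :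
    rhoFun g.inner f x = coordRho (chartMetric g.inner x) (chartFun x f) (origin d x) := by
  rw [rhoFun, coordRho, chartFun_origin, laplacian, trace_eq_matrix_trace, schoutenTrace_eq]
  rfl

lemma obstructionA_eq_coordObstruction (hd : 3 ≤ d) (g : Metric d M) (f : M → ℝ) (x : M) :
    obstructionA g.inner f x =
      coordObstruction (chartMetric g.inner x) (chartFun x f) (origin d x) := by
  rw [obstructionA, trace_eq_matrix_trace, schouten_eq, sub_eq_add_neg, ← neg_smul,
    coordObstruction, (isMetricOn_chartMetric g x).coordRho_eq hd (origin_mem_target x),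
    chartFun_origin]
  rfl

lemma obstructionA_eq (hd : 3 ≤ d) (g : Metric d M) (f : M → ℝ) (x : M) :
    obstructionA g.inner f x =
      hess g.inner f x + f x • schouten g.inner x + rhoFun g.inner f x • metricAt g.inner x := by
  rw [obstructionA_eq_coordObstruction hd, coordObstruction, schouten_eq, rhoFun_eq,
    chartFun_origin]
  rfl

lemma normSq_eq (g : Metric d M) {x : M} (hf : ContMDiffAt (𝓡 d) 𝓘(ℝ, ℝ) ∞ f x) :
    normSq g.inner f x = coordNormSq (chartMetric g.inner x) (chartFun x f)
      (coordRho (chartMetric g.inner x) (chartFun x f)) (origin d x) := by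
  rw [normSq, coordNormSq, coInner_eq_dotProduct, diff_frame_eq_differential hf, rhoFun_eq,
    chartFun_origin]
  rfl

variable {y : Model d}

lemma chartFun_rhoFun (g : Metric d M) (hf : ContMDiff (𝓡 d) 𝓘(ℝ, ℝ) ∞ f) (x : M)
    (hy : y ∈ (extChartAt (𝓡 d) x).target) :
    chartFun x (rhoFun g.inner f) y = coordRho (chartMetric g.inner x) (chartFun x f) y := by
  have ho := origin_mem_overlap ((extChartAt (𝓡 d) x).map_target hy)
  conv_rhs => rw [← chartChange_origin_symm hy]
  exact (rhoFun_eq g f _).trans <| (isPullback_chartChange g _ x).coordRho_eq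
    (contDiffOn_chartFun x hf) (fun _ hz => chartFun_chartChange f hz) ho

lemma chartFun_normSq (g : Metric d M) (hf : ContMDiff (𝓡 d) 𝓘(ℝ, ℝ) ∞ f) (x : M)
    (hy : y ∈ (extChartAt (𝓡 d) x).target) :
    chartFun x (normSq g.inner f) y = coordNormSq (chartMetric g.inner x) (chartFun x f)
      (coordRho (chartMetric g.inner x) (chartFun x f)) y := by
  have ho := origin_mem_overlap ((extChartAt (𝓡 d) x).map_target hy)
  conv_rhs => rw [← chartChange_origin_symm hy]
  exact (normSq_eq g (hf _)).trans <| (isPullback_chartChange g _ x).coordNormSq_eq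
    (contDiffOn_chartFun x hf) (fun _ hz => chartFun_chartChange f hz) ho

lemma coordObstruction_chartFun_eq_zero (hd : 3 ≤ d) (g : Metric d M)
    (hf : ContMDiff (𝓡 d) 𝓘(ℝ, ℝ) ∞ f) (h : ∀ p, obstructionA g.inner f p = 0) (x : M)
    (hy : y ∈ (extChartAt (𝓡 d) x).target) :
    coordObstruction (chartMetric g.inner x) (chartFun x f) y = 0 := by
  have ho := origin_mem_overlap ((extChartAt (𝓡 d) x).map_target hy)
  have hφ := isPullback_chartChange g ((extChartAt (𝓡 d) x).symm y) x
  rw [← chartChange_origin_symm hy]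
  refine hφ.eq_zero_of_pullback ho ?_
  rw [← hφ.coordObstruction_eq (contDiffOn_chartFun x hf)
    (fun _ hz => chartFun_chartChange f hz) ho, ← obstructionA_eq_coordObstruction hd, h]

lemma contMDiff_rhoFun (g : Metric d M) (hf : ContMDiff (𝓡 d) 𝓘(ℝ, ℝ) ∞ f) :
    ContMDiff (𝓡 d) 𝓘(ℝ, ℝ) ∞ (rhoFun g.inner f) :=
  contMDiff_of_chartFun fun x => (((isMetricOn_chartMetric g x).coordRho_smooth
    (contDiffOn_chartFun x hf)).congr fun _ hy => chartFun_rhoFun g hf x hy).contDiffAt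
      ((isOpen_extChartAt_target x).mem_nhds (origin_mem_target x))

end MetricExpressions

section Einstein

variable {d : ℕ} {M : Type*} [TopologicalSpace M] [ChartedSpace (Model d) M]
  [IsManifold (𝓡 d) ∞ M] {f : M → ℝ}

lemma contMDiff_diff (hf : ContMDiff (𝓡 d) 𝓘(ℝ, ℝ) ∞ f) :
    ContMDiff (𝓡 d) ((𝓡 d).prod 𝓘(ℝ, Model d →L[ℝ] ℝ)) ∞
      (fun x => TotalSpace.mk' (Model d →L[ℝ] ℝ) (E := fun x : M => Cotangent d x) x
        (diff d f x)) := by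
  intro x
  rw [contMDiffAt_hom_bundle]
  refine ⟨contMDiffAt_id, ((hf x).mfderiv_const (m := ∞) (by simp)).congr_of_eventuallyEq
    (Filter.Eventually.of_forall fun z => ?_)⟩
  have htriv : (trivializationAt ℝ (fun _ : M => ℝ) x).continuousLinearMapAt ℝ z =
      ContinuousLinearMap.id ℝ ℝ := Bundle.Trivial.continuousLinearMapAt_trivialization ..
  simp only [inTangentCoordinates, ContinuousLinearMap.inCoordinates, id]
  rw [TangentBundle.continuousLinearMapAt_model_space]
  ext v
  exact DFunLike.congr_fun htriv _

lemma isLocallyConstant_normSq (hd : 3 ≤ d) (g : Metric d M)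
    (hf : ContMDiff (𝓡 d) 𝓘(ℝ, ℝ) ∞ f) (h : ∀ x, obstructionA g.inner f x = 0) :
    IsLocallyConstant (normSq g.inner f) := by
  rw [IsLocallyConstant.iff_eventually_eq]
  intro x
  have hG := isMetricOn_chartMetric g x
  have hu := contDiffOn_chartFun x hf
  obtain ⟨ε, hε, hball⟩ :=
    Metric.isOpen_iff.1 (isOpen_extChartAt_target (I := 𝓡 d) x) _ (origin_mem_target x)
  have hconst : ∀ y ∈ Metric.ball (origin d x) ε,
      chartFun x (normSq g.inner f) y = chartFun x (normSq g.inner f) (origin d x) := by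
    intro y hy
    rw [chartFun_normSq g hf x (hball hy), chartFun_normSq g hf x (origin_mem_target x)]
    exact Metric.isOpen_ball.is_const_of_fderiv_eq_zero (convex_ball _ _).isPreconnected
      (((hG.contDiffOn_coordNormSq hu (hG.coordRho_smooth hu)).differentiableOn
        (by simp)).mono hball)
      (fun z hz => fderiv_eq_zero_of_pd <| hG.pd_coordNormSq hd hu (hG.coordRho_smooth hu)
        (fun w hw => coordObstruction_chartFun_eq_zero hd g hf h x hw) (hball hz))
      hy (Metric.mem_ball_self hε)
  filter_upwards [(continuousAt_extChartAt (I := 𝓡 d) x).preimage_mem_nhds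
    (Metric.ball_mem_nhds _ hε), extChartAt_source_mem_nhds (I := 𝓡 d) x] with z hz hzs
  rw [← chartFun_origin (d := d) x (normSq g.inner f), ← hconst _ hz, chartFun, Function.comp,
    (extChartAt (𝓡 d) x).left_inv hzs]

lemma diff_rhoFun (hd : 3 ≤ d) (g : Metric d M) (hf : ContMDiff (𝓡 d) 𝓘(ℝ, ℝ) ∞ f)
    (h : ∀ x, obstructionA g.inner f x = 0) (x : M) (v : TangentSpace (𝓡 d) x) :
    diff d (rhoFun g.inner f) x v =
      coInner g.inner x (contract x (schouten g.inner x) v) (diff d f x) := by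
  have hG := isMetricOn_chartMetric g x
  have hu := contDiffOn_chartFun x hf
  have hdiff : (fun i => diff d (rhoFun g.inner f) x (frame x i)) =
      (schouten g.inner x).mulVec
        (gradient (chartMetric g.inner x) (chartFun x f) (origin d x)) := by
    rw [diff_frame_eq_differential (contMDiff_rhoFun g hf x),
      differential_congr (isOpen_extChartAt_target x) (fun z hz => chartFun_rhoFun g hf x hz)
        (origin_mem_target x),
      hG.differential_of_almostEinstein hd hu (hG.coordRho_smooth hu)
        (fun z hz => coordObstruction_chartFun_eq_zero hd g hf h x hz) (origin_mem_target x),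
      schouten_eq]
  calc diff d (rhoFun g.inner f) x v
      = coords v ⬝ᵥ fun i => diff d (rhoFun g.inner f) x (frame x i) := by
        conv_lhs => rw [← sum_coords_frame x v]
        simp only [map_sum, map_smul, smul_eq_mul, dotProduct]
    _ = _ := by
        rw [hdiff, Matrix.dotProduct_mulVec, coInner_eq_dotProduct,
          diff_frame_eq_differential (hf x)]
        simp only [contract_apply_frame]
        rfl

lemma trace_schouten (hd : 3 ≤ d) (g : Metric d M) (x : M) :
    trace g.inner x (schouten g.inner x) = schoutenTrace g.inner x := by
  rw [trace_eq_matrix_trace, schouten_eq, schoutenTrace_eq]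
  exact (isMetricOn_chartMetric g x).trace_coordSchouten hd (origin_mem_target x)

lemma eq_rhoFun (hd : 3 ≤ d) (g : Metric d M) (f : M → ℝ) (x : M) {r : ℝ}
    (h : hess g.inner f x + r • metricAt g.inner x + f x • schouten g.inner x = 0) :
    r = rhoFun g.inner f x := by
  have hd0 : (d : ℝ) ≠ 0 := by positivity
  have htrace := congrArg (trace g.inner x) h
  rw [trace_add, trace_add, trace_smul, trace_smul, trace_metricAt, trace_schouten hd,
    show trace g.inner x 0 = 0 by simp [trace]] at htrace
  rw [rhoFun, laplacian]
  field_simp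
  linarith

end Einstein

section Conformal

variable {d : ℕ} {M : Type*} [TopologicalSpace M] [ChartedSpace (Model d) M]
  [IsManifold (𝓡 d) ∞ M] {c : ConformalStructure d M}

lemma chartMetric_logFactor (g g' : c.metrics) (x : M) (y : Model d) :
    chartMetric g'.1.inner x y =
      Real.exp (2 * chartFun x (logFactor g g') y) • chartMetric g.1.inner x y := by
  ext i j
  simp only [chartMetric, Matrix.of_apply, inner_logFactor g g', Matrix.smul_apply, smul_eq_mul]
  rfl

lemma chartFun_inScale (g g' : c.metrics) (σ : SmoothDensity c 1) (x : M) (y : Model d) :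
    chartFun x (inScale g' σ.1) y =
      Real.exp (chartFun x (logFactor g g') y) * chartFun x (inScale g σ.1) y := by
  simp only [chartFun, Function.comp, inScale_eq (inner_logFactor g g') σ.2.1, one_mul]

lemma obstructionA_conformal (hd : 3 ≤ d) (g g' : c.metrics) (σ : SmoothDensity c 1) (x : M) :
    obstructionA g'.1.inner (inScale g' σ.1) x =
      Real.exp (logFactor g g' x) • obstructionA g.1.inner (inScale g σ.1) x := by
  rw [obstructionA_eq_coordObstruction hd, obstructionA_eq_coordObstruction hd,
    (isMetricOn_chartMetric g.1 x).coordObstruction_conformal hd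
      (contDiffOn_chartFun x (contMDiff_logFactor g g'))
      (fun z _ => chartMetric_logFactor g g' x z) (contDiffOn_chartFun x (σ.2.2 g))
      (fun z _ => chartFun_inScale g g' σ x z) (origin_mem_target x), chartFun_origin]

lemma normSq_conformal (hd : 3 ≤ d) (g g' : c.metrics) (σ : SmoothDensity c 1) (x : M) :
    normSq g'.1.inner (inScale g' σ.1) x = normSq g.1.inner (inScale g σ.1) x := by
  rw [normSq_eq _ (σ.2.2 g' x), normSq_eq _ (σ.2.2 g x)]
  exact (isMetricOn_chartMetric g.1 x).coordNormSq_conformal hd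
    (contDiffOn_chartFun x (contMDiff_logFactor g g')) (fun z _ => chartMetric_logFactor g g' x z)
    (contDiffOn_chartFun x (σ.2.2 g)) (fun z _ => chartFun_inScale g g' σ x z)
    (origin_mem_target x)

lemma IsAlmostEinstein.congr (hd : 3 ≤ d) {g : c.metrics} (g' : c.metrics)
    {σ : SmoothDensity c 1} (h : IsAlmostEinstein c g σ.1) : IsAlmostEinstein c g' σ.1 :=
  fun x => by rw [obstructionA_conformal hd g g', h x, smul_zero]

lemma ricciAt_scaleMetric (hd : 3 ≤ d) {g : c.metrics} {σ : SmoothDensity c 1}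
    (h : IsAlmostEinstein c g σ.1) {x : M} (hx : σ.1 x g ≠ 0) :
    ricciAt (scaleMetric c g σ.1) x = (-((d : ℝ) - 1) * normSq g.1.inner (inScale g σ.1) x) •
      metricAt (scaleMetric c g σ.1) x := by
  have hf := σ.2.2 g
  set f := inScale g σ.1
  have hu := contDiffOn_chartFun x hf
  set U := (extChartAt (𝓡 d) x).target ∩ chartFun x f ⁻¹' {0}ᶜ
  have hU : IsOpen U := hu.continuousOn.isOpen_inter_preimage
    (isOpen_extChartAt_target x) isOpen_compl_singleton
  have hG := (isMetricOn_chartMetric g.1 x).mono hU Set.inter_subset_left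
  have hmem : origin d x ∈ U :=
    ⟨origin_mem_target x, fun h0 => hx ((chartFun_origin x f).symm.trans h0)⟩
  have hscale : ∀ z ∈ U, chartMetric (scaleMetric c g σ.1) x z =
      (chartFun x f z ^ 2)⁻¹ • chartMetric g.1.inner x z := fun _ _ => rfl
  rw [ricciAt, normSq_eq _ (hf x)]
  exact hG.ricci_of_almostEinstein hd (hu.mono Set.inter_subset_left) (fun _ hz => hz.2) hscale hmem
    (coordObstruction_chartFun_eq_zero hd g.1 hf h x hmem.1)

end Conformal

/-! ### Parallel tractors -/

section ParallelTractors

variable {d : ℕ} [NeZero d] {M : Type*} [TopologicalSpace M] [ChartedSpace (Model d) M]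
  [IsManifold (𝓡 d) ∞ M] {c : ConformalStructure d M} {I : ∀ x, TractorFibre c x}

lemma pairX_apply (I : ∀ x, TractorFibre c x) (x : M) (g : c.metrics) :
    pairX c I x g = compσ c g I x := by
  have hone : ofScale c (-1) g (fun _ => 1) x g = 1 :=
    congrFun (inScale_ofScale (-1) g fun _ : M => (1 : ℝ)) x
  simp [pairX, tractorMetric, canonicalX, coInner, compσ, hone]

lemma inScale_pairX (I : ∀ x, TractorFibre c x) (g : c.metrics) :
    inScale g (pairX c I) = compσ c g I :=
  funext fun x => pairX_apply I x g

lemma pairX_mem_smoothDensity (hI : IsSmoothTractor c I) : pairX c I ∈ SmoothDensity c 1 := by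
  refine ⟨fun x => ?_, fun g => inScale_pairX I g ▸ (hI g).1⟩
  obtain ⟨τ, hτ⟩ := toTractor_surjective x (I x)
  have hpair : pairX c I x = τ.1 x := by
    ext g
    rw [pairX_apply, compσ, ← hτ]
    rfl
  exact hpair ▸ τ.2.1 x

lemma splitting_tractorD (g : c.metrics) (σ : SmoothDensity c 1) (x : M) :
    splitting c g x (tractorD c σ x) = (inScale g σ.1 x, diff d (inScale g σ.1) x,
      rhoFun g.1.inner (inScale g σ.1) x) := rfl

lemma compσ_tractorD (g : c.metrics) (σ : SmoothDensity c 1) :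
    compσ c g (tractorD c σ) = inScale g σ.1 := rfl

lemma compμ_tractorD (g : c.metrics) (σ : SmoothDensity c 1) :
    compμ c g (tractorD c σ) = diff d (inScale g σ.1) := rfl

lemma compρ_tractorD (g : c.metrics) (σ : SmoothDensity c 1) :
    compρ c g (tractorD c σ) = rhoFun g.1.inner (inScale g σ.1) := rfl

lemma pairX_tractorD (σ : SmoothDensity c 1) : pairX c (tractorD c σ) = σ.1 := by
  ext x g
  rw [pairX_apply, compσ_tractorD]
  rfl

lemma tractorD_ne_zero {σ : SmoothDensity c 1} (hσ : σ ≠ 0) : ∃ x, tractorD c σ x ≠ 0 := by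
  by_contra! hzero
  refine hσ (Subtype.ext (funext fun x => funext fun g => ?_))
  rw [← pairX_tractorD σ, pairX_apply, compσ, hzero x, map_zero]
  rfl

lemma tractorMetric_tractorD (g : c.metrics) (σ : SmoothDensity c 1) (x : M) :
    tractorMetric c g x (tractorD c σ x) (tractorD c σ x) = normSq g.1.inner (inScale g σ.1) x := by
  rw [tractorMetric, splitting_tractorD, normSq]
  ring

lemma isSmoothTractor_tractorD (σ : SmoothDensity c 1) : IsSmoothTractor c (tractorD c σ) :=
  fun g => by
    rw [compσ_tractorD, compμ_tractorD, compρ_tractorD]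
    exact ⟨σ.2.2 g, contMDiff_diff (σ.2.2 g), contMDiff_rhoFun g.1 (σ.2.2 g)⟩

lemma isParallel_iff {g : c.metrics} (hσ : ContMDiff (𝓡 d) 𝓘(ℝ, ℝ) ∞ (compσ c g I)) :
    IsParallel c g I ↔ compμ c g I = diff d (compσ c g I) ∧
      (∀ x, hess g.1.inner (compσ c g I) x + compρ c g I x • metricAt g.1.inner x +
        compσ c g I x • schouten g.1.inner x = 0) ∧
      ∀ x v, diff d (compρ c g I) x v =
        coInner g.1.inner x (contract x (schouten g.1.inner x) v) (compμ c g I x) := by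
  have hμ : compμ c g I = diff d (compσ c g I) ↔
      ∀ x v, diff d (compσ c g I) x v = compμ c g I x v := by
    rw [eq_comm]
    simp only [funext_iff, DFunLike.ext_iff]
  have hmid : compμ c g I = diff d (compσ c g I) → ∀ x v,
      contract x (covForm g.1.inner (compμ c g I) x) v + compρ c g I x • g.1.inner x v +
          compσ c g I x • contract x (schouten g.1.inner x) v =
        contract x (hess g.1.inner (compσ c g I) x + compρ c g I x • metricAt g.1.inner x +
          compσ c g I x • schouten g.1.inner x) v := fun h x v => by
    rw [h, covForm_diff _ hσ, inner_eq_contract, contract_add, contract_add, contract_smul,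
      contract_smul]
  simp only [IsParallel, tractorConnection, LinearEquiv.map_eq_zero_iff, Prod.mk_eq_zero,
    forall_and, sub_eq_zero]
  rw [← hμ]
  refine and_congr_right fun h => and_congr_left' ?_
  simp only [hmid h, contract_eq_zero_iff]

lemma isParallel_tractorD (hd : 3 ≤ d) {g : c.metrics} {σ : SmoothDensity c 1}
    (h : IsAlmostEinstein c g σ.1) : IsParallel c g (tractorD c σ) := by
  rw [isParallel_iff (isSmoothTractor_tractorD σ g).1, compσ_tractorD, compμ_tractorD,
    compρ_tractorD]
  refine ⟨rfl, fun x => ?_, diff_rhoFun hd g.1 (σ.2.2 g) h⟩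
  rw [add_right_comm, ← obstructionA_eq hd, h x]

lemma exists_of_isParallel (hd : 3 ≤ d) {g : c.metrics} (hI : IsSmoothTractor c I)
    (hp : IsParallel c g I) :
    ∃ σ : SmoothDensity c 1, σ.1 = pairX c I ∧ IsAlmostEinstein c g σ.1 ∧ tractorD c σ = I := by
  obtain ⟨hμ, hhess, -⟩ := (isParallel_iff (hI g).1).1 hp
  have hρ : ∀ x, compρ c g I x = rhoFun g.1.inner (compσ c g I) x := fun x =>
    eq_rhoFun hd g.1 _ x (hhess x)
  refine ⟨⟨pairX c I, pairX_mem_smoothDensity hI⟩, rfl, fun x => ?_, funext fun x => ?_⟩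
  · rw [obstructionA_eq hd, inScale_pairX, ← hρ, add_right_comm, hhess]
  · apply (splitting c g x).injective
    rw [splitting_tractorD, inScale_pairX, ← hρ, ← hμ]
    rfl

lemma exists_ne_zero_of_isParallel (hd : 3 ≤ d) (g : c.metrics) {g' : c.metrics}
    (hI : IsSmoothTractor c I) (hI0 : ∃ x, I x ≠ 0) (hp : IsParallel c g' I) :
    ∃ σ : SmoothDensity c 1, σ.1 = pairX c I ∧ σ ≠ 0 ∧ IsAlmostEinstein c g σ.1 ∧
      tractorD c σ = I := by
  obtain ⟨σ, hσ, hE, rfl⟩ := exists_of_isParallel hd hI hp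
  obtain ⟨x, hx⟩ := hI0
  refine ⟨σ, hσ, ?_, hE.congr hd g, rfl⟩
  rintro rfl
  exact hx (map_zero (toTractor c x))

lemma scalarS_eq_neg_tractorMetric (hd : 3 ≤ d) (g g' : c.metrics) (σ : SmoothDensity c 1)
    (x : M) : scalarS g.1.inner (inScale g σ.1) x =
      -tractorMetric c g' x (tractorD c σ x) (tractorD c σ x) := by
  rw [scalarS_eq_neg_normSq, tractorMetric_tractorD, normSq_conformal hd g g']

lemma IsAlmostEinstein.exists_isAlmostScalarConstant [PreconnectedSpace M] (hd : 3 ≤ d)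
    {g : c.metrics} {σ : SmoothDensity c 1} (hσ : σ ≠ 0) (h : IsAlmostEinstein c g σ.1) :
    ∃ k, IsAlmostScalarConstant c σ.1 k := by
  obtain ⟨x₀, -⟩ := tractorD_ne_zero hσ
  refine ⟨-normSq g.1.inner (inScale g σ.1) x₀, σ.2, fun h0 => hσ (Subtype.ext h0),
    fun g' x => ?_⟩
  rw [scalarS_eq_neg_normSq, normSq_conformal hd g g',
    (isLocallyConstant_normSq hd g.1 (σ.2.2 g) h).apply_eq_of_preconnectedSpace x x₀]

lemma IsAlmostEinstein.contract_ricciAt_scaleMetric (hd : 3 ≤ d) {g : c.metrics}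
    (g' : c.metrics) {σ : SmoothDensity c 1} (h : IsAlmostEinstein c g σ.1) {x : M}
    (hx : σ.1 x g ≠ 0) (v w : TangentSpace (𝓡 d) x) :
    contract x (ricciAt (scaleMetric c g σ.1) x) v w =
      -((d : ℝ) - 1) * tractorMetric c g' x (tractorD c σ x) (tractorD c σ x) *
        scaleMetric c g σ.1 x v w := by
  have hscale : metricAt (scaleMetric c g σ.1) x =
      ((inScale g σ.1 x) ^ 2)⁻¹ • metricAt g.1.inner x := by
    ext i j
    simp [metricAt_apply, scaleMetric]
  rw [ricciAt_scaleMetric hd h hx, hscale, contract_smul, contract_smul, ← inner_eq_contract,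
    tractorMetric_tractorD, normSq_conformal hd g g']
  rfl

end ParallelTractors

end Tractor

end

theorem mainTheorem3 {n : ℕ} (hn : 2 ≤ n) {M : Type*} [TopologicalSpace M] [T2Space M]
    [SecondCountableTopology M] [ChartedSpace (Model (n + 1)) M] [IsManifold (𝓡 (n + 1)) ∞ M]
    (c : ConformalStructure (n + 1) M) :
    (∀ (g g' : c.metrics) (σ : SmoothDensity c 1), σ ≠ 0 → IsAlmostEinstein c g σ.1 →
      IsSmoothTractor c (tractorD c σ) ∧ (∃ x, tractorD c σ x ≠ 0) ∧
        IsParallel c g' (tractorD c σ) ∧ pairX c (tractorD c σ) = σ.1) ∧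
    (∀ (g g' : c.metrics) (I : ∀ x, TractorFibre c x),
      IsSmoothTractor c I → (∃ x, I x ≠ 0) → IsParallel c g' I →
        ∃ σ : SmoothDensity c 1, σ.1 = pairX c I ∧ σ ≠ 0 ∧ IsAlmostEinstein c g σ.1 ∧
          tractorD c σ = I) ∧
    (∀ (g : c.metrics) (I : ∀ x, TractorFibre c x),
      IsSmoothTractor c I → (∃ x, I x ≠ 0) → IsParallel c g I →
        (∀ (g₁ g₂ : c.metrics) (x : M), scalarS g₁.1.inner (inScale g₁ (pairX c I)) x =
          -tractorMetric c g₂ x (I x) (I x)) ∧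
        (PreconnectedSpace M → ∃ k : ℝ, IsAlmostScalarConstant c (pairX c I) k ∧
          ∀ (g₂ : c.metrics) (x : M), k = -tractorMetric c g₂ x (I x) (I x)) ∧
        (∀ (g₁ g₂ : c.metrics) (x : M), pairX c I x g₁ ≠ 0 → ∀ v w : TangentSpace (𝓡 (n + 1)) x,
          contract x (ricciAt (scaleMetric c g₁ (pairX c I)) x) v w =
            -(n : ℝ) * tractorMetric c g₂ x (I x) (I x) *
              scaleMetric c g₁ (pairX c I) x v w)) := by
  have hd : 3 ≤ n + 1 := by omega
  refine ⟨fun g g' σ hσ hE => ⟨isSmoothTractor_tractorD σ, tractorD_ne_zero hσ,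
    isParallel_tractorD hd (hE.congr hd g'), pairX_tractorD σ⟩,
    fun g g' I hI hI0 hp => exists_ne_zero_of_isParallel hd g hI hI0 hp, fun g I hI hI0 hp => ?_⟩
  obtain ⟨σ, hσI, hσ, hE, rfl⟩ := exists_ne_zero_of_isParallel hd g hI hI0 hp
  rw [← hσI]
  have hS := fun g₁ g₂ => scalarS_eq_neg_tractorMetric hd g₁ g₂ σ
  refine ⟨hS, fun _ => ?_, fun g₁ g₂ x hx v w => ?_⟩
  · obtain ⟨k, hk⟩ := hE.exists_isAlmostScalarConstant hd hσ
    exact ⟨k, hk, fun g₂ x => (hk.2.2 g x).symm.trans (hS g g₂ x)⟩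
  · rw [(hE.congr hd g₁).contract_ricciAt_scaleMetric hd g₂ hx]
    push_cast
    ring
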